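/- **Setting.** Let $\Omega=(l_1,l_2)\times(l_3,l_4)$, let $\psi$ be smooth in $\Omega$ with $\nabla\psi\neq0$ on $\Gamma=\{q\in\Omega:\psi(q)=0\}$, and let $\Omega^{\pm}=\{q\in\Omega:\pm\psi(q)>0\}$. Let $u$ be a solution of $$-\nabla\cdot(a\nabla u)=f\ \text{in }\Omega\setminus\Gamma,\qquad [u]=g_1,\quad [a\nabla u\cdot\vec n]=g_2\ \text{on }\Gamma,\qquad u=g\ \text{on }\partial\Omega,$$ (the last condition being imposed off $\overline\Gamma$), where $[\cdot]$ is the limit from $\Omega^+$ minus the limit from $\Omega^-$ and $\vec n$ is the unit normal of $\Gamma$ pointing into $\Omega^+$. Assume that $g_1,g_2,g$ are smooth; that $a,f$ are smooth in $\Omega^+$ and in $\Omega^-$, with all partial derivatives having one-sided limits at the points of $\Gamma$; that $a$ is positive in $\Omega^\pm$ and its one-sided limits on $\Gamma$ are positive; and that $u$ has uniformly continuous partial derivatives of total order up to five in each of $\Omega^\pm$. Write $a_\pm,f_\pm,u_\pm$ for the restrictions to $\Omega^\pm$, extended to $\Gamma$ by limits. Fix a base point $p=(x^*,y^*)\in\Gamma$,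 and let the superscript $(m,n)$ denote the value of $\partial_x^m\partial_y^n$ at $p$ (one-sided limits for $a_\pm,f_\pm,u_\pm$). Let $t\mapsto p+(r(t),s(t))$, $r(0)=s(0)=0$, be a smooth regular parametrization of $\Gamma$ near $p$ with $(s',-r')$ pointing into $\Omega^+$. Put $\Lambda_K=\{(m,n)\in\mathbb N_0^2: m+n\le K\}$ and $\Lambda_K^1=\{(m,n)\in\Lambda_K: m\le1\}$. **Coefficients.** Solving the equation $a_\pm u_{xx}+a_\pm u_{yy}+(a_\pm)_xu_x+(a_\pm)_yu_y=-f_\pm$ and its first derivatives at $p$ for $u_\pm^{(2,0)},u_\pm^{(2,1)},u_\pm^{(3,0)}$ writes the cubic Taylor polynomial of $u_\pm$ at $p$ uniquely as $\sum_{(m,n)\in\Lambda_3^1}u_\pm^{(m,n)}G^\pm_{m,n}+\sum_{(m,n)\in\Lambda_1}f_\pm^{(m,n)}H^\pm_{m,n}$, with polynomials $G^\pm_{m,n},H^\pm_{m,n}$ depending only on $a_\pm^{(i,j)}$, $(i,j)\in\Lambda_2$. Insert these expressions, and the Taylor polynomials of $a_\pm$ (degree 2), $g_1$ (degree 3) and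 $g_2$ (degree 2), into $u_+-u_-=g_1$ and $(a_+\nabla u_+-a_-\nabla u_-)\cdot(s',-r')=g_2\sqrt{r'^2+s'^2}$ along the curve, and compare the coefficients of $t^0,\dots,t^3$, respectively $t^0,\dots,t^2$; solving order by order gives $$u_-^{(m',n')}=\sum_{\Lambda_3^1}T^{u_+}_{m',n',m,n}u_+^{(m,n)}+\sum_{\Lambda_1}\bigl(T^+_{m',n',m,n}f_+^{(m,n)}+T^-_{m',n',m,n}f_-^{(m,n)}\bigr)+\sum_{\Lambda_3}T^{g_1}_{m',n',m,n}g_1^{(m,n)}+\sum_{\Lambda_2}T^{g_2}_{m',n',m,n}g_2^{(m,n)}$$ for $(m',n')\in\Lambda_3^1$, and thereby defines the transmission coefficients $T$. **Scheme.** For $v_0,w_0\in(-1,1)$ and $h>0$ consider the nine-point stencil with centre $p+(v_0h,w_0h)$, that is, the points $p+((v_0+k)h,(w_0+\ell)h)$ with $k,\ell\in\{-1,0,1\}$. Let $d^+$ and $d^-$ be the sets of indices $(k,\ell)$ of the stencil points with $\psi\ge0$ and with $\psi<0$; the centre is irregular if both are nonempty. The value of $u$ at a stencil point of $\Gamma$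 is $u_+$. For stencil coefficients $C_{k,\ell}(h)$ put $$I^\pm_{m,n}(h)=\sum_{(k,\ell)\in d^\pm}C_{k,\ell}(h)G^\pm_{m,n}((v_0+k)h,(w_0+\ell)h),\qquad I_{m,n}=I^+_{m,n}+\sum_{(m',n')\in\Lambda_3^1}I^-_{m',n'}T^{u_+}_{m',n',m,n},$$ $$J^\pm_{m,n}(h)=\sum_{(k,\ell)\in d^\pm}C_{k,\ell}(h)H^\pm_{m,n}((v_0+k)h,(w_0+\ell)h)+\sum_{(m',n')\in\Lambda_3^1}I^-_{m',n'}(h)T^\pm_{m',n',m,n},$$ $$J^{g_i}_{m,n}(h)=\sum_{(m',n')\in\Lambda_3^1}I^-_{m',n'}(h)T^{g_i}_{m',n',m,n}\quad(i=1,2),$$ and let the consistency error be $$E(h)=\sum_{k,\ell}C_{k,\ell}(h)\,u\bigl(p+((v_0+k)h,(w_0+\ell)h)\bigr)-\sum_{\Lambda_1}\bigl(f_+^{(m,n)}J^+_{m,n}(h)+f_-^{(m,n)}J^-_{m,n}(h)\bigr)-\sum_{\Lambda_3}g_1^{(m,n)}J^{g_1}_{m,n}(h)-\sum_{\Lambda_2}g_2^{(m,n)}J^{g_2}_{m,n}(h).$$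 Third-order consistency at an irregular point means $E(h)=O(h^4)$ for stencil coefficients that do not all vanish at $h=0$. **Theorem.** 1. Let $p\in\Gamma$, a parametrization $(r,s)$ as above, $v_0,w_0\in(-1,1)$, and a partition of $\{-1,0,1\}^2$ into two nonempty sets $d^+,d^-$ be given. Then the system $I_{m,n}(h)=O(h^4)$ as $h\to0$, $(m,n)\in\Lambda_3^1$, has a nontrivial solution: polynomials $C_{k,\ell}(h)$ of degree at most $3$ with $C_{k,\ell}(0)\ne0$ for at least one $(k,\ell)$. For every nontrivial solution the scheme is third-order consistent: $E(h)=O(h^4)$ as $h\to0^+$, along those $h$ for which $\Gamma$ splits the stencil with centre $p+(v_0h,w_0h)$ into $d^+$ and $d^-$. 2. The bound is uniform: for every compact $S\subset\Gamma$ and every $B$ there are $K$ and $h_0>0$ such that, for all $p\in S$, all parametrizations as above, all $v_0,w_0\in(-1,1)$ and all $0<h<h_0$ for which the centre $p+(v_0h,w_0h)$ is irregular (with $d^\pm$ its stencil sets), and all real stencil values $C_{k,\ell}$ with $|C_{k,\ell}|\le B$ and $|I_{m,n}(h)|\le Bh^4$ for $(m,n)\in\Lambda_3^1$, one has $|E(h)|\le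 Kh^4$. -/

import Mathlib

open Set Filter Topology
open scoped ContDiff Nat

noncomputable section

namespace InterfaceScheme

/-! ### Partial derivatives and the rectangular elliptic interface problem -/

/-- The partial derivative in the first variable. -/
def pdx (g : ℝ × ℝ → ℝ) (q : ℝ × ℝ) : ℝ := fderiv ℝ g q (1, 0)

/-- The partial derivative in the second variable. -/
def pdy (g : ℝ × ℝ → ℝ) (q : ℝ × ℝ) : ℝ := fderiv ℝ g q (0, 1)

/-- The partial derivative of order `m` in the first and `n` in the second variable. -/
def pd (m n : ℕ) (g : ℝ × ℝ → ℝ) : ℝ × ℝ → ℝ := pdx^[m] (pdy^[n] g)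

/-- The data of the problem: the rectangle `(l₁, l₂) × (l₃, l₄)`, the level set function `ψ`, the
coefficient `a`, the source `f`, the jumps `g₁`, `g₂` and the Dirichlet data `g`. -/
structure Problem where
  l₁ : ℝ
  l₂ : ℝ
  l₃ : ℝ
  l₄ : ℝ
  ψ : ℝ × ℝ → ℝ
  a : ℝ × ℝ → ℝ
  f : ℝ × ℝ → ℝ
  g₁ : ℝ × ℝ → ℝ
  g₂ : ℝ × ℝ → ℝ
  g : ℝ × ℝ → ℝ

namespace Problem

variable (P : Problem)

/-- The open rectangle. -/
def Ω : Set (ℝ × ℝ) := Ioo P.l₁ P.l₂ ×ˢ Ioo P.l₃ P.l₄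

/-- The interface. -/
def Γ : Set (ℝ × ℝ) := {q | q ∈ P.Ω ∧ P.ψ q = 0}

/-- The subregion where the level set function is positive. -/
def Ωp : Set (ℝ × ℝ) := {q | q ∈ P.Ω ∧ 0 < P.ψ q}

/-- The subregion where the level set function is negative. -/
def Ωm : Set (ℝ × ℝ) := {q | q ∈ P.Ω ∧ P.ψ q < 0}

/-- The one-sided limit of `g` from the positive side: `g₊` at points of the closure. -/
def limP (g : ℝ × ℝ → ℝ) : ℝ × ℝ → ℝ := extendFrom P.Ωp g

/-- The one-sided limit of `g` from the negative side. -/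
def limM (g : ℝ × ℝ → ℝ) : ℝ × ℝ → ℝ := extendFrom P.Ωm g

/-- The jump `[g]` across the interface. -/
def jump (g : ℝ × ℝ → ℝ) (q : ℝ × ℝ) : ℝ := P.limP g q - P.limM g q

/-- The unit normal of the interface pointing towards the positive side. -/
def normal (q : ℝ × ℝ) : ℝ × ℝ :=
  (pdx P.ψ q / √(pdx P.ψ q ^ 2 + pdy P.ψ q ^ 2), pdy P.ψ q / √(pdx P.ψ q ^ 2 + pdy P.ψ q ^ 2))

/-- `g` is smooth in the subregion `S`, and all its partial derivatives have limits
at the points of the interface. -/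
def SmoothUpToInterface (S : Set (ℝ × ℝ)) (g : ℝ × ℝ → ℝ) : Prop :=
  ContDiffOn ℝ ∞ g S ∧
    ∀ m n : ℕ, ∀ q ∈ P.Γ, ∃ L : ℝ, Tendsto (pd m n g) (𝓝[S] q) (𝓝 L)

/-- The standing assumptions on the data. -/
structure Admissible : Prop where
  lt_x : P.l₁ < P.l₂
  lt_y : P.l₃ < P.l₄
  smooth_ψ : ContDiffOn ℝ ∞ P.ψ P.Ω
  /-- the interface is a regular level set -/
  regular : ∀ q ∈ P.Γ, pdx P.ψ q ≠ 0 ∨ pdy P.ψ q ≠ 0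
  smooth_g₁ : ContDiffOn ℝ ∞ P.g₁ P.Ω
  smooth_g₂ : ContDiffOn ℝ ∞ P.g₂ P.Ω
  smooth_g : ContDiff ℝ ∞ P.g
  smooth_aP : P.SmoothUpToInterface P.Ωp P.a
  smooth_aM : P.SmoothUpToInterface P.Ωm P.a
  smooth_fP : P.SmoothUpToInterface P.Ωp P.f
  smooth_fM : P.SmoothUpToInterface P.Ωm P.f
  pos_a : ∀ q ∈ P.Ω \ P.Γ, 0 < P.a q
  pos_aP : ∀ q ∈ P.Γ, 0 < P.limP P.a q
  pos_aM : ∀ q ∈ P.Γ, 0 < P.limM P.a q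

/-- `u` has uniformly continuous partial derivatives of total order up to five in `S`. -/
def PiecewiseRegular (S : Set (ℝ × ℝ)) (u : ℝ × ℝ → ℝ) : Prop :=
  ContDiffOn ℝ 5 u S ∧ ∀ m n : ℕ, m + n ≤ 5 → UniformContinuousOn (pd m n u) S

/-- `u` is a piecewise smooth solution of the elliptic interface problem. -/
structure IsSolution (u : ℝ × ℝ → ℝ) : Prop where
  regP : PiecewiseRegular P.Ωp u
  regM : PiecewiseRegular P.Ωm u
  /-- `-∇ · (a ∇ u) = f` off the interface -/
  pde : ∀ q ∈ P.Ω \ P.Γ,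
    -(pdx (fun z ↦ P.a z * pdx u z) q + pdy (fun z ↦ P.a z * pdy u z) q) = P.f q
  /-- `[u] = g₁` on the interface -/
  jump_u : ∀ q ∈ P.Γ, P.jump u q = P.g₁ q
  /-- `[a ∇ u · n] = g₂` on the interface -/
  jump_flux : ∀ q ∈ P.Γ,
    P.jump (fun z ↦ P.a z * pdx u z * (P.normal q).1 + P.a z * pdy u z * (P.normal q).2) q
      = P.g₂ q
  /-- `u = g` on the boundary of the rectangle -/
  dirichlet : ∀ q ∈ frontier P.Ω, q ∉ closure P.Γ → Tendsto u (𝓝[P.Ω] q) (𝓝 (P.g q))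

/-- `t ↦ p + (r t, s t)` is a smooth regular parametrization of the interface near `p`,
oriented so that the tangent rotated clockwise points to the positive side. -/
structure IsLocalParam (p : ℝ × ℝ) (r s : ℝ → ℝ) : Prop where
  r_zero : r 0 = 0
  s_zero : s 0 = 0
  param : ∃ ε > 0, ContDiffOn ℝ ∞ r (Ioo (-ε) ε) ∧ ContDiffOn ℝ ∞ s (Ioo (-ε) ε) ∧
    ∀ t ∈ Ioo (-ε) ε, p + (r t, s t) ∈ P.Γ ∧ 0 < deriv r t ^ 2 + deriv s t ^ 2
  oriented : 0 < pdx P.ψ p * deriv s 0 - pdy P.ψ p * deriv r 0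

end Problem

/-! ### Reduction of the derivatives by the equation -/

/-- A jet: `J (m, n)` stands for the derivative of order `(m, n)` at the base point. -/
abbrev Jet := ℕ × ℕ → ℝ

/-- `Λ_K`: the orders `(m, n)` with `m + n ≤ K`. -/
def Lam (K : ℕ) : Finset (ℕ × ℕ) :=
  (Finset.range (K + 1) ×ˢ Finset.range (K + 1)).filter fun k ↦ k.1 + k.2 ≤ K

/-- `Λ_K^1`: the orders in `Λ_K` with at most one derivative in the first variable. -/
def Lam1 (K : ℕ) : Finset (ℕ × ℕ) := (Lam K).filter fun k ↦ k.1 ≤ 1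

/-- The value of `u_xx` obtained from `a u_xx + a u_yy + a_x u_x + a_y u_y = -f`. -/
def red20 (α U F : Jet) : ℝ :=
  -U (0, 2) - (α (1, 0) * U (1, 0) + α (0, 1) * U (0, 1) + F (0, 0)) / α (0, 0)

/-- All derivatives of `u` of total order at most three, expressed through the free ones
`U (m, n)`, `(m, n) ∈ Λ_3^1`, and the derivatives `F` of `f`; `α` is the jet of `a`. The entries
`(2, 1)` and `(3, 0)` come from the equation differentiated in `y`, respectively in `x`. -/
def fullJet (α U F : Jet) : Jet
  | (2, 0) => red20 α U F
  | (2, 1) => -U (0, 3) - (α (0, 1) * red20 α U F + 2 * α (0, 1) * U (0, 2) + α (1, 1) * U (1, 0)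
      + α (1, 0) * U (1, 1) + α (0, 2) * U (0, 1) + F (0, 1)) / α (0, 0)
  | (3, 0) => -U (1, 2) - (2 * α (1, 0) * red20 α U F + α (1, 0) * U (0, 2) + α (2, 0) * U (1, 0)
      + α (1, 1) * U (0, 1) + α (0, 1) * U (1, 1) + F (1, 0)) / α (0, 0)
  | k => U k

/-- The polynomial `∑_{(m, n) ∈ Λ_K} J (m, n) x ^ m y ^ n / (m! n!)`. -/
def taylorPoly (K : ℕ) (J : Jet) (z : ℝ × ℝ) : ℝ :=
  ∑ k ∈ Lam K, J k / (k.1 ! * k.2 !) * z.1 ^ k.1 * z.2 ^ k.2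

/-- `G_{m,n}`: the factor of `u^{(m,n)}` in the reduced Taylor polynomial of degree three. -/
def G (α : Jet) (k : ℕ × ℕ) : ℝ × ℝ → ℝ := taylorPoly 3 (fullJet α (Pi.single k 1) 0)

/-- `H_{m,n}`: the factor of `f^{(m,n)}` in the reduced Taylor polynomial of degree three. -/
def H (α : Jet) (k : ℕ × ℕ) : ℝ × ℝ → ℝ := taylorPoly 3 (fullJet α 0 (Pi.single k 1))

/-! ### Transmission coefficients -/

/-- The Taylor coefficient of `t ^ p` at `t = 0`. -/
def coef (y : ℝ → ℝ) (p : ℕ) : ℝ := iteratedDeriv p y 0 / p !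

/-- `a ∇ Q · (ds/dt, -dr/dt)` along the curve, with `a` replaced by its quadratic Taylor polynomial. -/
def fluxAlong (α : Jet) (r s : ℝ → ℝ) (Q : ℝ × ℝ → ℝ) (t : ℝ) : ℝ :=
  taylorPoly 2 α (r t, s t) * (pdx Q (r t, s t) * deriv s t - pdy Q (r t, s t) * deriv r t)

/-- The data that determine the coefficients of the scheme: the jets of `a₊` and `a₋` at the base
point, the curve, the position `(v, w)` of the centre relative to the base point in units of `h`,
and the set `d⁺` of the stencil points on the positive side. -/
structure Config where
  aP : Jet
  aM : Jet
  r : ℝ → ℝ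
  s : ℝ → ℝ
  v : ℝ
  w : ℝ
  d : Finset (ℤ × ℤ)

/-- The nine stencil indices `{-1, 0, 1}²`. -/
def stencil : Finset (ℤ × ℤ) := Finset.Icc (-1) 1 ×ˢ Finset.Icc (-1) 1

namespace Config

variable (c : Config)

/-- `g⁺_{m,n,p}` -/
def gP (k : ℕ × ℕ) (p : ℕ) : ℝ := coef (fun t ↦ G c.aP k (c.r t, c.s t)) p
/-- `g⁻_{m,n,p}` -/
def gM (k : ℕ × ℕ) (p : ℕ) : ℝ := coef (fun t ↦ G c.aM k (c.r t, c.s t)) p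
/-- `h⁺_{m,n,p}` -/
def hP (k : ℕ × ℕ) (p : ℕ) : ℝ := coef (fun t ↦ H c.aP k (c.r t, c.s t)) p
/-- `h⁻_{m,n,p}` -/
def hM (k : ℕ × ℕ) (p : ℕ) : ℝ := coef (fun t ↦ H c.aM k (c.r t, c.s t)) p
/-- The flux coefficient of `t ^ p` of `G⁺_{m,n}`. -/
def gtP (k : ℕ × ℕ) (p : ℕ) : ℝ := coef (fluxAlong c.aP c.r c.s (G c.aP k)) p
/-- The flux coefficient of `t ^ p` of `G⁻_{m,n}`. -/
def gtM (k : ℕ × ℕ) (p : ℕ) : ℝ := coef (fluxAlong c.aM c.r c.s (G c.aM k)) p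
/-- The flux coefficient of `t ^ p` of `H⁺_{m,n}`. -/
def htP (k : ℕ × ℕ) (p : ℕ) : ℝ := coef (fluxAlong c.aP c.r c.s (H c.aP k)) p
/-- The flux coefficient of `t ^ p` of `H⁻_{m,n}`. -/
def htM (k : ℕ × ℕ) (p : ℕ) : ℝ := coef (fluxAlong c.aM c.r c.s (H c.aM k)) p
/-- `r_{m,n,p}` -/
def rc (k : ℕ × ℕ) (p : ℕ) : ℝ := coef (fun t ↦ c.r t ^ k.1 * c.s t ^ k.2) p
/-- The coefficient of `t ^ p` of `r ^ m s ^ n` times the speed of the curve. -/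
def rtc (k : ℕ × ℕ) (p : ℕ) : ℝ :=
  coef (fun t ↦ c.r t ^ k.1 * c.s t ^ k.2 * √(deriv c.r t ^ 2 + deriv c.s t ^ 2)) p

/-- The known part of the coefficient of `t ^ p` in the expansion of `[u] = g₁`. -/
def rhsU (fP fM g₁ : Jet) (p : ℕ) : ℝ :=
  ∑ k ∈ Lam 1, (fM k * c.hM k p - fP k * c.hP k p)
    + ∑ k ∈ Lam 3, g₁ k / (k.1 ! * k.2 !) * c.rc k p

/-- The known part of the coefficient of `t ^ p` in the expansion of `[a ∇ u · n] = g₂`. -/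
def rhsFlux (fP fM g₂ : Jet) (p : ℕ) : ℝ :=
  ∑ k ∈ Lam 1, (fM k * c.htM k p - fP k * c.htP k p)
    + ∑ k ∈ Lam 2, g₂ k / (k.1 ! * k.2 !) * c.rtc k p

/-- The derivatives `u₋^{(m,n)}`, `(m, n) ∈ Λ_p^1`, obtained from those of `u₊`, `f₊`, `f₋`, `g₁`,
`g₂` by solving successively, for orders `1, …, p`, the two by two linear systems
`g⁻_{0,q,q} X + g⁻_{1,q-1,q} Y = b₁`, `g̃⁻_{0,q,q-1} X + g̃⁻_{1,q-1,q-1} Y = b₂` for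
`X = u₋^{(0,q)}`, `Y = u₋^{(1,q-1)}` that result from comparing the coefficients of `t ^ q` in
`[u] = g₁` and of `t ^ (q-1)` in `[a ∇ u · n] = g₂` along the curve. -/
def minusJet (uP fP fM g₁ g₂ : Jet) : ℕ → Jet
  | 0 => Pi.single (0, 0) (uP (0, 0) - g₁ (0, 0))
  | p + 1 =>
    let V : Jet := minusJet uP fP fM g₁ g₂ p
    let b₁ : ℝ := ∑ k ∈ Lam1 (p + 1), uP k * c.gP k (p + 1) - ∑ k ∈ Lam1 p, V k * c.gM k (p + 1)
      - c.rhsU fP fM g₁ (p + 1)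
    let b₂ : ℝ := ∑ k ∈ Lam1 (p + 1), uP k * c.gtP k p - ∑ k ∈ Lam1 p, V k * c.gtM k p
      - c.rhsFlux fP fM g₂ p
    let D : ℝ := c.gM (0, p + 1) (p + 1) * c.gtM (1, p) p - c.gM (1, p) (p + 1) * c.gtM (0, p + 1) p
    V + Pi.single (0, p + 1) ((c.gtM (1, p) p * b₁ - c.gM (1, p) (p + 1) * b₂) / D)
      + Pi.single (1, p) ((c.gM (0, p + 1) (p + 1) * b₂ - c.gtM (0, p + 1) p * b₁) / D)

/-- `T^{u₊}_{j,k}` -/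
def Tu (j k : ℕ × ℕ) : ℝ := c.minusJet (Pi.single k 1) 0 0 0 0 3 j
/-- `T^{+}_{j,k}` -/
def TfP (j k : ℕ × ℕ) : ℝ := c.minusJet 0 (Pi.single k 1) 0 0 0 3 j
/-- `T^{-}_{j,k}` -/
def TfM (j k : ℕ × ℕ) : ℝ := c.minusJet 0 0 (Pi.single k 1) 0 0 3 j
/-- `T^{g₁}_{j,k}` -/
def Tg1 (j k : ℕ × ℕ) : ℝ := c.minusJet 0 0 0 (Pi.single k 1) 0 3 j
/-- `T^{g₂}_{j,k}` -/
def Tg2 (j k : ℕ × ℕ) : ℝ := c.minusJet 0 0 0 0 (Pi.single k 1) 3 j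

/-! ### The scheme -/

/-- The stencil point of index `e`, relative to the base point. -/
def node (h : ℝ) (e : ℤ × ℤ) : ℝ × ℝ := ((c.v + e.1) * h, (c.w + e.2) * h)

/-- `I⁺_{m,n}(h)`, for stencil coefficients with the values `C` at `h`. -/
def IP (C : ℤ × ℤ → ℝ) (h : ℝ) (k : ℕ × ℕ) : ℝ := ∑ e ∈ c.d, C e * G c.aP k (c.node h e)
/-- `I⁻_{m,n}(h)` -/
def IM (C : ℤ × ℤ → ℝ) (h : ℝ) (k : ℕ × ℕ) : ℝ :=
  ∑ e ∈ stencil \ c.d, C e * G c.aM k (c.node h e)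
/-- `J^{+,0}_{m,n}(h)` -/
def JP0 (C : ℤ × ℤ → ℝ) (h : ℝ) (k : ℕ × ℕ) : ℝ := ∑ e ∈ c.d, C e * H c.aP k (c.node h e)
/-- `J^{-,0}_{m,n}(h)` -/
def JM0 (C : ℤ × ℤ → ℝ) (h : ℝ) (k : ℕ × ℕ) : ℝ :=
  ∑ e ∈ stencil \ c.d, C e * H c.aM k (c.node h e)

/-- `I_{m,n}(h)` -/
def I (C : ℤ × ℤ → ℝ) (h : ℝ) (k : ℕ × ℕ) : ℝ :=
  c.IP C h k + ∑ j ∈ Lam1 3, c.IM C h j * c.Tu j k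
/-- `J⁺_{m,n}(h)` -/
def JP (C : ℤ × ℤ → ℝ) (h : ℝ) (k : ℕ × ℕ) : ℝ :=
  c.JP0 C h k + ∑ j ∈ Lam1 3, c.IM C h j * c.TfP j k
/-- `J⁻_{m,n}(h)` -/
def JM (C : ℤ × ℤ → ℝ) (h : ℝ) (k : ℕ × ℕ) : ℝ :=
  c.JM0 C h k + ∑ j ∈ Lam1 3, c.IM C h j * c.TfM j k
/-- `J^{g₁}_{m,n}(h)` -/
def Jg1 (C : ℤ × ℤ → ℝ) (h : ℝ) (k : ℕ × ℕ) : ℝ := ∑ j ∈ Lam1 3, c.IM C h j * c.Tg1 j k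
/-- `J^{g₂}_{m,n}(h)` -/
def Jg2 (C : ℤ × ℤ → ℝ) (h : ℝ) (k : ℕ × ℕ) : ℝ := ∑ j ∈ Lam1 3, c.IM C h j * c.Tg2 j k

/-- `C` is a nontrivial solution of `I_{m,n}(h) = O(h^4)`, `(m, n) ∈ Λ_3^1`: nine polynomials in `h`
of degree less than four that do not all vanish at `h = 0`. -/
structure IsNontrivialSolution (C : ℤ × ℤ → Polynomial ℝ) : Prop where
  degree_lt : ∀ e ∈ stencil, (C e).degree < 4
  nontrivial : ∃ e ∈ stencil, (C e).coeff 0 ≠ 0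
  system : ∀ k ∈ Lam1 3,
    (fun h : ℝ ↦ c.I (fun e ↦ (C e).eval h) h k) =O[𝓝 0] fun h : ℝ ↦ h ^ 4

end Config

namespace Problem

variable (P : Problem)

/-- The stencil point of index `e` of the compact stencil with centre `x` and mesh size `h`. -/
def gridPoint (x : ℝ × ℝ) (h : ℝ) (e : ℤ × ℤ) : ℝ × ℝ := (x.1 + e.1 * h, x.2 + e.2 * h)

open Classical in
/-- `d⁺`: the indices of the stencil points with `ψ ≥ 0`. -/
def dP (x : ℝ × ℝ) (h : ℝ) : Finset (ℤ × ℤ) := stencil.filter fun e ↦ 0 ≤ P.ψ (gridPoint x h e)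

open Classical in
/-- `d⁻`: the indices of the stencil points with `ψ < 0`. -/
def dM (x : ℝ × ℝ) (h : ℝ) : Finset (ℤ × ℤ) := stencil.filter fun e ↦ P.ψ (gridPoint x h e) < 0

/-- The centre `x` is irregular: the interface splits the stencil. -/
def IsIrregular (x : ℝ × ℝ) (h : ℝ) : Prop := (P.dP x h).Nonempty ∧ (P.dM x h).Nonempty

/-- The jet at `p` of `g₊`. -/
def jetP (g : ℝ × ℝ → ℝ) (p : ℝ × ℝ) : Jet := fun k ↦ P.limP (pd k.1 k.2 g) p

/-- The jet at `p` of `g₋`. -/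
def jetM (g : ℝ × ℝ → ℝ) (p : ℝ × ℝ) : Jet := fun k ↦ P.limM (pd k.1 k.2 g) p

/-- The configuration at the base point `p` for the centre `p + (v h, w h)`. -/
def config (p : ℝ × ℝ) (r s : ℝ → ℝ) (v w : ℝ) (d : Finset (ℤ × ℤ)) : Config :=
  ⟨P.jetP P.a p, P.jetM P.a p, r, s, v, w, d⟩

open Classical in
/-- The value of the exact solution at a stencil point; points of the interface count as
points of the positive side. -/
def exactValue (u : ℝ × ℝ → ℝ) (q : ℝ × ℝ) : ℝ := if 0 ≤ P.ψ q then P.limP u q else P.limM u q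

/-- The right-hand side of the scheme at the base point `p`. -/
def schemeRhs (p : ℝ × ℝ) (c : Config) (C : ℤ × ℤ → ℝ) (h : ℝ) : ℝ :=
  ∑ k ∈ Lam 1, P.jetP P.f p k * c.JP C h k + ∑ k ∈ Lam 1, P.jetM P.f p k * c.JM C h k
    + ∑ k ∈ Lam 3, pd k.1 k.2 P.g₁ p * c.Jg1 C h k + ∑ k ∈ Lam 2, pd k.1 k.2 P.g₂ p * c.Jg2 C h k

/-- The consistency error: the residual of the scheme at the exact solution, for the centre
`p + (v h, w h)`. -/
def consistencyError (u : ℝ × ℝ → ℝ) (p : ℝ × ℝ) (c : Config) (C : ℤ × ℤ → ℝ) (h : ℝ) : ℝ :=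
  ∑ e ∈ stencil, C e * P.exactValue u (gridPoint (p + (c.v * h, c.w * h)) h e)
    - P.schemeRhs p c C h

end Problem

end InterfaceScheme

end

noncomputable section

namespace InterfaceScheme

/-! ### Iterated partial derivatives -/

/-! Replace `u` at each stencil point by the cubic Taylor polynomial at `p` of the side on which the
point lies. The equation turns these polynomials into combinations of the `G` and `H`, with the free
derivatives of `u₊`, `u₋` and the derivatives of `f₊`, `f₋` as factors. The interface conditions
express the free derivatives of `u₋` through those of `u₊` and the data. After this substitution all
terms in the data cancel against the right-hand side of the scheme. What remains is the exact
identity `consistencyError_eq`: the error is the sum of `u₊^{(m,n)} I_{m,n}(h)` plus the Taylor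
remainders. As the stencil points are within `2h` of `p`, every term is `O(h^4)`. Only the
derivatives of `u₊` and the Taylor constants enter the bound, never the size of the transmission
coefficients or the choice of the parametrization; hence compactness of `S` suffices for uniformity.

Three ingredients need work. Taylor's formula (`taylor_remainder`) must hold up to the interface,
uniformly in the base point, although `Ω⁺` and `Ω⁻` are not convex: near a regular point of the
level set, two points on one side are joined on that side by a path of comparable length
(`locallyQuasiconvexAt_of_regular`), and integrating the derivative bounds along such paths gives
the remainder.

The transmission relation (`transmission`) comes from inserting the Taylor polynomials into the jump
conditions along the curve. The errors are `O(t^4)` and `O(t^3)`, so the Taylor coefficients agree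
below these orders. The resulting linear system is triangular in the order of the derivatives, and
its two by two blocks are invertible because `a₋(p)` and the speed of the curve are nonzero
(`det_ne_zero`, `minusJet_eq`).

Nontrivial stencils exist because seven linear equations over the polynomials in `h` are imposed on
nine unknowns; dividing out powers of `h` makes the solution nonzero at `h = 0`, and reducing modulo
`h^4` bounds its degree (`exists_polynomial_solution`). -/

lemma fderiv_eq_pd (g : ℝ × ℝ → ℝ) (q e : ℝ × ℝ) :
    fderiv ℝ g q e = e.1 * pdx g q + e.2 * pdy g q := by
  have h : e = e.1 • ((1 : ℝ), (0 : ℝ)) + e.2 • ((0 : ℝ), (1 : ℝ)) := by ext <;> simp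
  conv_lhs => rw [h, map_add, map_smul, map_smul]
  rfl

lemma norm_fderiv_le (g : ℝ × ℝ → ℝ) (q : ℝ × ℝ) : ‖fderiv ℝ g q‖ ≤ |pdx g q| + |pdy g q| := by
  refine ContinuousLinearMap.opNorm_le_bound _ (by positivity) fun e ↦ ?_
  rw [fderiv_eq_pd, Real.norm_eq_abs]
  have h1 : |e.1| ≤ ‖e‖ := norm_fst_le e
  have h2 : |e.2| ≤ ‖e‖ := norm_snd_le e
  calc _ ≤ |e.1 * pdx g q| + |e.2 * pdy g q| := abs_add_le _ _
    _ = |pdx g q| * |e.1| + |pdy g q| * |e.2| := by rw [abs_mul, abs_mul]; ring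
    _ ≤ |pdx g q| * ‖e‖ + |pdy g q| * ‖e‖ := by gcongr
    _ = _ := by ring

lemma pdx_congr {f g : ℝ × ℝ → ℝ} {q : ℝ × ℝ} (h : f =ᶠ[𝓝 q] g) : pdx f q = pdx g q := by
  simp only [pdx, h.fderiv_eq]

lemma pd_zero (g : ℝ × ℝ → ℝ) : pd 0 0 g = g := rfl

lemma pdx_pd (m n : ℕ) (g : ℝ × ℝ → ℝ) : pdx (pd m n g) = pd (m + 1) n g :=
  (Function.iterate_succ_apply' pdx m _).symm

section
variable {S : Set (ℝ × ℝ)} (hS : IsOpen S) {g : ℝ × ℝ → ℝ}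
include hS

lemma contDiffOn_pdx {n : ℕ} (hg : ContDiffOn ℝ (n + 1 : ℕ) g S) : ContDiffOn ℝ n (pdx g) S :=
  (hg.fderiv_of_isOpen hS (by norm_cast)).clm_apply contDiffOn_const

lemma contDiffOn_pdy {n : ℕ} (hg : ContDiffOn ℝ (n + 1 : ℕ) g S) : ContDiffOn ℝ n (pdy g) S :=
  (hg.fderiv_of_isOpen hS (by norm_cast)).clm_apply contDiffOn_const

lemma contDiffOn_pd : ∀ {m n K : ℕ}, ContDiffOn ℝ (K + m + n : ℕ) g S → ContDiffOn ℝ K (pd m n g) S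
  | 0, 0, K, h => h
  | 0, n + 1, K, h => by
    have : pd 0 (n + 1) g = pdy (pd 0 n g) := Function.iterate_succ_apply' pdy n _
    rw [this]
    exact contDiffOn_pdy hS (contDiffOn_pd (h.of_le (by norm_cast; omega)))
  | m + 1, n, K, h => by
    rw [← pdx_pd]
    exact contDiffOn_pdx hS (contDiffOn_pd (h.of_le (by norm_cast; omega)))

lemma pdy_pdx_comm (hg : ContDiffOn ℝ (2 : ℕ) g S) {q : ℝ × ℝ} (hq : q ∈ S) :
    pdy (pdx g) q = pdx (pdy g) q := by
  have h := hg.contDiffAt (hS.mem_nhds hq)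
  have hs : IsSymmSndFDerivAt ℝ g q := h.isSymmSndFDerivAt (by simp)
  have hd : DifferentiableAt ℝ (fderiv ℝ g) q :=
    (h.fderiv_right (m := 1) (by norm_cast)).differentiableAt (by norm_num)
  have key (e e' : ℝ × ℝ) : fderiv ℝ (fun z ↦ fderiv ℝ g z e) q e' = fderiv ℝ (fderiv ℝ g) q e' e := by
    rw [fderiv_clm_apply hd (differentiableAt_const _)]
    simp
  change fderiv ℝ (fun z ↦ fderiv ℝ g z (1, 0)) q (0, 1)
    = fderiv ℝ (fun z ↦ fderiv ℝ g z (0, 1)) q (1, 0)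
  rw [key, key]
  exact hs _ _

/-- As `pd` takes the derivatives in the second variable first, a further one has to be moved
inwards past those in the first variable, one at a time, by the symmetry of second derivatives. -/
lemma pdy_pd : ∀ {m n : ℕ}, ContDiffOn ℝ (m + n + 1 : ℕ) g S → ∀ {q}, q ∈ S →
    pdy (pd m n g) q = pd m (n + 1) g q
  | 0, n, _, q, _ => by
    have : pd 0 (n + 1) g = pdy (pd 0 n g) := Function.iterate_succ_apply' pdy n _
    rw [this]
  | m + 1, n, h, q, hq => by
    rw [← pdx_pd, ← pdx_pd, pdy_pdx_comm hS _ hq]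
    · refine pdx_congr ?_
      filter_upwards [hS.mem_nhds hq] with z hz
      exact pdy_pd (h.of_le (by norm_cast; omega)) hz
    · exact contDiffOn_pd hS (h.of_le (by norm_cast; omega))

lemma differentiableAt_pd {m n : ℕ} (h : ContDiffOn ℝ (m + n + 1 : ℕ) g S) {q} (hq : q ∈ S) :
    DifferentiableAt ℝ (pd m n g) q :=
  ((contDiffOn_pd hS (K := 1) (h.of_le (by norm_cast; omega))).contDiffAt
    (hS.mem_nhds hq)).differentiableAt (by simp)

end

/-! ### Local quasi-convexity -/

/-- Near `p₀`, points of `S` can be joined inside `S` by paths of length at most a constant times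
their distance; expressed through the mean value inequality. -/
def LocallyQuasiconvexAt (S : Set (ℝ × ℝ)) (p₀ : ℝ × ℝ) : Prop :=
  ∃ ρ > 0, ∃ A ≥ 1, ∀ p ∈ S, dist p p₀ < ρ → ∀ z ∈ S, dist z p₀ < ρ →
    ∀ (g : ℝ × ℝ → ℝ) (N : ℝ),
      (∀ w ∈ S, dist w p ≤ A * dist z p → DifferentiableAt ℝ g w ∧ ‖fderiv ℝ g w‖ ≤ N) →
        |g z - g p| ≤ N * (A * dist z p)

lemma abs_sub_le_of_segment {g : ℝ × ℝ → ℝ} {N : ℝ} {a b : ℝ × ℝ}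
    (h : ∀ w ∈ segment ℝ a b, DifferentiableAt ℝ g w ∧ ‖fderiv ℝ g w‖ ≤ N) :
    |g b - g a| ≤ N * ‖b - a‖ :=
  (convex_segment a b).norm_image_sub_le_of_norm_fderiv_le (fun w hw ↦ (h w hw).1)
    (fun w hw ↦ (h w hw).2) (left_mem_segment ℝ a b) (right_mem_segment ℝ a b)

lemma locallyQuasiconvexAt_of_mem {S : Set (ℝ × ℝ)} (hS : IsOpen S) {p₀ : ℝ × ℝ} (hp : p₀ ∈ S) :
    LocallyQuasiconvexAt S p₀ := by
  obtain ⟨ρ, hρ, hb⟩ := Metric.isOpen_iff.1 hS p₀ hp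
  refine ⟨ρ, hρ, 1, le_rfl, fun p _ hp z _ hz g N hg ↦ ?_⟩
  rw [one_mul, dist_eq_norm]
  refine abs_sub_le_of_segment fun w hw ↦ hg w (hb ?_) ?_
  · exact (convex_ball p₀ ρ).segment_subset hp hz hw
  · rw [one_mul]
    have := (convex_closedBall p (dist z p)).segment_subset (Metric.mem_closedBall_self dist_nonneg)
      (Metric.mem_closedBall.2 le_rfl) hw
    exact this

lemma mul_le_sub_of_line {χ : ℝ × ℝ → ℝ} {p e : ℝ × ℝ} {c T : ℝ}
    (h : ∀ t ∈ Icc 0 T, DifferentiableAt ℝ χ (p + t • e) ∧ c ≤ fderiv ℝ χ (p + t • e) e)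
    {t : ℝ} (ht : t ∈ Icc 0 T) : χ p + c * t ≤ χ (p + t • e) := by
  have hd (s) (hs : s ∈ Icc 0 T) :
      HasDerivAt (fun s : ℝ ↦ χ (p + s • e)) (fderiv ℝ χ (p + s • e) e) s := by
    have h1 : HasDerivAt (fun s : ℝ ↦ p + s • e) e s := by
      simpa using ((hasDerivAt_id s).smul_const e).const_add p
    exact (h s hs).1.hasFDerivAt.comp_hasDerivAt s h1
  have := (convex_Icc 0 T).mul_sub_le_image_sub_of_le_deriv (f := fun s : ℝ ↦ χ (p + s • e)) (C := c)
    (fun s hs ↦ (hd s hs).continuousAt.continuousWithinAt)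
    (fun s hs ↦ (hd s (interior_subset hs)).differentiableAt.differentiableWithinAt)
    (fun s hs ↦ by rw [(hd s (interior_subset hs)).deriv]; exact (h s (interior_subset hs)).2)
    0 ⟨le_rfl, ht.1.trans ht.2⟩ t ht ht.1
  simp only [zero_smul, add_zero, sub_zero] at this
  linarith

/-- A direction along which `χ` increases near a regular point. -/
lemma exists_increasing_direction {χ : ℝ × ℝ → ℝ} {p₀ : ℝ × ℝ} (hχ : ContDiffAt ℝ 1 χ p₀)
    (hreg : pdx χ p₀ ≠ 0 ∨ pdy χ p₀ ≠ 0) :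
    ∃ (e : ℝ × ℝ) (c M : ℝ), 0 < c ∧ 0 < M ∧ ∀ᶠ z in 𝓝 p₀,
      DifferentiableAt ℝ χ z ∧ c ≤ fderiv ℝ χ z e ∧ ‖fderiv ℝ χ z‖ ≤ M := by
  have hpos : 0 < fderiv ℝ χ p₀ (pdx χ p₀, pdy χ p₀) := by
    rw [fderiv_eq_pd]
    rcases hreg with h | h
    · have := mul_self_pos.2 h; have := mul_self_nonneg (pdy χ p₀); simp only; linarith
    · have := mul_self_pos.2 h; have := mul_self_nonneg (pdx χ p₀); simp only; linarith
  have hcont : ContinuousAt (fderiv ℝ χ) p₀ :=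
    (hχ.fderiv_right (m := 0) (by norm_num)).continuousAt
  -- The direction is the gradient at `p₀`; by continuity the derivative along it keeps at least
  -- half of its positive value there.
  refine ⟨(pdx χ p₀, pdy χ p₀), fderiv ℝ χ p₀ (pdx χ p₀, pdy χ p₀) / 2, ‖fderiv ℝ χ p₀‖ + 1,
    by positivity, by positivity, ?_⟩
  have h1 := (hcont.clm_apply continuousAt_const :
    ContinuousAt (fun z ↦ fderiv ℝ χ z (pdx χ p₀, pdy χ p₀)) p₀).eventually_const_lt
    (half_lt_self hpos)
  have h2 := hcont.norm.eventually_lt_const (lt_add_one _)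
  have h3 : ∀ᶠ z in 𝓝 p₀, DifferentiableAt ℝ χ z := by
    filter_upwards [hχ.eventually (by simp)] with z hz using hz.differentiableAt (by simp)
  filter_upwards [h1, h2, h3] with z h1 h2 h3 using ⟨h3, h1.le, h2.le⟩

/-- The segment from `p` to `z` may leave `S`, so a detour is taken. Both points are pushed along
the direction `e` of increase, which keeps `χ` positive and raises it by at least `(M + 1) δ`, where
`δ = dist z p`. The segment between the pushed points has length `δ`, so `χ` changes by at most `M
δ` along it and stays positive. The three pieces have total length at most `A δ`. -/
lemma locallyQuasiconvexAt_of_regular {S : Set (ℝ × ℝ)} {χ : ℝ × ℝ → ℝ} {p₀ : ℝ × ℝ}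
    (hχ : ContDiffAt ℝ 1 χ p₀) (hreg : pdx χ p₀ ≠ 0 ∨ pdy χ p₀ ≠ 0)
    (hS : ∀ᶠ z in 𝓝 p₀, z ∈ S ↔ 0 < χ z) : LocallyQuasiconvexAt S p₀ := by
  obtain ⟨e, c, M, hc, hM, hev⟩ := exists_increasing_direction hχ hreg
  obtain ⟨ρ₀, hρ₀, hb⟩ := Metric.eventually_nhds_iff.1 (hev.and hS)
  -- The length of the push is chosen so that `c * (L * δ) = (M + 1) * δ`.
  set L : ℝ := (M + 1) / c with hL
  have hLpos : 0 < L := by positivity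
  set A : ℝ := 1 + 2 * (L * ‖e‖) with hA
  have hA1 : 1 ≤ A := by have : 0 ≤ L * ‖e‖ := by positivity
                         linarith
  -- Points within `A * δ` of `p` stay in the ball of radius `ρ₀`, since `δ` is less than twice the
  -- new radius.
  refine ⟨ρ₀ / (1 + 2 * A), by positivity, A, hA1, fun p hpS hp z hzS hz g N hg ↦ ?_⟩
  set δ := dist z p with hδ
  have hδ0 : 0 ≤ δ := dist_nonneg
  have hρ : ρ₀ / (1 + 2 * A) * (1 + 2 * A) = ρ₀ := div_mul_cancel₀ _ (by positivity)
  have hδρ : δ < 2 * (ρ₀ / (1 + 2 * A)) := by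
    have := dist_triangle_right z p p₀
    linarith
  have hball (w : ℝ × ℝ) (hw : dist w p ≤ A * δ) : dist w p₀ < ρ₀ := by
    have h1 := dist_triangle w p p₀
    have h2 : A * δ ≤ A * (2 * (ρ₀ / (1 + 2 * A))) := by gcongr
    nlinarith
  have hLe : 0 ≤ L * ‖e‖ := by positivity
  have hup (t : ℝ) (ht : t ∈ Icc 0 (L * δ)) : ‖t • e‖ ≤ L * ‖e‖ * δ := by
    rw [norm_smul, Real.norm_eq_abs, abs_of_nonneg ht.1]
    nlinarith [ht.2, norm_nonneg e]
  have hdp (t : ℝ) (ht : t ∈ Icc 0 (L * δ)) : dist (p + t • e) p ≤ A * δ := by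
    rw [dist_eq_norm, add_sub_cancel_left]
    nlinarith [hup t ht]
  have hdz (t : ℝ) (ht : t ∈ Icc 0 (L * δ)) : dist (z + t • e) p ≤ A * δ := by
    have h1 : dist (z + t • e) p ≤ ‖t • e‖ + δ := by
      rw [hδ, dist_eq_norm, dist_eq_norm, show z + t • e - p = t • e + (z - p) by abel]
      exact norm_add_le _ _
    nlinarith [hup t ht]
  have hTmem : L * δ ∈ Icc 0 (L * δ) := ⟨by positivity, le_rfl⟩
  have h0mem : (0 : ℝ) ∈ Icc 0 (L * δ) := ⟨le_rfl, by positivity⟩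
  have hχp (t : ℝ) (ht : t ∈ Icc 0 (L * δ)) : χ p + c * t ≤ χ (p + t • e) :=
    mul_le_sub_of_line (fun s hs ↦ ⟨(hb (hball _ (hdp s hs))).1.1, (hb (hball _ (hdp s hs))).1.2.1⟩) ht
  have hχz (t : ℝ) (ht : t ∈ Icc 0 (L * δ)) : χ z + c * t ≤ χ (z + t • e) :=
    mul_le_sub_of_line (fun s hs ↦ ⟨(hb (hball _ (hdz s hs))).1.1, (hb (hball _ (hdz s hs))).1.2.1⟩) ht
  have hp0 : 0 < χ p := by
    have := hdp 0 h0mem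
    rw [zero_smul, add_zero] at this
    exact (hb (hball p this)).2.1 hpS
  have hz0 : 0 < χ z := by
    have := hdz 0 h0mem
    rw [zero_smul, add_zero] at this
    exact (hb (hball z this)).2.1 hzS
  have hcL : c * (L * δ) = (M + 1) * δ := by rw [hL]; field_simp
  -- the transversal segments
  have hseg (x : ℝ × ℝ) (hx : 0 < χ x) (hdx : ∀ t ∈ Icc 0 (L * δ), dist (x + t • e) p ≤ A * δ)
      (hχx : ∀ t ∈ Icc 0 (L * δ), χ x + c * t ≤ χ (x + t • e)) :
      |g (x + (L * δ) • e) - g x| ≤ N * (L * ‖e‖ * δ) := by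
    have h1 : |g (x + (L * δ) • e) - g x| ≤ N * ‖x + (L * δ) • e - x‖ := by
      refine abs_sub_le_of_segment fun w hw ↦ ?_
      rw [segment_eq_image'] at hw
      obtain ⟨θ, hθ, rfl⟩ := hw
      have hmem : θ * (L * δ) ∈ Icc 0 (L * δ) :=
        ⟨mul_nonneg hθ.1 hTmem.1, mul_le_of_le_one_left hTmem.1 hθ.2⟩
      have heq : x + θ • (x + (L * δ) • e - x) = x + (θ * (L * δ)) • e := by
        simp only [add_sub_cancel_left, mul_smul]
      simp only [heq]
      refine hg _ ((hb (hball _ (hdx _ hmem))).2.2 ?_) (hdx _ hmem)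
      have := hχx _ hmem
      have := mul_nonneg hc.le hmem.1
      linarith
    rw [add_sub_cancel_left, norm_smul, Real.norm_eq_abs, abs_of_nonneg hTmem.1] at h1
    calc _ ≤ _ := h1
      _ = _ := by ring
  have h1 := hseg p hp0 hdp hχp
  have h2 := hseg z hz0 hdz hχz
  have hconv : Convex ℝ (Metric.closedBall p (A * δ)) := convex_closedBall _ _
  have hdseg (θ : ℝ) (hθ : θ ∈ Icc (0 : ℝ) 1) : dist (p + (L * δ) • e + θ • (z - p)) p ≤ A * δ := by
    have := hconv.segment_subset (Metric.mem_closedBall.2 (hdp _ hTmem))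
      (Metric.mem_closedBall.2 (hdz _ hTmem))
    refine this ?_
    rw [segment_eq_image']
    exact ⟨θ, hθ, by simp⟩
  -- The raised segment: `χ` is at least `χ p + (M + 1) δ` at its starting point and loses at most
  -- `M δ`.
  have h3 : |g (z + (L * δ) • e) - g (p + (L * δ) • e)| ≤ N * δ := by
    have h1 : |g (z + (L * δ) • e) - g (p + (L * δ) • e)|
        ≤ N * ‖z + (L * δ) • e - (p + (L * δ) • e)‖ := by
      refine abs_sub_le_of_segment fun w hw ↦ ?_
      rw [segment_eq_image'] at hw
      obtain ⟨θ, hθ, rfl⟩ := hw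
      rw [add_sub_add_right_eq_sub]
      refine hg _ ((hb (hball _ (hdseg θ hθ))).2.2 ?_) (hdseg θ hθ)
      have hlow := hχp _ hTmem
      have hvar : |χ (p + (L * δ) • e + θ • (z - p)) - χ (p + (L * δ) • e)|
          ≤ M * ‖p + (L * δ) • e + θ • (z - p) - (p + (L * δ) • e)‖ := by
        refine abs_sub_le_of_segment fun w hw ↦ ?_
        have hwb : dist w p ≤ A * δ :=
          hconv.segment_subset (Metric.mem_closedBall.2 (hdp _ hTmem))
            (Metric.mem_closedBall.2 (hdseg θ hθ)) hw
        exact ⟨(hb (hball _ hwb)).1.1, (hb (hball _ hwb)).1.2.2⟩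
      rw [add_sub_cancel_left, norm_smul, Real.norm_eq_abs, abs_of_nonneg hθ.1, ← dist_eq_norm] at hvar
      have h4 : M * (θ * δ) ≤ M * δ := by
        gcongr
        exact mul_le_of_le_one_left hδ0 hθ.2
      have h5 := abs_le.1 hvar
      linarith [h5.1]
    rwa [add_sub_add_right_eq_sub, ← dist_eq_norm] at h1
  rw [abs_le] at h1 h2 h3 ⊢
  have : N * (A * δ) = N * (L * ‖e‖ * δ) + N * δ + N * (L * ‖e‖ * δ) := by rw [hA]; ring
  constructor <;> linarith [h1.1, h1.2, h2.1, h2.2, h3.1, h3.2]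

lemma mem_closure_of_regular {S : Set (ℝ × ℝ)} {χ : ℝ × ℝ → ℝ} {p₀ : ℝ × ℝ}
    (hχ : ContDiffAt ℝ 1 χ p₀) (hreg : pdx χ p₀ ≠ 0 ∨ pdy χ p₀ ≠ 0) (h0 : χ p₀ = 0)
    (hS : ∀ᶠ z in 𝓝 p₀, z ∈ S ↔ 0 < χ z) : p₀ ∈ closure S := by
  obtain ⟨e, c, M, hc, hM, hev⟩ := exists_increasing_direction hχ hreg
  have hline : Tendsto (fun t : ℝ ↦ p₀ + t • e) (𝓝 0) (𝓝 p₀) := by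
    have : Continuous fun t : ℝ ↦ p₀ + t • e := by fun_prop
    simpa using this.tendsto 0
  obtain ⟨ε, hε, hb⟩ := Metric.eventually_nhds_iff.1 (hline.eventually (hev.and hS))
  have hline' : Tendsto (fun t : ℝ ↦ p₀ + t • e) (𝓝[>] 0) (𝓝 p₀) := hline.mono_left inf_le_left
  refine mem_closure_of_tendsto hline' ?_
  have : Ioo 0 ε ∈ 𝓝[>] (0 : ℝ) := Ioo_mem_nhdsGT hε
  filter_upwards [this] with t ht
  have hd (s : ℝ) (hs : s ∈ Icc 0 t) : dist s 0 < ε := by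
    rw [Real.dist_0_eq_abs, abs_of_nonneg hs.1]; exact hs.2.trans_lt ht.2
  have hm : t ∈ Icc 0 t := ⟨ht.1.le, le_rfl⟩
  refine (hb (hd t hm)).2.2 ?_
  have := mul_le_sub_of_line (c := c) (fun s hs ↦ ⟨(hb (hd s hs)).1.1, (hb (hd s hs)).1.2.1⟩) hm
  have := mul_pos hc ht.1
  linarith

/-! ### Taylor polynomials -/

lemma sum_Lam_zero (w : ℕ × ℕ → ℝ) : ∑ k ∈ Lam 0, w k = w (0, 0) := by
  rw [show Lam 0 = {(0, 0)} by decide]; simp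

lemma sum_Lam_one (w : ℕ × ℕ → ℝ) : ∑ k ∈ Lam 1, w k = w (0, 0) + w (0, 1) + w (1, 0) := by
  rw [show Lam 1 = {(0, 0), (0, 1), (1, 0)} by decide]; simp [add_assoc]

lemma sum_Lam_two (w : ℕ × ℕ → ℝ) : ∑ k ∈ Lam 2, w k
    = w (0, 0) + w (0, 1) + w (1, 0) + w (0, 2) + w (1, 1) + w (2, 0) := by
  rw [show Lam 2 = {(0, 0), (0, 1), (1, 0), (0, 2), (1, 1), (2, 0)} by decide]; simp [add_assoc]

lemma sum_Lam_three (w : ℕ × ℕ → ℝ) : ∑ k ∈ Lam 3, w k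
    = w (0, 0) + w (0, 1) + w (1, 0) + w (0, 2) + w (1, 1) + w (2, 0)
      + w (0, 3) + w (1, 2) + w (2, 1) + w (3, 0) := by
  rw [show Lam 3 = {(0, 0), (0, 1), (1, 0), (0, 2), (1, 1), (2, 0),
    (0, 3), (1, 2), (2, 1), (3, 0)} by decide]
  simp [add_assoc]

lemma taylorPoly_zero (J : Jet) (z : ℝ × ℝ) : taylorPoly 0 J z = J (0, 0) := by
  simp [taylorPoly, sum_Lam_zero]

lemma taylorPoly_one (J : Jet) (z : ℝ × ℝ) :
    taylorPoly 1 J z = J (0, 0) + J (0, 1) * z.2 + J (1, 0) * z.1 := by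
  simp [taylorPoly, sum_Lam_one]

lemma taylorPoly_two (J : Jet) (z : ℝ × ℝ) :
    taylorPoly 2 J z = J (0, 0) + J (0, 1) * z.2 + J (1, 0) * z.1 + J (0, 2) / 2 * z.2 ^ 2
      + J (1, 1) * z.1 * z.2 + J (2, 0) / 2 * z.1 ^ 2 := by
  simp [taylorPoly, sum_Lam_two]

lemma taylorPoly_three (J : Jet) (z : ℝ × ℝ) :
    taylorPoly 3 J z = J (0, 0) + J (0, 1) * z.2 + J (1, 0) * z.1 + J (0, 2) / 2 * z.2 ^ 2
      + J (1, 1) * z.1 * z.2 + J (2, 0) / 2 * z.1 ^ 2 + J (0, 3) / 6 * z.2 ^ 3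
      + J (1, 2) / 2 * z.1 * z.2 ^ 2 + J (2, 1) / 2 * z.1 ^ 2 * z.2 + J (3, 0) / 6 * z.1 ^ 3 := by
  simp [taylorPoly, sum_Lam_three, Nat.factorial]

lemma contDiff_taylorPoly (K : ℕ) (J : Jet) {n : WithTop ℕ∞} : ContDiff ℝ n (taylorPoly K J) := by
  unfold taylorPoly
  fun_prop

lemma differentiable_taylorPoly (K : ℕ) (J : Jet) : Differentiable ℝ (taylorPoly K J) :=
  (contDiff_taylorPoly K J (n := 1)).differentiable (by simp)

lemma pdx_eq_deriv {g : ℝ × ℝ → ℝ} {z : ℝ × ℝ} (hg : DifferentiableAt ℝ g z) :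
    pdx g z = deriv (fun x ↦ g (x, z.2)) z.1 := by
  have h : HasDerivAt (fun x : ℝ ↦ (x, z.2)) ((1 : ℝ), (0 : ℝ)) z.1 :=
    (hasDerivAt_id z.1).prodMk (hasDerivAt_const _ _)
  exact (HasFDerivAt.comp_hasDerivAt z.1 (f := fun x : ℝ ↦ (x, z.2)) hg.hasFDerivAt h).deriv.symm

lemma pdy_eq_deriv {g : ℝ × ℝ → ℝ} {z : ℝ × ℝ} (hg : DifferentiableAt ℝ g z) :
    pdy g z = deriv (fun y ↦ g (z.1, y)) z.2 := by
  have h : HasDerivAt (fun y : ℝ ↦ (z.1, y)) ((0 : ℝ), (1 : ℝ)) z.2 :=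
    (hasDerivAt_const _ _).prodMk (hasDerivAt_id z.2)
  exact (HasFDerivAt.comp_hasDerivAt z.2 (f := fun y : ℝ ↦ (z.1, y)) hg.hasFDerivAt h).deriv.symm

lemma deriv_cubic (a b c d x : ℝ) :
    deriv (fun x ↦ a + b * x + c * x ^ 2 + d * x ^ 3) x = b + c * (2 * x) + d * (3 * x ^ 2) := by
  have h1 := ((hasDerivAt_id x).const_mul b).const_add a
  have h2 := ((hasDerivAt_pow 2 x).const_mul c)
  have h3 := ((hasDerivAt_pow 3 x).const_mul d)
  have := ((h1.add h2).add h3).deriv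
  simpa [Pi.add_def] using this

lemma pdx_taylorPoly {K : ℕ} (hK : K ≤ 2) (J : Jet) (z : ℝ × ℝ) :
    pdx (taylorPoly (K + 1) J) z = taylorPoly K (fun k ↦ J (k.1 + 1, k.2)) z := by
  rw [pdx_eq_deriv (differentiable_taylorPoly _ _ z)]
  interval_cases K
  · convert deriv_cubic (J (0, 0) + J (0, 1) * z.2) (J (1, 0)) 0 0 z.1 using 2
    · ext x; simp only [zero_add, taylorPoly_one]; ring
    · rw [taylorPoly_zero]; ring
  · convert deriv_cubic (J (0, 0) + J (0, 1) * z.2 + J (0, 2) / 2 * z.2 ^ 2)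
      (J (1, 0) + J (1, 1) * z.2) (J (2, 0) / 2) 0 z.1 using 2
    · ext x; simp only [Nat.reduceAdd, taylorPoly_two]; ring
    · rw [taylorPoly_one]; ring
  · convert deriv_cubic (J (0, 0) + J (0, 1) * z.2 + J (0, 2) / 2 * z.2 ^ 2 + J (0, 3) / 6 * z.2 ^ 3)
      (J (1, 0) + J (1, 1) * z.2 + J (1, 2) / 2 * z.2 ^ 2) (J (2, 0) / 2 + J (2, 1) / 2 * z.2)
      (J (3, 0) / 6) z.1 using 2
    · ext x; simp only [Nat.reduceAdd, taylorPoly_three]; ring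
    · rw [taylorPoly_two]; ring

lemma pdy_taylorPoly {K : ℕ} (hK : K ≤ 2) (J : Jet) (z : ℝ × ℝ) :
    pdy (taylorPoly (K + 1) J) z = taylorPoly K (fun k ↦ J (k.1, k.2 + 1)) z := by
  rw [pdy_eq_deriv (differentiable_taylorPoly _ _ z)]
  interval_cases K
  · convert deriv_cubic (J (0, 0) + J (1, 0) * z.1) (J (0, 1)) 0 0 z.2 using 2
    · ext x; simp only [zero_add, taylorPoly_one]; ring
    · rw [taylorPoly_zero]; ring
  · convert deriv_cubic (J (0, 0) + J (1, 0) * z.1 + J (2, 0) / 2 * z.1 ^ 2)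
      (J (0, 1) + J (1, 1) * z.1) (J (0, 2) / 2) 0 z.2 using 2
    · ext x; simp only [Nat.reduceAdd, taylorPoly_two]; ring
    · rw [taylorPoly_one]; ring
  · convert deriv_cubic (J (0, 0) + J (1, 0) * z.1 + J (2, 0) / 2 * z.1 ^ 2 + J (3, 0) / 6 * z.1 ^ 3)
      (J (0, 1) + J (1, 1) * z.1 + J (2, 1) / 2 * z.1 ^ 2) (J (0, 2) / 2 + J (1, 2) / 2 * z.1)
      (J (0, 3) / 6) z.2 using 2
    · ext x; simp only [Nat.reduceAdd, taylorPoly_three]; ring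
    · rw [taylorPoly_two]; ring

lemma taylorPoly_at_zero (K : ℕ) (J : Jet) : taylorPoly K J 0 = J (0, 0) := by
  unfold taylorPoly
  rw [Finset.sum_eq_single (0, 0)]
  · simp
  · rintro ⟨i, j⟩ _ h
    rcases Nat.eq_zero_or_pos i with rfl | hi
    · rcases Nat.eq_zero_or_pos j with rfl | hj
      · exact absurd rfl h
      · simp [hj.ne']
    · simp [hi.ne']
  · intro h; exact absurd (by simp [Lam]) h

/-! ### Taylor's formula with uniform remainder, up to the boundary -/

section
variable {S : Set (ℝ × ℝ)} {v : ℝ × ℝ → ℝ} {p₀ : ℝ × ℝ} {N : ℕ}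

lemma exists_bound_of_tendsto {g : ℝ × ℝ → ℝ} {L : ℝ} (h : Tendsto g (𝓝[S] p₀) (𝓝 L)) :
    ∃ M, ∃ ρ > 0, ∀ z ∈ S, dist z p₀ < ρ → |g z| ≤ M := by
  have := (h.abs.eventually_lt_const (lt_add_one |L|))
  rw [eventually_nhdsWithin_iff, Metric.eventually_nhds_iff] at this
  obtain ⟨ρ, hρ, hb⟩ := this
  exact ⟨|L| + 1, ρ, hρ, fun z hz hd ↦ (hb hd hz).le⟩

/-- Taylor's formula with uniform remainder between points of `S` close to `p₀`. -/
lemma taylor_remainder_of_mem (hS : IsOpen S) (hQ : LocallyQuasiconvexAt S p₀)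
    (hv : ContDiffOn ℝ N v S)
    (hb : ∀ m n, m + n = N → ∃ L, Tendsto (pd m n v) (𝓝[S] p₀) (𝓝 L)) :
    ∀ d ≤ 3, ∃ C ≥ 0, ∃ ρ > 0, ∀ p ∈ S, dist p p₀ < ρ → ∀ z ∈ S, dist z p₀ < ρ →
      ∀ m n, m + n + d + 1 = N →
        |pd m n v z - taylorPoly d (fun k ↦ pd (m + k.1) (n + k.2) v p) (z - p)|
          ≤ C * dist z p ^ (d + 1) := by
  obtain ⟨ρ₁, hρ₁, A, hA, hmv⟩ := hQ
  -- it suffices to bound the partial derivatives of the remainder along the paths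
  have step (d : ℕ) (C ρ : ℝ) (hC : 0 ≤ C) (hρ : 0 < ρ)
      (h : ∀ p ∈ S, dist p p₀ < ρ → ∀ z ∈ S, dist z p₀ < ρ → ∀ m n, m + n + d + 1 = N →
        |pdx (fun z ↦ pd m n v z - taylorPoly d (fun k ↦ pd (m + k.1) (n + k.2) v p) (z - p)) z|
          ≤ C * dist z p ^ d ∧
        |pdy (fun z ↦ pd m n v z - taylorPoly d (fun k ↦ pd (m + k.1) (n + k.2) v p) (z - p)) z|
          ≤ C * dist z p ^ d) :
      ∃ C ≥ 0, ∃ ρ > 0, ∀ p ∈ S, dist p p₀ < ρ → ∀ z ∈ S, dist z p₀ < ρ →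
      ∀ m n, m + n + d + 1 = N →
        |pd m n v z - taylorPoly d (fun k ↦ pd (m + k.1) (n + k.2) v p) (z - p)|
          ≤ C * dist z p ^ (d + 1) := by
    have hA0 : 0 < A := by linarith
    -- The differential is bounded by the sum of the two partial derivatives, whence the factor 2;
    -- along the path these are at most `C * (A * δ) ^ d`, with `δ = dist z p`, and the path has
    -- length at most `A * δ`.
    refine ⟨2 * C * A ^ (d + 1), by positivity, min ρ₁ (ρ / (1 + 2 * A)), by positivity,
      fun p hp hpd z hz hzd m n hmn ↦ ?_⟩
    rw [lt_min_iff] at hpd hzd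
    have hρ' : ρ / (1 + 2 * A) * (1 + 2 * A) = ρ := div_mul_cancel₀ _ (by positivity)
    have hpos : 0 < ρ / (1 + 2 * A) := by positivity
    have hδ : dist z p < 2 * (ρ / (1 + 2 * A)) := by
      have := dist_triangle_right z p p₀
      linarith
    have := hmv p hp hpd.1 z hz hzd.1
      (fun z ↦ pd m n v z - taylorPoly d (fun k ↦ pd (m + k.1) (n + k.2) v p) (z - p))
      (2 * (C * (A * dist z p) ^ d)) fun w hw hwd ↦ ?_
    -- The remainder vanishes at the base point `p`, so the mean value inequality bounds it at `z`.
    · simp only [sub_self, taylorPoly_at_zero, add_zero, sub_zero] at this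
      calc _ ≤ _ := this
        _ = _ := by ring
    · constructor
      · refine (differentiableAt_pd hS (hv.of_le (by norm_cast; omega)) hw).sub ?_
        exact (differentiable_taylorPoly _ _).differentiableAt.comp w (by fun_prop)
      · have hwp : dist w p₀ < ρ := by
          have h1 := dist_triangle w p p₀
          have h2 : A * dist z p ≤ A * (2 * (ρ / (1 + 2 * A))) := by gcongr
          nlinarith [hpd.2]
        have hpp : dist p p₀ < ρ := by nlinarith [hpd.2]
        obtain ⟨h1, h2⟩ := h p hp hpp w hw hwp m n hmn
        have h3 : C * dist w p ^ d ≤ C * (A * dist z p) ^ d := by gcongr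
        refine (norm_fderiv_le _ _).trans ?_
        linarith
  have hsub (m n d : ℕ) (hmn : m + n + d + 1 = N) (p z : ℝ × ℝ) (hz : z ∈ S) (J : Jet) :
      pdx (fun z ↦ pd m n v z - taylorPoly d J (z - p)) z
        = pd (m + 1) n v z - pdx (taylorPoly d J) (z - p) ∧
      pdy (fun z ↦ pd m n v z - taylorPoly d J (z - p)) z
        = pd m (n + 1) v z - pdy (taylorPoly d J) (z - p) := by
    have h1 := differentiableAt_pd (m := m) (n := n) hS (hv.of_le (by norm_cast; omega)) hz
    have h2 : DifferentiableAt ℝ (fun z ↦ taylorPoly d J (z - p)) z :=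
      (differentiable_taylorPoly _ _).differentiableAt.comp z (by fun_prop)
    have h3 : fderiv ℝ (fun z ↦ taylorPoly d J (z - p)) z = fderiv ℝ (taylorPoly d J) (z - p) :=
      fderiv_comp_sub (f := taylorPoly d J) p
    rw [← pdx_pd, ← pdy_pd hS (m := m) (n := n) (hv.of_le (by norm_cast; omega)) hz]
    constructor
    · simp only [pdx]
      rw [fderiv_fun_sub h1 h2, h3]; rfl
    · simp only [pdy]
      rw [fderiv_fun_sub h1 h2, h3]; rfl
  intro d
  -- A first derivative of a remainder of degree `d + 1` is the remainder of degree `d` of that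
  -- derivative of `v`. One order is added to the derivative and one removed from the degree, so `m
  -- + n + d + 1 = N` persists. At degree 0 the derivatives of the remainder are derivatives of `v`
  -- of order `N`, which are bounded near `p₀`.
  induction d with
  | zero =>
    intro _
    have hbd : ∀ m n, m + n = N → ∃ M, ∃ ρ > 0, ∀ z ∈ S, dist z p₀ < ρ → |pd m n v z| ≤ M :=
      fun m n h ↦ exists_bound_of_tendsto (hb m n h).choose_spec
    choose! M R hR hM using hbd
    have hfin : ∃ M' ≥ 0, ∃ ρ > 0, ∀ m n, m + n = N → M m n ≤ M' ∧ ρ ≤ R m n := by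
      have hne : (Finset.HasAntidiagonal.antidiagonal N).Nonempty := ⟨(0, N), by simp⟩
      refine ⟨∑ k ∈ Finset.HasAntidiagonal.antidiagonal N, |M k.1 k.2|, by positivity,
        (Finset.HasAntidiagonal.antidiagonal N).inf' hne fun k ↦ R k.1 k.2, ?_, fun m n h ↦ ⟨?_, ?_⟩⟩
      · rw [gt_iff_lt, Finset.lt_inf'_iff]
        exact fun k hk ↦ hR _ _ (Finset.HasAntidiagonal.mem_antidiagonal.1 hk)
      · exact (le_abs_self _).trans (Finset.single_le_sum (f := fun k : ℕ × ℕ ↦ |M k.1 k.2|)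
          (fun _ _ ↦ abs_nonneg _) (Finset.HasAntidiagonal.mem_antidiagonal.2 h : (m, n) ∈ _))
      · exact Finset.inf'_le (fun k : ℕ × ℕ ↦ R k.1 k.2)
          (Finset.HasAntidiagonal.mem_antidiagonal.2 h : (m, n) ∈ _)
    obtain ⟨M', hM', ρ, hρ, hfin⟩ := hfin
    refine step 0 M' ρ hM' hρ fun p hp hpd z hz hzd m n hmn ↦ ?_
    have hconst (J : Jet) (w : ℝ × ℝ) : pdx (taylorPoly 0 J) w = 0 ∧ pdy (taylorPoly 0 J) w = 0 := by
      have : taylorPoly 0 J = fun _ ↦ J (0, 0) := funext (taylorPoly_zero J)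
      simp [this, pdx, pdy]
    rw [(hsub m n 0 hmn p z hz _).1, (hsub m n 0 hmn p z hz _).2, (hconst _ _).1, (hconst _ _).2]
    simp only [sub_zero, pow_zero, mul_one]
    have h1 : m + 1 + n = N := by omega
    have h2 : m + (n + 1) = N := by omega
    exact ⟨(hM _ _ h1 z hz (hzd.trans_le (hfin _ _ h1).2)).trans (hfin _ _ h1).1,
      (hM _ _ h2 z hz (hzd.trans_le (hfin _ _ h2).2)).trans (hfin _ _ h2).1⟩
  | succ d ih =>
    intro hd
    obtain ⟨C, hC, ρ, hρ, h⟩ := ih (by omega)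
    refine step (d + 1) C ρ hC hρ fun p hp hpd z hz hzd m n hmn ↦ ?_
    rw [(hsub m n (d + 1) hmn p z hz _).1, (hsub m n (d + 1) hmn p z hz _).2,
      pdx_taylorPoly (by omega), pdy_taylorPoly (by omega)]
    have h1 := h p hp hpd z hz hzd (m + 1) n (by omega)
    have h2 := h p hp hpd z hz hzd m (n + 1) (by omega)
    refine ⟨?_, ?_⟩
    · convert h1 using 6 with k; omega
    · convert h2 using 6 with k; omega

/-- Taylor's formula with uniform remainder, for one-sided limits at points of the closure. -/
lemma taylor_remainder (hS : IsOpen S) (hQ : LocallyQuasiconvexAt S p₀)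
    (hv : ContDiffOn ℝ N v S)
    (hb : ∀ m n, m + n = N → ∃ L, Tendsto (pd m n v) (𝓝[S] p₀) (𝓝 L)) {d : ℕ} (hd : d ≤ 3) :
    ∃ C ≥ 0, ∃ ρ > 0, ∀ p ∈ closure S, dist p p₀ < ρ → ∀ z ∈ closure S, dist z p₀ < ρ →
      (∀ m n, m + n < N → ∃ L, Tendsto (pd m n v) (𝓝[S] p) (𝓝 L)) →
      (∀ m n, m + n < N → ∃ L, Tendsto (pd m n v) (𝓝[S] z) (𝓝 L)) →
      ∀ m n, m + n + d + 1 = N →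
        |extendFrom S (pd m n v) z
            - taylorPoly d (fun k ↦ extendFrom S (pd (m + k.1) (n + k.2) v) p) (z - p)|
          ≤ C * dist z p ^ (d + 1) := by
  obtain ⟨C, hC, ρ, hρ, h⟩ := taylor_remainder_of_mem hS hQ hv hb d hd
  refine ⟨C, hC, ρ, hρ, fun p hp hpd z hz hzd hLp hLz m n hmn ↦ ?_⟩
  have : (𝓝[S] p).NeBot := mem_closure_iff_nhdsWithin_neBot.1 hp
  have : (𝓝[S] z).NeBot := mem_closure_iff_nhdsWithin_neBot.1 hz
  have t1 : Tendsto (fun w : (ℝ × ℝ) × (ℝ × ℝ) ↦ w.1) (𝓝[S] p ×ˢ 𝓝[S] z) (𝓝 p) :=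
    tendsto_fst.mono_right inf_le_left
  have t2 : Tendsto (fun w : (ℝ × ℝ) × (ℝ × ℝ) ↦ w.2) (𝓝[S] p ×ˢ 𝓝[S] z) (𝓝 z) :=
    tendsto_snd.mono_right inf_le_left
  have l1 : Tendsto (fun w : (ℝ × ℝ) × (ℝ × ℝ) ↦ pd m n v w.2) (𝓝[S] p ×ˢ 𝓝[S] z)
      (𝓝 (extendFrom S (pd m n v) z)) :=
    (tendsto_extendFrom (hLz m n (by omega))).comp tendsto_snd
  have l2 : Tendsto (fun w : (ℝ × ℝ) × (ℝ × ℝ) ↦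
      taylorPoly d (fun k ↦ pd (m + k.1) (n + k.2) v w.1) (w.2 - w.1)) (𝓝[S] p ×ˢ 𝓝[S] z)
      (𝓝 (taylorPoly d (fun k ↦ extendFrom S (pd (m + k.1) (n + k.2) v) p) (z - p))) := by
    unfold taylorPoly
    refine tendsto_finsetSum _ fun k hk ↦ ?_
    have hk' : k.1 + k.2 ≤ d := by simp [Lam] at hk; exact hk.2
    have l3 : Tendsto (fun w : (ℝ × ℝ) × (ℝ × ℝ) ↦ pd (m + k.1) (n + k.2) v w.1)
        (𝓝[S] p ×ˢ 𝓝[S] z) (𝓝 (extendFrom S (pd (m + k.1) (n + k.2) v) p)) :=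
      (tendsto_extendFrom (hLp _ _ (by omega))).comp tendsto_fst
    have l4 := t2.sub t1
    exact ((l3.div_const _).mul ((l4.fst_nhds).pow _)).mul ((l4.snd_nhds).pow _)
  -- Both points are approached from inside `S` at once, and the inequality passes to the limit. It
  -- involves only derivatives of order below `N`, so those limits suffice at `p` and `z`.
  refine le_of_tendsto_of_tendsto ((l1.sub l2).abs) (((t2.dist t1).pow (d + 1)).const_mul C) ?_
  have e1 : ∀ᶠ w : (ℝ × ℝ) × (ℝ × ℝ) in 𝓝[S] p ×ˢ 𝓝[S] z, w.1 ∈ S :=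
    tendsto_fst.eventually eventually_mem_nhdsWithin
  have e2 : ∀ᶠ w : (ℝ × ℝ) × (ℝ × ℝ) in 𝓝[S] p ×ˢ 𝓝[S] z, w.2 ∈ S :=
    tendsto_snd.eventually eventually_mem_nhdsWithin
  have e3 := (t1.dist tendsto_const_nhds).eventually_lt_const hpd
  have e4 := (t2.dist tendsto_const_nhds).eventually_lt_const hzd
  filter_upwards [e1, e2, e3, e4] with w h1 h2 h3 h4 using h w.1 h1 h3 w.2 h2 h4 m n hmn

end

/-! ### Taylor coefficients along a curve -/

/-- The Taylor series at `0`. -/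
def taylorSeries (y : ℝ → ℝ) : PowerSeries ℝ := PowerSeries.mk (coef y)

lemma coeff_taylorSeries (y : ℝ → ℝ) (q : ℕ) : (taylorSeries y).coeff q = coef y q :=
  PowerSeries.coeff_mk _ _

section
variable {x y : ℝ → ℝ}

lemma _root_.ContDiffAt.of_infty {x : ℝ → ℝ} (hx : ContDiffAt ℝ ∞ x 0) (n : ℕ) :
    ContDiffAt ℝ n x 0 := hx.of_le (by exact_mod_cast le_top)

lemma coef_add (hx : ContDiffAt ℝ ∞ x 0) (hy : ContDiffAt ℝ ∞ y 0) (q : ℕ) :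
    coef (fun t ↦ x t + y t) q = coef x q + coef y q := by
  rw [coef, iteratedDeriv_fun_add (hx.of_infty q) (hy.of_infty q), add_div]; rfl

lemma coef_const_mul (c : ℝ) (q : ℕ) : coef (fun t ↦ c * x t) q = c * coef x q := by
  rw [coef, iteratedDeriv_const_mul_field, mul_div_assoc]; rfl

lemma coef_sub (hx : ContDiffAt ℝ ∞ x 0) (hy : ContDiffAt ℝ ∞ y 0) (q : ℕ) :
    coef (fun t ↦ x t - y t) q = coef x q - coef y q := by
  have : (fun t ↦ x t - y t) = fun t ↦ x t + (-1) * y t := by ext; ring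
  rw [this, coef_add hx (contDiffAt_const.mul hy), coef_const_mul]
  ring

lemma coef_zero_fun (q : ℕ) : coef (fun _ ↦ 0) q = 0 := by
  have := coef_const_mul (x := fun _ ↦ 0) 0 q
  simpa using this

lemma coef_sum {ι : Type*} (A : Finset ι) {f : ι → ℝ → ℝ} (hf : ∀ i ∈ A, ContDiffAt ℝ ∞ (f i) 0)
    (q : ℕ) : coef (fun t ↦ ∑ i ∈ A, f i t) q = ∑ i ∈ A, coef (f i) q := by
  classical
  induction A using Finset.induction_on with
  | empty => simp [coef_zero_fun]
  | insert a A ha ih =>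
    simp only [Finset.sum_insert ha]
    rw [coef_add (hf a (by simp)) (ContDiffAt.sum fun i hi ↦ hf i (by simp [hi])),
      ih fun i hi ↦ hf i (by simp [hi])]

lemma coef_zero_eq : coef y 0 = y 0 := by simp [coef]

lemma coef_one_eq : coef y 1 = deriv y 0 := by simp [coef]

/-- Divided by factorials, Leibniz's rule is the Cauchy product. Coefficient computations along the
curve thereby become algebra of power series. -/
lemma taylorSeries_mul (hx : ContDiffAt ℝ ∞ x 0) (hy : ContDiffAt ℝ ∞ y 0) :
    taylorSeries (fun t ↦ x t * y t) = taylorSeries x * taylorSeries y := by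
  ext q
  rw [PowerSeries.coeff_mul, coeff_taylorSeries, coef,
    show (fun t ↦ x t * y t) = x * y from rfl, iteratedDeriv_mul (hx.of_infty q) (hy.of_infty q),
    Finset.Nat.sum_antidiagonal_eq_sum_range_succ (fun i j ↦ (taylorSeries x).coeff i *
      (taylorSeries y).coeff j), Finset.sum_div]
  refine Finset.sum_congr rfl fun i hi ↦ ?_
  have hi' : i ≤ q := Nat.lt_succ_iff.1 (Finset.mem_range.1 hi)
  rw [coeff_taylorSeries, coeff_taylorSeries, coef, coef]
  have h := Nat.choose_mul_factorial_mul_factorial hi'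
  have h' : (q.choose i : ℝ) * i ! * (q - i)! = q ! := by exact_mod_cast h
  have h1 : (q ! : ℝ) ≠ 0 := by positivity
  have h2 : (i ! : ℝ) ≠ 0 := by positivity
  have h3 : ((q - i)! : ℝ) ≠ 0 := by positivity
  field_simp
  rw [← h']
  ring

lemma taylorSeries_one : taylorSeries (fun _ ↦ (1 : ℝ)) = 1 := by
  ext q
  rw [coeff_taylorSeries, coef, PowerSeries.coeff_one, iteratedDeriv_const]
  split_ifs with h
  · simp [h]
  · simp

lemma taylorSeries_pow (hx : ContDiffAt ℝ ∞ x 0) (n : ℕ) :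
    taylorSeries (fun t ↦ x t ^ n) = taylorSeries x ^ n := by
  induction n with
  | zero => simp [taylorSeries_one]
  | succ n ih => simp only [pow_succ]; rw [taylorSeries_mul (hx.pow n) hx, ih]

lemma exists_taylorSeries_eq_X_mul (h0 : x 0 = 0) :
    ∃ ξ : PowerSeries ℝ, taylorSeries x = PowerSeries.X * ξ ∧ ξ.coeff 0 = deriv x 0 := by
  have : PowerSeries.X ∣ taylorSeries x := by
    rw [PowerSeries.X_dvd_iff, ← PowerSeries.coeff_zero_eq_constantCoeff_apply, coeff_taylorSeries,
      coef_zero_eq, h0]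
  obtain ⟨ξ, hξ⟩ := this
  refine ⟨ξ, hξ, ?_⟩
  rw [← PowerSeries.coeff_succ_X_mul, ← hξ, coeff_taylorSeries, coef_one_eq]

/-- A smooth function of size `O(t ^ n)` has vanishing Taylor coefficients below order `n`. -/
lemma coef_eq_zero_of_isBigO (hy : ContDiffAt ℝ ∞ y 0) {n : ℕ}
    (h : y =O[𝓝 0] fun t ↦ t ^ n) : ∀ q < n, coef y q = 0 := by
  intro q
  induction q using Nat.strong_induction_on with
  | _ q ih =>
  intro hq
  obtain ⟨U, hU, hyU⟩ := (hy.of_infty q).contDiffOn le_rfl (by simp)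
  obtain ⟨ε, hε, hball⟩ := Metric.mem_nhds_iff.1 hU
  have hmem : Metric.ball (0 : ℝ) ε ∈ 𝓝 0 := Metric.ball_mem_nhds _ hε
  have ht := taylor_isLittleO (convex_ball (0 : ℝ) ε) (Metric.mem_ball_self hε) (hyU.mono hball)
  rw [nhdsWithin_eq_nhds.2 hmem] at ht
  have hcoef (i : ℕ) (hi : i ≤ q) :
      iteratedDerivWithin i y (Metric.ball (0 : ℝ) ε) 0 = i ! * coef y i := by
    rw [coef, iteratedDerivWithin_of_isOpen Metric.isOpen_ball (Metric.mem_ball_self hε)]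
    have : (i ! : ℝ) ≠ 0 := by positivity
    field_simp
  -- The lower coefficients vanish by induction, so the Taylor polynomial of degree `q` is a single
  -- monomial. It must be `o(t ^ q)`, which forces its coefficient to be zero.
  have hpoly : (fun t ↦ taylorWithinEval y q (Metric.ball (0 : ℝ) ε) 0 t)
      = fun t ↦ coef y q * t ^ q := by
    ext t
    rw [taylor_within_apply, Finset.sum_range_succ, Finset.sum_eq_zero, zero_add, hcoef q le_rfl]
    · have : (q ! : ℝ) ≠ 0 := by positivity
      simp only [sub_zero, smul_eq_mul]
      field_simp
    · intro i hi
      have hi' := Finset.mem_range.1 hi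
      rw [hcoef i hi'.le, ih i hi' (hi'.trans hq)]
      simp
  have h2 : y =o[𝓝 0] fun t ↦ t ^ q := h.trans_isLittleO (Asymptotics.isLittleO_pow_pow hq)
  simp only [sub_zero] at ht
  have h3 := h2.sub ht
  have h4 : (fun t ↦ coef y q * t ^ q) =o[𝓝 0] fun t ↦ t ^ q := by
    refine h3.congr_left fun t ↦ ?_
    have := congrFun hpoly t
    rw [this]; ring
  by_contra hne
  have h5 : (fun t : ℝ ↦ t ^ q) =o[𝓝 0] fun t ↦ t ^ q :=
    (Asymptotics.isLittleO_const_mul_left_iff hne).1 h4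
  have h6 := (Asymptotics.isLittleO_irrefl' (f' := fun t : ℝ ↦ t ^ q) (l := 𝓝[≠] 0) ?_)
  · exact h6 (h5.mono inf_le_left)
  · refine Eventually.frequently ?_
    filter_upwards [self_mem_nhdsWithin] with t ht
    simpa using fun h ↦ absurd h (by simpa using ht)

end

section
variable {r s : ℝ → ℝ} (hr : ContDiffAt ℝ ∞ r 0) (hs : ContDiffAt ℝ ∞ s 0)
  (r0 : r 0 = 0) (s0 : s 0 = 0)
include hr hs

lemma contDiffAt_taylorPoly_curve (K : ℕ) (J : Jet) :
    ContDiffAt ℝ ∞ (fun t ↦ taylorPoly K J (r t, s t)) 0 :=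
  (contDiff_taylorPoly K J).contDiffAt.comp 0 (hr.prodMk hs)

lemma contDiffAt_monomial_curve (m n : ℕ) : ContDiffAt ℝ ∞ (fun t ↦ r t ^ m * s t ^ n) 0 :=
  (hr.pow m).mul (hs.pow n)

lemma coef_taylorPoly_curve (K : ℕ) (J : Jet) (q : ℕ) :
    coef (fun t ↦ taylorPoly K J (r t, s t)) q
      = ∑ k ∈ Lam K, J k / (k.1 ! * k.2 !) * coef (fun t ↦ r t ^ k.1 * s t ^ k.2) q := by
  unfold taylorPoly
  simp only [mul_assoc]
  rw [coef_sum _ fun k _ ↦ contDiffAt_const.mul (contDiffAt_monomial_curve hr hs _ _)]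
  exact Finset.sum_congr rfl fun k _ ↦ coef_const_mul _ _

include r0 s0

/-- Each of `r` and `s` vanishes at 0 and so contributes one factor `X`. A monomial of degree `m +
n` therefore starts at `t ^ (m + n)`, with leading coefficient read off from the velocity; the
triangularity of the transmission system rests on this. -/
lemma taylorSeries_monomial_curve :
    ∃ ρ σ : PowerSeries ℝ, ρ.coeff 0 = deriv r 0 ∧ σ.coeff 0 = deriv s 0 ∧ ∀ m n,
      taylorSeries (fun t ↦ r t ^ m * s t ^ n) = PowerSeries.X ^ (m + n) * (ρ ^ m * σ ^ n) := by
  obtain ⟨ρ, hρ, h1⟩ := exists_taylorSeries_eq_X_mul r0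
  obtain ⟨σ, hσ, h2⟩ := exists_taylorSeries_eq_X_mul s0
  refine ⟨ρ, σ, h1, h2, fun m n ↦ ?_⟩
  rw [taylorSeries_mul (hr.pow m) (hs.pow n), taylorSeries_pow hr, taylorSeries_pow hs, hρ, hσ]
  ring

lemma coef_monomial_mul_of_lt {b : ℝ → ℝ} (hb : ContDiffAt ℝ ∞ b 0) {m n q : ℕ} (hq : q < m + n) :
    coef (fun t ↦ r t ^ m * s t ^ n * b t) q = 0 := by
  obtain ⟨ρ, σ, -, -, h⟩ := taylorSeries_monomial_curve hr hs r0 s0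
  rw [← coeff_taylorSeries, taylorSeries_mul (contDiffAt_monomial_curve hr hs m n) hb, h, mul_assoc,
    PowerSeries.coeff_X_pow_mul', if_neg (by omega)]

lemma coef_monomial_mul_self {b : ℝ → ℝ} (hb : ContDiffAt ℝ ∞ b 0) (m n : ℕ) :
    coef (fun t ↦ r t ^ m * s t ^ n * b t) (m + n) = deriv r 0 ^ m * deriv s 0 ^ n * b 0 := by
  obtain ⟨ρ, σ, h1, h2, h⟩ := taylorSeries_monomial_curve hr hs r0 s0
  rw [← coeff_taylorSeries, taylorSeries_mul (contDiffAt_monomial_curve hr hs m n) hb, h, mul_assoc,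
    PowerSeries.coeff_X_pow_mul', if_pos le_rfl, Nat.sub_self]
  have h3 : (taylorSeries b).coeff 0 = b 0 := by rw [coeff_taylorSeries, coef_zero_eq]
  simp only [PowerSeries.coeff_zero_eq_constantCoeff_apply] at h1 h2 h3 ⊢
  simp only [map_mul, map_pow, h1, h2, h3]

/-- The lowest coefficient of a Taylor polynomial along the curve, weighted by a smooth function. -/
lemma coef_taylorPoly_curve_mul {b : ℝ → ℝ} (hb : ContDiffAt ℝ ∞ b 0) {K q : ℕ} {J : Jet}
    (hJ : ∀ k, k.1 + k.2 < q → J k = 0) :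
    coef (fun t ↦ taylorPoly K J (r t, s t) * b t) q
      = ∑ k ∈ (Lam K).filter (fun k ↦ k.1 + k.2 = q),
          J k / (k.1 ! * k.2 !) * deriv r 0 ^ k.1 * deriv s 0 ^ k.2 * b 0 := by
  unfold taylorPoly
  simp only [Finset.sum_mul, mul_assoc]
  rw [coef_sum, Finset.sum_filter]
  · refine Finset.sum_congr rfl fun k _ ↦ ?_
    rw [coef_const_mul]
    simp only [← mul_assoc]
    split_ifs with h
    · rw [← h, coef_monomial_mul_self hr hs r0 s0 hb]; ring
    · rcases lt_or_gt_of_ne h with h | h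
      · rw [hJ k h]; simp
      · rw [coef_monomial_mul_of_lt hr hs r0 s0 hb h, mul_zero]
  · exact fun k _ ↦ contDiffAt_const.mul ((hr.pow _).mul ((hs.pow _).mul hb))

end

lemma contDiffAt_deriv {x : ℝ → ℝ} (hx : ContDiffAt ℝ ∞ x 0) : ContDiffAt ℝ ∞ (deriv x) 0 := by
  have h : ContDiffAt ℝ ∞ (fderiv ℝ x) 0 := hx.fderiv_right (by simp)
  exact h.clm_apply contDiffAt_const

section
variable {r s : ℝ → ℝ}

/-- This writes the flux through Taylor polynomials times smooth weights, the form required by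
`coef_taylorPoly_curve_mul`. -/
lemma fluxAlong_taylorPoly (α J : Jet) (t : ℝ) :
    fluxAlong α r s (taylorPoly 3 J) t
      = taylorPoly 2 (fun k ↦ J (k.1 + 1, k.2)) (r t, s t) * (taylorPoly 2 α (r t, s t) * deriv s t)
        - taylorPoly 2 (fun k ↦ J (k.1, k.2 + 1)) (r t, s t)
          * (taylorPoly 2 α (r t, s t) * deriv r t) := by
  rw [fluxAlong, pdx_taylorPoly le_rfl, pdy_taylorPoly le_rfl]
  ring

variable (hr : ContDiffAt ℝ ∞ r 0) (hs : ContDiffAt ℝ ∞ s 0) (r0 : r 0 = 0) (s0 : s 0 = 0)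
include hr hs

lemma contDiffAt_fluxAlong (α J : Jet) : ContDiffAt ℝ ∞ (fluxAlong α r s (taylorPoly 3 J)) 0 := by
  have : fluxAlong α r s (taylorPoly 3 J) = _ := funext (fluxAlong_taylorPoly α J)
  rw [this]
  have h := contDiffAt_taylorPoly_curve hr hs
  exact ((h 2 _).mul ((h 2 α).mul (contDiffAt_deriv hs))).sub
    ((h 2 _).mul ((h 2 α).mul (contDiffAt_deriv hr)))

include r0 s0

lemma coef_taylorPoly_three {q : ℕ} {J : Jet} (hJ : ∀ k, k.1 + k.2 < q → J k = 0) :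
    coef (fun t ↦ taylorPoly 3 J (r t, s t)) q
      = ∑ k ∈ (Lam 3).filter (fun k ↦ k.1 + k.2 = q),
          J k / (k.1 ! * k.2 !) * deriv r 0 ^ k.1 * deriv s 0 ^ k.2 := by
  have := coef_taylorPoly_curve_mul hr hs r0 s0 (b := fun _ ↦ 1) contDiffAt_const (K := 3) hJ
  simpa using this

/-- The gradient lowers the degree by one, so a jet that vanishes below order `q + 1` has a flux
starting at `t ^ q`. Only the value of `a` at the base point and the velocity at 0 enter that
coefficient. -/
lemma coef_fluxAlong {q : ℕ} (α : Jet) {J : Jet} (hJ : ∀ k, k.1 + k.2 < q + 1 → J k = 0) :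
    coef (fluxAlong α r s (taylorPoly 3 J)) q
      = ∑ k ∈ (Lam 2).filter (fun k ↦ k.1 + k.2 = q),
          deriv r 0 ^ k.1 * deriv s 0 ^ k.2 / (k.1 ! * k.2 !) * α (0, 0)
            * (J (k.1 + 1, k.2) * deriv s 0 - J (k.1, k.2 + 1) * deriv r 0) := by
  have h := contDiffAt_taylorPoly_curve hr hs
  have hα : taylorPoly 2 α (r 0, s 0) = α (0, 0) := by
    rw [r0, s0]; exact taylorPoly_at_zero 2 α
  have : fluxAlong α r s (taylorPoly 3 J) = _ := funext (fluxAlong_taylorPoly α J)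
  rw [this, coef_sub ((h 2 _).mul ((h 2 α).mul (contDiffAt_deriv hs)))
    ((h 2 _).mul ((h 2 α).mul (contDiffAt_deriv hr))),
    coef_taylorPoly_curve_mul hr hs r0 s0 ((h 2 α).mul (contDiffAt_deriv hs))
      (fun k hk ↦ hJ _ (by simp only; omega)),
    coef_taylorPoly_curve_mul hr hs r0 s0 ((h 2 α).mul (contDiffAt_deriv hr))
      (fun k hk ↦ hJ _ (by simp only; omega)), ← Finset.sum_sub_distrib]
  refine Finset.sum_congr rfl fun k _ ↦ ?_
  rw [hα]
  ring

end

/-! ### The reduced Taylor polynomials -/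

lemma G_eq (α : Jet) (k : ℕ × ℕ) : G α k = taylorPoly 3 (fullJet α (Pi.single k 1) 0) := rfl

lemma H_eq (α : Jet) (k : ℕ × ℕ) : H α k = taylorPoly 3 (fullJet α 0 (Pi.single k 1)) := rfl

lemma sum_Lam1_three (w : ℕ × ℕ → ℝ) : ∑ k ∈ Lam1 3, w k
    = w (0, 0) + w (0, 1) + w (1, 0) + w (0, 2) + w (1, 1) + w (0, 3) + w (1, 2) := by
  rw [show Lam1 3 = {(0, 0), (0, 1), (1, 0), (0, 2), (1, 1), (0, 3), (1, 2)} by decide]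
  simp [add_assoc]

lemma mem_Lam1 {K : ℕ} {k : ℕ × ℕ} : k ∈ Lam1 K ↔ k.1 + k.2 ≤ K ∧ k.1 ≤ 1 := by
  simp only [Lam1, Lam, Finset.mem_filter, Finset.mem_product, Finset.mem_range]
  omega

lemma sum_Lam1_succ {p : ℕ} (hp : p ≤ 2) (w : ℕ × ℕ → ℝ) :
    ∑ k ∈ Lam1 (p + 1), w k = ∑ k ∈ Lam1 p, w k + w (0, p + 1) + w (1, p) := by
  have h : Lam1 (p + 1) = insert (1, p) (insert (0, p + 1) (Lam1 p)) := by
    interval_cases p <;> decide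
  have h1 : (0, p + 1) ∉ Lam1 p := by simp [mem_Lam1]
  have h2 : (1, p) ∉ insert (0, p + 1) (Lam1 p) := by simp [mem_Lam1]
  rw [h, Finset.sum_insert h2, Finset.sum_insert h1]
  ring

/-- The equation expresses a derivative through derivatives of the same or lower order, so a free
derivative never influences derivatives of lower order than its own. Thus `G α k` has no terms of
degree below `k.1 + k.2`. -/
lemma fullJet_single_eq_zero (α : Jet) {j k : ℕ × ℕ} (hk : k ∈ Lam1 3)
    (hj : j.1 + j.2 < k.1 + k.2) : fullJet α (Pi.single k 1) 0 j = 0 := by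
  have hk' := (mem_Lam1.1 hk).1
  unfold fullJet
  split
  · simp only at hj
    rw [show Lam1 3 = {(0, 0), (0, 1), (1, 0), (0, 2), (1, 1), (0, 3), (1, 2)} by decide] at hk
    simp only [Finset.mem_insert, Finset.mem_singleton] at hk
    rcases hk with rfl | rfl | rfl | rfl | rfl | rfl | rfl <;> simp_all [red20]
  · simp only at hj; omega
  · simp only at hj; omega
  · rw [Pi.single_eq_of_ne]
    rintro rfl
    exact lt_irrefl _ hj

/-- The Taylor polynomial is the combination of the reduced Taylor polynomials. -/
lemma taylorPoly_fullJet (α U F : Jet) (z : ℝ × ℝ) :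
    taylorPoly 3 (fullJet α U F) z
      = ∑ k ∈ Lam1 3, U k * G α k z + ∑ k ∈ Lam 1, F k * H α k z := by
  simp only [sum_Lam1_three, sum_Lam_one, G_eq, H_eq, taylorPoly_three, fullJet, red20,
    Pi.single_apply, Pi.zero_apply, Prod.mk.injEq, zero_ne_one, one_ne_zero, OfNat.ofNat_ne_zero,
    OfNat.zero_ne_ofNat, OfNat.one_ne_ofNat, OfNat.ofNat_ne_one, and_true, and_false,
    and_self, if_true, if_false, mul_zero, mul_one, add_zero, zero_add, neg_zero, zero_div,
    sub_zero, zero_mul, Nat.reduceEqDiff]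
  ring

namespace Config

variable {c : Config}

section
variable (hr : ContDiffAt ℝ ∞ c.r 0) (hs : ContDiffAt ℝ ∞ c.s 0) (r0 : c.r 0 = 0) (s0 : c.s 0 = 0)
include hr hs r0 s0

lemma gP_eq_zero {k : ℕ × ℕ} (hk : k ∈ Lam1 3) {q : ℕ} (hq : q < k.1 + k.2) : c.gP k q = 0 := by
  rw [gP, G_eq, coef_taylorPoly_three hr hs r0 s0
    fun j hj ↦ fullJet_single_eq_zero _ hk (hj.trans hq)]
  refine Finset.sum_eq_zero fun j hj ↦ ?_
  rw [fullJet_single_eq_zero _ hk ((Finset.mem_filter.1 hj).2.trans_lt hq)]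
  simp

lemma gM_eq_zero {k : ℕ × ℕ} (hk : k ∈ Lam1 3) {q : ℕ} (hq : q < k.1 + k.2) : c.gM k q = 0 :=
  -- The negative side is the positive side of the configuration whose two coefficient jets are both
  -- `c.aM`.
  gP_eq_zero (c := ⟨c.aM, c.aM, c.r, c.s, c.v, c.w, c.d⟩) hr hs r0 s0 hk hq

lemma gtP_eq_zero {k : ℕ × ℕ} (hk : k ∈ Lam1 3) {q : ℕ} (hq : q + 1 < k.1 + k.2) :
    c.gtP k q = 0 := by
  rw [gtP, G_eq, coef_fluxAlong hr hs r0 s0 _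
    fun j hj ↦ fullJet_single_eq_zero _ hk (hj.trans hq)]
  refine Finset.sum_eq_zero fun j hj ↦ ?_
  have hj := (Finset.mem_filter.1 hj).2
  rw [fullJet_single_eq_zero _ hk (by simp only; omega),
    fullJet_single_eq_zero _ hk (by simp only; omega)]
  simp

lemma gtM_eq_zero {k : ℕ × ℕ} (hk : k ∈ Lam1 3) {q : ℕ} (hq : q + 1 < k.1 + k.2) :
    c.gtM k q = 0 :=
  gtP_eq_zero (c := ⟨c.aM, c.aM, c.r, c.s, c.v, c.w, c.d⟩) hr hs r0 s0 hk hq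

/-- The determinant of the two by two system of order `p + 1`. -/
lemma det_ne_zero (ha : c.aM (0, 0) ≠ 0) (hreg : deriv c.r 0 ^ 2 + deriv c.s 0 ^ 2 ≠ 0) {p : ℕ}
    (hp : p ≤ 2) :
    c.gM (0, p + 1) (p + 1) * c.gtM (1, p) p - c.gM (1, p) (p + 1) * c.gtM (0, p + 1) p ≠ 0 := by
  have h1 : (0, p + 1) ∈ Lam1 3 := by simp [mem_Lam1]; omega
  have h2 : (1, p) ∈ Lam1 3 := by simp [mem_Lam1]; omega
  simp only [gM, gtM, G_eq]
  rw [coef_taylorPoly_three hr hs r0 s0 fun j hj ↦ fullJet_single_eq_zero _ h1 (by simp only; omega),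
    coef_taylorPoly_three hr hs r0 s0 fun j hj ↦ fullJet_single_eq_zero _ h2 (by simp only; omega),
    coef_fluxAlong hr hs r0 s0 _ fun j hj ↦ fullJet_single_eq_zero _ h1 (by simp only; omega),
    coef_fluxAlong hr hs r0 s0 _ fun j hj ↦ fullJet_single_eq_zero _ h2 (by simp only; omega)]
  set R := deriv c.r 0
  set S := deriv c.s 0
  set A := c.aM (0, 0)
  -- With `q = p + 1`, the lowest-degree parts of `G_{0,q}` and `G_{1,q-1}` are harmonic, namely the
  -- real and imaginary parts of `(y + ix)^q / q!`. For `ζ = S + iR` their values along the curve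
  -- have leading coefficients `Re ζ^q / q!` and `Im ζ^q / q!`, and their fluxes `-A Im ζ^q /
  -- (q-1)!` and `A Re ζ^q / (q-1)!`. The determinant is therefore `A (R² + S²)^q / (q! (q-1)!)`,
  -- which explains the factors 1, 2 and 12 below.
  have hmain : A * (R ^ 2 + S ^ 2) ^ (p + 1) ≠ 0 := mul_ne_zero ha (pow_ne_zero _ hreg)
  simp only [Finset.sum_filter, sum_Lam_three, sum_Lam_two]
  intro h0
  apply hmain
  interval_cases p
  · simp [fullJet] at h0
    linear_combination h0
  · simp [fullJet, red20] at h0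
    linear_combination 2 * h0
  · simp [fullJet, red20, Nat.factorial] at h0
    linear_combination 12 * h0

end

/-- If the Taylor coefficients satisfy the interface conditions along the curve, the recursion
recovers the derivatives on the negative side. -/
lemma minusJet_eq (hr : ContDiffAt ℝ ∞ c.r 0) (hs : ContDiffAt ℝ ∞ c.s 0) (r0 : c.r 0 = 0)
    (s0 : c.s 0 = 0) (ha : c.aM (0, 0) ≠ 0) (hreg : deriv c.r 0 ^ 2 + deriv c.s 0 ^ 2 ≠ 0)
    {uP uM fP fM g₁ g₂ : Jet} (h0 : uP (0, 0) - uM (0, 0) = g₁ (0, 0))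
    (hu : ∀ q ≤ 3, ∑ k ∈ Lam1 3, uP k * c.gP k q - ∑ k ∈ Lam1 3, uM k * c.gM k q
      = c.rhsU fP fM g₁ q)
    (hflux : ∀ q ≤ 2, ∑ k ∈ Lam1 3, uP k * c.gtP k q - ∑ k ∈ Lam1 3, uM k * c.gtM k q
      = c.rhsFlux fP fM g₂ q) :
    ∀ p ≤ 3, c.minusJet uP fP fM g₁ g₂ p = fun k ↦ if k ∈ Lam1 p then uM k else 0 := by
  intro p
  induction p with
  | zero =>
    intro _
    ext k
    simp only [minusJet, Pi.single_apply, mem_Lam1]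
    by_cases hk : k = (0, 0)
    · subst hk; simp; linarith
    · rw [if_neg hk, if_neg]
      rintro ⟨h1, -⟩
      exact hk (Prod.ext (by simp only; omega) (by simp only; omega))
  | succ p ih =>
    intro hp
    have hp2 : p ≤ 2 := by omega
    have hsub : Lam1 (p + 1) ⊆ Lam1 3 := fun k hk ↦ by
      rw [mem_Lam1] at hk ⊢; omega
    -- Unknowns of order above `p + 1` do not occur in the coefficient of `t ^ (p + 1)` of the jump,
    -- nor in that of `t ^ p` of the flux.
    have trunc (w : ℕ × ℕ → ℝ) (hw : ∀ k ∈ Lam1 3, p + 1 < k.1 + k.2 → w k = 0) :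
        ∑ k ∈ Lam1 3, w k = ∑ k ∈ Lam1 (p + 1), w k := by
      refine (Finset.sum_subset hsub fun k hk hk' ↦ hw k hk ?_).symm
      rw [mem_Lam1] at hk hk'; omega
    have eu := hu (p + 1) hp
    have ef := hflux p hp2
    rw [trunc _ fun k hk h ↦ by rw [gP_eq_zero hr hs r0 s0 hk h, mul_zero],
      trunc _ fun k hk h ↦ by rw [gM_eq_zero hr hs r0 s0 hk h, mul_zero],
      sum_Lam1_succ hp2 fun k ↦ uM k * c.gM k (p + 1)] at eu
    rw [trunc _ fun k hk h ↦ by rw [gtP_eq_zero hr hs r0 s0 hk h, mul_zero],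
      trunc _ fun k hk h ↦ by rw [gtM_eq_zero hr hs r0 s0 hk h, mul_zero],
      sum_Lam1_succ hp2 fun k ↦ uM k * c.gtM k p] at ef
    have hD := det_ne_zero hr hs r0 s0 ha hreg hp2
    have hV (w : ℕ × ℕ → ℝ) : ∑ k ∈ Lam1 p, (if k ∈ Lam1 p then uM k else 0) * w k
        = ∑ k ∈ Lam1 p, uM k * w k :=
      Finset.sum_congr rfl fun k hk ↦ by rw [if_pos hk]
    rw [minusJet, ih (by omega)]
    simp only [hV]
    set b₁ : ℝ := ∑ k ∈ Lam1 (p + 1), uP k * c.gP k (p + 1) - ∑ k ∈ Lam1 p, uM k * c.gM k (p + 1)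
      - c.rhsU fP fM g₁ (p + 1) with hb₁
    set b₂ : ℝ := ∑ k ∈ Lam1 (p + 1), uP k * c.gtP k p - ∑ k ∈ Lam1 p, uM k * c.gtM k p
      - c.rhsFlux fP fM g₂ p with hb₂
    have e1 : b₁ = uM (0, p + 1) * c.gM (0, p + 1) (p + 1) + uM (1, p) * c.gM (1, p) (p + 1) := by
      rw [hb₁]; linarith
    have e2 : b₂ = uM (0, p + 1) * c.gtM (0, p + 1) p + uM (1, p) * c.gtM (1, p) p := by
      rw [hb₂]; linarith
    -- Cramer's rule for the two unknowns of order `p + 1`, those of lower order being known by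
    -- induction.
    have x1 : (c.gtM (1, p) p * b₁ - c.gM (1, p) (p + 1) * b₂)
        / (c.gM (0, p + 1) (p + 1) * c.gtM (1, p) p - c.gM (1, p) (p + 1) * c.gtM (0, p + 1) p)
        = uM (0, p + 1) := by
      rw [div_eq_iff hD, e1, e2]; ring
    have x2 : (c.gM (0, p + 1) (p + 1) * b₂ - c.gtM (0, p + 1) p * b₁)
        / (c.gM (0, p + 1) (p + 1) * c.gtM (1, p) p - c.gM (1, p) (p + 1) * c.gtM (0, p + 1) p)
        = uM (1, p) := by
      rw [div_eq_iff hD, e1, e2]; ring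
    rw [x1, x2]
    ext k
    simp only [Pi.add_apply, Pi.single_apply, mem_Lam1]
    by_cases h1 : k = (0, p + 1)
    · subst h1; simp
    by_cases h2 : k = (1, p)
    · subst h2; simp [add_comm]
    rw [if_neg h1, if_neg h2, add_zero, add_zero]
    refine if_congr ?_ rfl rfl
    have h1' : ¬ (k.1 = 0 ∧ k.2 = p + 1) := fun h ↦ h1 (Prod.ext h.1 h.2)
    have h2' : ¬ (k.1 = 1 ∧ k.2 = p) := fun h ↦ h2 (Prod.ext h.1 h.2)
    omega

/-! ### Linearity of the recursion -/

lemma minusJet_add (u u' fP fP' fM fM' g₁ g₁' g₂ g₂' : Jet) (p : ℕ) :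
    c.minusJet (u + u') (fP + fP') (fM + fM') (g₁ + g₁') (g₂ + g₂') p
      = c.minusJet u fP fM g₁ g₂ p + c.minusJet u' fP' fM' g₁' g₂' p := by
  induction p with
  | zero =>
    simp only [minusJet, Pi.add_apply, ← Pi.single_add]
    congr 1; ring
  | succ p ih =>
    simp only [minusJet, ih, rhsU, rhsFlux, Pi.add_apply, add_mul, add_div, Finset.sum_add_distrib,
      Finset.sum_sub_distrib]
    ext k
    simp only [Pi.add_apply, Pi.single_apply]
    split_ifs <;> ring

lemma minusJet_smul (a : ℝ) (u fP fM g₁ g₂ : Jet) (p : ℕ) :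
    c.minusJet (a • u) (a • fP) (a • fM) (a • g₁) (a • g₂) p
      = a • c.minusJet u fP fM g₁ g₂ p := by
  induction p with
  | zero =>
    simp only [minusJet, Pi.smul_apply, ← Pi.single_smul, smul_eq_mul]
    congr 1; ring
  | succ p ih =>
    simp only [minusJet, ih, rhsU, rhsFlux, Pi.smul_apply, smul_eq_mul, mul_assoc, mul_div_assoc,
      ← Finset.mul_sum, ← mul_sub, ← mul_add]
    ext k
    simp only [Pi.add_apply, Pi.single_apply, Pi.smul_apply, smul_eq_mul, div_mul_eq_mul_div,
      mul_div_assoc]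
    split_ifs <;> ring

variable (c) in
/-- The recursion as a linear map. -/
def minusJetLin (p : ℕ) : (Jet × Jet × Jet × Jet × Jet) →ₗ[ℝ] Jet where
  toFun x := c.minusJet x.1 x.2.1 x.2.2.1 x.2.2.2.1 x.2.2.2.2 p
  map_add' _ _ := minusJet_add _ _ _ _ _ _ _ _ _ _ p
  map_smul' a _ := minusJet_smul a _ _ _ _ _ p

/-- The recursion reads only finitely many entries of each jet, so each jet may be replaced by a
finite combination of unit jets, to which linearity applies. -/
lemma minusJet_congr {u u' fP fP' fM fM' g₁ g₁' g₂ g₂' : Jet} (hu : ∀ k ∈ Lam1 3, u k = u' k)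
    (hP : ∀ k ∈ Lam 1, fP k = fP' k) (hM : ∀ k ∈ Lam 1, fM k = fM' k)
    (h₁ : ∀ k ∈ Lam 3, g₁ k = g₁' k) (h₂ : ∀ k ∈ Lam 2, g₂ k = g₂' k) :
    ∀ p ≤ 3, c.minusJet u fP fM g₁ g₂ p = c.minusJet u' fP' fM' g₁' g₂' p := by
  intro p
  induction p with
  | zero => intro _; simp only [minusJet]; rw [hu (0, 0) (by decide), h₁ (0, 0) (by decide)]
  | succ p ih =>
    intro hp
    have e1 : c.rhsU fP fM g₁ = c.rhsU fP' fM' g₁' := by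
      ext q
      simp only [rhsU]
      rw [Finset.sum_congr rfl fun k hk ↦ by rw [hP k hk, hM k hk],
        Finset.sum_congr (s₁ := Lam 3) rfl fun k hk ↦ by rw [h₁ k hk]]
    have e2 : c.rhsFlux fP fM g₂ = c.rhsFlux fP' fM' g₂' := by
      ext q
      simp only [rhsFlux]
      rw [Finset.sum_congr rfl fun k hk ↦ by rw [hP k hk, hM k hk],
        Finset.sum_congr (s₁ := Lam 2) rfl fun k hk ↦ by rw [h₂ k hk]]
    have e3 (w : ℕ × ℕ → ℝ) : ∑ k ∈ Lam1 (p + 1), u k * w k = ∑ k ∈ Lam1 (p + 1), u' k * w k :=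
      Finset.sum_congr rfl fun k hk ↦ by
        rw [hu k (by rw [mem_Lam1] at hk ⊢; omega)]
    simp only [minusJet, ih (by omega), e1, e2, e3]

/-- The transmission coefficients represent the recursion. -/
lemma minusJet_eq_sum (u fP fM g₁ g₂ : Jet) (j : ℕ × ℕ) :
    c.minusJet u fP fM g₁ g₂ 3 j
      = ∑ k ∈ Lam1 3, u k * c.Tu j k + ∑ k ∈ Lam 1, (fP k * c.TfP j k + fM k * c.TfM j k)
        + ∑ k ∈ Lam 3, g₁ k * c.Tg1 j k + ∑ k ∈ Lam 2, g₂ k * c.Tg2 j k := by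
  have trunc (A : Finset (ℕ × ℕ)) (w : Jet) (k) (hk : k ∈ A) :
      w k = (∑ i ∈ A, w i • Pi.single i (1 : ℝ) : Jet) k := by
    simp [Finset.sum_apply, Pi.single_apply, hk]
  rw [minusJet_congr (trunc _ u) (trunc _ fP) (trunc _ fM) (trunc _ g₁) (trunc _ g₂) 3 le_rfl]
  -- By linearity the five kinds of data contribute separately.
  have hsplit : ∀ a b c' d e : Jet, c.minusJet a b c' d e 3
      = c.minusJetLin 3 (a, 0, 0, 0, 0) + c.minusJetLin 3 (0, b, 0, 0, 0)
        + c.minusJetLin 3 (0, 0, c', 0, 0) + c.minusJetLin 3 (0, 0, 0, d, 0)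
        + c.minusJetLin 3 (0, 0, 0, 0, e) := by
    intro a b c' d e
    simp only [← map_add, Prod.mk_add_mk, add_zero, zero_add]
    rfl
  have comb (A : Finset (ℕ × ℕ)) (w : Jet) (ι : Jet →ₗ[ℝ] (Jet × Jet × Jet × Jet × Jet)) :
      c.minusJetLin 3 (ι (∑ i ∈ A, w i • Pi.single i (1 : ℝ))) j
        = ∑ i ∈ A, w i * c.minusJetLin 3 (ι (Pi.single i 1)) j := by
    simp only [map_sum, map_smul, Finset.sum_apply, Pi.smul_apply, smul_eq_mul]
  rw [hsplit]
  simp only [Pi.add_apply, Finset.sum_add_distrib]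
  have c1 := comb (Lam1 3) u (LinearMap.inl ℝ Jet _)
  have c2 := comb (Lam 1) fP (LinearMap.inr ℝ Jet _ ∘ₗ LinearMap.inl ℝ Jet _)
  have c3 := comb (Lam 1) fM (LinearMap.inr ℝ Jet _ ∘ₗ LinearMap.inr ℝ Jet _ ∘ₗ LinearMap.inl ℝ Jet _)
  have c4 := comb (Lam 3) g₁ (LinearMap.inr ℝ Jet _ ∘ₗ LinearMap.inr ℝ Jet _ ∘ₗ
    LinearMap.inr ℝ Jet _ ∘ₗ LinearMap.inl ℝ Jet _)
  have c5 := comb (Lam 2) g₂ (LinearMap.inr ℝ Jet _ ∘ₗ LinearMap.inr ℝ Jet _ ∘ₗ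
    LinearMap.inr ℝ Jet _ ∘ₗ LinearMap.inr ℝ Jet _)
  refine (congrArg₂ (· + ·) (congrArg₂ (· + ·) (congrArg₂ (· + ·) (congrArg₂ (· + ·) c1 c2) c3) c4)
    c5).trans ?_
  simp only [add_assoc]
  rfl

end Config

/-! ### Existence of stencil coefficients -/

/-- An underdetermined homogeneous polynomial system has a solution that is nonzero at `0`. -/
lemma exists_polynomial_solution {ι κ : Type*} [Fintype ι] [Fintype κ]
    (h : Fintype.card κ < Fintype.card ι) (A : κ → ι → Polynomial ℝ) :
    ∃ C : ι → Polynomial ℝ, (∃ i, (C i).coeff 0 ≠ 0) ∧ ∀ k, ∑ i, A k i * C i = 0 := by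
  classical
  obtain ⟨C, hC0, hC⟩ : ∃ C : ι → Polynomial ℝ, C ≠ 0 ∧ ∀ k, ∑ i, A k i * C i = 0 := by
    -- The columns are more numerous than the rank of the free module in which they lie, so they are
    -- dependent over the polynomial ring.
    have hnot : ¬ LinearIndependent (Polynomial ℝ) (fun (i : ι) (k : κ) ↦ A k i) := fun hli ↦ by
      have := hli.fintype_card_le_finrank
      rw [Module.finrank_fintype_fun_eq_card] at this
      omega
    obtain ⟨C, hC, i, hi⟩ := Fintype.not_linearIndependent_iff.1 hnot
    refine ⟨C, fun h ↦ hi (congrFun h i), fun k ↦ ?_⟩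
    have := congrFun hC k
    simpa [Finset.sum_apply, mul_comm] using this
  -- If all components vanish at 0, the solution can be divided by `X`, which lowers the total
  -- degree; this must stop.
  induction hn : ∑ i, (C i).natDegree using Nat.strong_induction_on generalizing C with
  | _ n ih =>
  by_cases hex : ∃ i, (C i).coeff 0 ≠ 0
  · exact ⟨C, hex, hC⟩
  push Not at hex
  have hX (i : ι) : C i = Polynomial.X * (C i).divX := by
    have := Polynomial.X_mul_divX_add (C i)
    rw [hex i, map_zero, add_zero] at this
    exact this.symm
  refine ih (∑ i, (C i).divX.natDegree) ?_ (fun i ↦ (C i).divX) ?_ ?_ rfl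
  · rw [← hn]
    obtain ⟨i, hi⟩ := Function.ne_iff.1 hC0
    refine Finset.sum_lt_sum (fun j _ ↦ ?_) ⟨i, Finset.mem_univ i, ?_⟩
    · rw [Polynomial.natDegree_divX_eq_natDegree_tsub_one]; omega
    · have hne : (C i).divX ≠ 0 := fun h ↦ hi (by rw [hX i, h, mul_zero]; rfl)
      conv_rhs => rw [hX i]
      rw [Polynomial.natDegree_X_mul hne]
      omega
  · intro h0
    refine hC0 (funext fun i ↦ ?_)
    rw [hX i, congrFun h0 i, Pi.zero_apply, mul_zero]
  · intro k
    have h1 := hC k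
    have h2 : ∑ i, A k i * C i = Polynomial.X * ∑ i, A k i * (C i).divX := by
      rw [Finset.mul_sum]
      exact Finset.sum_congr rfl fun i _ ↦ by conv_lhs => rw [hX i, mul_left_comm]
    rw [h2] at h1
    exact (mul_eq_zero.1 h1).resolve_left Polynomial.X_ne_zero

lemma exists_polynomial_taylorPoly_node (c : Config) (K : ℕ) (J : Jet) (e : ℤ × ℤ) :
    ∃ A : Polynomial ℝ, ∀ h, A.eval h = taylorPoly K J (c.node h e) := by
  refine ⟨∑ k ∈ Lam K, Polynomial.C (J k / (k.1 ! * k.2 !)) *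
    (Polynomial.C (c.v + e.1) * Polynomial.X) ^ k.1 *
    (Polynomial.C (c.w + e.2) * Polynomial.X) ^ k.2, fun h ↦ ?_⟩
  simp [taylorPoly, Config.node, Polynomial.eval_finsetSum]

namespace Config

variable (c : Config)

/-- `I_{m,n}(h)` is a linear form in the stencil coefficients with coefficients polynomial in `h`. -/
lemma exists_polynomial_I (hd : c.d ⊆ stencil) : ∃ A : ℕ × ℕ → ℤ × ℤ → Polynomial ℝ,
    ∀ C h k, c.I C h k = ∑ e ∈ stencil, (A k e).eval h * C e := by
  choose AP hAP using fun (k : ℕ × ℕ) (e : ℤ × ℤ) ↦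
    exists_polynomial_taylorPoly_node c 3 (fullJet c.aP (Pi.single k 1) 0) e
  choose AM hAM using fun (k : ℕ × ℕ) (e : ℤ × ℤ) ↦
    exists_polynomial_taylorPoly_node c 3 (fullJet c.aM (Pi.single k 1) 0) e
  refine ⟨fun k e ↦ if e ∈ c.d then AP k e
    else ∑ j ∈ Lam1 3, AM j e * Polynomial.C (c.Tu j k), fun C h k ↦ ?_⟩
  rw [← Finset.sum_sdiff hd, add_comm, I, IP]
  congr 1
  · refine Finset.sum_congr rfl fun e he ↦ ?_
    simp only [if_pos he, hAP, mul_comm (C e)]; rfl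
  · simp only [IM, Finset.sum_mul]
    rw [Finset.sum_comm]
    refine Finset.sum_congr rfl fun e he ↦ ?_
    simp only [if_neg (Finset.mem_sdiff.1 he).2]
    rw [Polynomial.eval_finsetSum, Finset.sum_mul]
    refine Finset.sum_congr rfl fun j _ ↦ ?_
    rw [Polynomial.eval_mul, Polynomial.eval_C, hAM, G_eq]
    ring

/-- The system `I_{m,n}(h) = O(h^4)` has a nontrivial polynomial solution. -/
lemma exists_isNontrivialSolution (hd : c.d ⊆ stencil) :
    ∃ C : ℤ × ℤ → Polynomial ℝ, c.IsNontrivialSolution C := by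
  classical
  obtain ⟨A, hA⟩ := c.exists_polynomial_I hd
  have hcard : Fintype.card (Lam1 3) < Fintype.card stencil := by
    rw [Fintype.card_coe, Fintype.card_coe]; decide
  obtain ⟨D, ⟨i, hi⟩, hD⟩ := exists_polynomial_solution hcard
    fun (k : Lam1 3) (e : stencil) ↦ A k e
  -- Reducing an exact solution modulo `X ^ 4` leaves its constant terms unchanged and alters each
  -- `I_{m,n}` by a multiple of `h ^ 4`.
  set M : Polynomial ℝ := Polynomial.X ^ 4 with hM
  have hmonic : M.Monic := Polynomial.monic_X_pow 4
  set D' : ℤ × ℤ → Polynomial ℝ := fun e ↦ if he : e ∈ stencil then D ⟨e, he⟩ else 0 with hD'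
  have hdiv (e : ℤ × ℤ) : D' e %ₘ M + M * (D' e /ₘ M) = D' e := Polynomial.modByMonic_add_div _ _
  refine ⟨fun e ↦ D' e %ₘ M, fun e _ ↦ ?_, ⟨i, i.2, ?_⟩, fun k hk ↦ ?_⟩
  · have := Polynomial.degree_modByMonic_lt (D' e) hmonic
    rwa [hM, Polynomial.degree_X_pow] at this
  · have h1 := congrArg (Polynomial.coeff · 0) (hdiv i)
    have h2 : D' i = D i := by simp [hD']
    simp only [Polynomial.coeff_add, hM, Polynomial.mul_coeff_zero, Polynomial.coeff_X_pow] at h1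
    rw [h2] at h1
    simp only [OfNat.zero_ne_ofNat, if_false, zero_mul, add_zero] at h1
    rw [h2, hM, h1]
    exact hi
  · have hsum : ∑ e ∈ stencil, A k e * D' e = 0 := by
      rw [← Finset.sum_coe_sort, ← hD ⟨k, hk⟩]
      exact Finset.sum_congr rfl fun e _ ↦ by simp [hD']
    have hI : (fun h : ℝ ↦ c.I (fun e ↦ (D' e %ₘ M).eval h) h k)
        = fun h ↦ (-∑ e ∈ stencil, A k e * (D' e /ₘ M)).eval h * h ^ 4 := by
      ext h
      rw [hA]
      have h1 := congrArg (Polynomial.eval h) hsum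
      rw [Polynomial.eval_finsetSum, Polynomial.eval_zero] at h1
      rw [Polynomial.eval_neg, Polynomial.eval_finsetSum, neg_mul, eq_neg_iff_add_eq_zero,
        Finset.sum_mul, ← Finset.sum_add_distrib, ← h1]
      refine Finset.sum_congr rfl fun e _ ↦ ?_
      conv_rhs => rw [← hdiv e]
      simp only [Polynomial.eval_mul, Polynomial.eval_add, hM, Polynomial.eval_pow,
        Polynomial.eval_X]
      ring
    rw [hI]
    have hO : (fun h : ℝ ↦ (-∑ e ∈ stencil, A k e * (D' e /ₘ M)).eval h) =O[𝓝 0]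
        fun _ ↦ (1 : ℝ) :=
      (Polynomial.continuous _).continuousAt.tendsto.isBigO_one ℝ
    simpa using hO.mul (Asymptotics.isBigO_refl (fun h : ℝ ↦ h ^ 4) (𝓝 0))

end Config

/-! ### One-sided limits and regularity up to the interface -/

lemma _root_.UniformContinuousOn.exists_tendsto_nhdsWithin {S : Set (ℝ × ℝ)} {g : ℝ × ℝ → ℝ}
    (h : UniformContinuousOn g S) {q : ℝ × ℝ} (hq : q ∈ closure S) :
    ∃ L, Tendsto g (𝓝[S] q) (𝓝 L) := by
  have : (𝓝[S] q).NeBot := mem_closure_iff_nhdsWithin_neBot.1 hq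
  -- Uniform continuity makes the image of the filter of points of `S` near `q` a Cauchy filter,
  -- which converges by completeness.
  have hc : Cauchy (map g (𝓝[S] q)) := by
    refine ⟨inferInstance, ?_⟩
    rw [prod_map_map_eq]
    refine h.mono_left (le_inf ?_ ?_)
    · exact (Filter.prod_mono inf_le_left inf_le_left).trans (nhds_prod_eq.symm.le.trans
        (nhds_le_uniformity q))
    · rw [← prod_principal_principal]
      exact Filter.prod_mono inf_le_right inf_le_right
  exact cauchy_map_iff_exists_tendsto.1 hc

/-- The one-sided jet at `p`. -/
def limJet (S : Set (ℝ × ℝ)) (v : ℝ × ℝ → ℝ) (p : ℝ × ℝ) : Jet :=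
  fun k ↦ extendFrom S (pd k.1 k.2 v) p

/-- `v` is `N` times differentiable in `S` and its derivatives have limits on `T`. -/
structure RegularUpTo (T S : Set (ℝ × ℝ)) (N : ℕ) (v : ℝ × ℝ → ℝ) : Prop where
  contDiffOn : ContDiffOn ℝ N v S
  exists_lim : ∀ m n, m + n ≤ N → ∀ q ∈ T, ∃ L, Tendsto (pd m n v) (𝓝[S] q) (𝓝 L)

/-- An open set one-sided to the curve `T`. -/
structure IsSide (T S : Set (ℝ × ℝ)) : Prop where
  isOpen : IsOpen S
  quasiconvex : ∀ p ∈ T, LocallyQuasiconvexAt S p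
  closure : T ⊆ closure S

section
variable {T S : Set (ℝ × ℝ)} {v : ℝ × ℝ → ℝ} {N : ℕ}

lemma RegularUpTo.mono {M : ℕ} (h : RegularUpTo T S N v) (hM : M ≤ N) : RegularUpTo T S M v :=
  ⟨h.contDiffOn.of_le (by exact_mod_cast hM), fun m n hmn ↦ h.exists_lim m n (hmn.trans hM)⟩

lemma RegularUpTo.tendsto (h : RegularUpTo T S N v) {m n : ℕ} (hmn : m + n ≤ N) {q : ℝ × ℝ}
    (hq : q ∈ T) : Tendsto (pd m n v) (𝓝[S] q) (𝓝 (limJet S v q (m, n))) :=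
  tendsto_extendFrom (h.exists_lim m n hmn q hq)

lemma continuousAt_pd (hS : IsOpen S) (hv : ContDiffOn ℝ N v S) {m n : ℕ} (hmn : m + n ≤ N)
    {q : ℝ × ℝ} (hq : q ∈ S) : ContinuousAt (pd m n v) q :=
  ((contDiffOn_pd hS (K := 0) (hv.of_le (by norm_cast; omega))).continuousOn).continuousAt
    (hS.mem_nhds hq)

lemma extendFrom_of_mem (hS : IsOpen S) (hv : ContDiffOn ℝ N v S) {m n : ℕ} (hmn : m + n ≤ N)
    {q : ℝ × ℝ} (hq : q ∈ S) : extendFrom S (pd m n v) q = pd m n v q :=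
  extendFrom_eq (subset_closure hq)
    ((continuousAt_pd hS hv hmn hq).tendsto.mono_left inf_le_left)

lemma regularUpTo_of_subset (hS : IsOpen S) (hT : T ⊆ S) (hv : ContDiffOn ℝ N v S) :
    RegularUpTo T S N v :=
  ⟨hv, fun _ _ hmn _ hq ↦
    ⟨_, (continuousAt_pd hS hv hmn (hT hq)).tendsto.mono_left inf_le_left⟩⟩

lemma isSide_of_subset (hS : IsOpen S) (hT : T ⊆ S) : IsSide T S :=
  ⟨hS, fun _ hp ↦ locallyQuasiconvexAt_of_mem hS (hT hp), fun _ hp ↦ subset_closure (hT hp)⟩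

/-- Taylor's formula at points of `T`, locally uniform in the base point. -/
lemma IsSide.taylor (hS : IsSide T S) (hv : RegularUpTo T S N v) {p₀ : ℝ × ℝ} (hp₀ : p₀ ∈ T)
    {d : ℕ} (hd : d ≤ 3) :
    ∃ C ≥ 0, ∃ ρ > 0, ∀ p ∈ T, dist p p₀ < ρ → ∀ z ∈ T ∪ S, dist z p₀ < ρ →
      ∀ m n, m + n + d + 1 = N →
        |extendFrom S (pd m n v) z
            - taylorPoly d (fun k ↦ limJet S v p (m + k.1, n + k.2)) (z - p)|
          ≤ C * dist z p ^ (d + 1) := by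
  obtain ⟨C, hC, ρ, hρ, h⟩ := taylor_remainder hS.isOpen (hS.quasiconvex p₀ hp₀) hv.contDiffOn
    (fun m n hmn ↦ hv.exists_lim m n hmn.le p₀ hp₀) hd
  refine ⟨C, hC, ρ, hρ, fun p hp hpd z hz hzd m n hmn ↦ h p (hS.closure hp) hpd z ?_ hzd
    (fun m n hmn ↦ hv.exists_lim m n hmn.le p hp) (fun m n hmn ↦ ?_) m n hmn⟩
  · exact hz.elim (fun h ↦ hS.closure h) fun h ↦ subset_closure h
  · rcases hz with hz | hz
    · exact hv.exists_lim m n hmn.le z hz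
    · exact ⟨_, (continuousAt_pd hS.isOpen hv.contDiffOn hmn.le hz).tendsto.mono_left inf_le_left⟩

/-- One-sided limits are locally bounded. -/
lemma IsSide.limJet_bounded (hS : IsSide T S) (hv : RegularUpTo T S N v) {p₀ : ℝ × ℝ}
    (hp₀ : p₀ ∈ T) {m n : ℕ} (hmn : m + n ≤ N) :
    ∃ M, ∃ ρ > 0, ∀ p ∈ T, dist p p₀ < ρ → |limJet S v p (m, n)| ≤ M := by
  obtain ⟨M, ρ, hρ, h⟩ := exists_bound_of_tendsto (hv.tendsto hmn hp₀)
  refine ⟨M, ρ, hρ, fun p hp hpd ↦ ?_⟩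
  have : (𝓝[S] p).NeBot := mem_closure_iff_nhdsWithin_neBot.1 (hS.closure hp)
  refine le_of_tendsto (hv.tendsto hmn hp).abs ?_
  have h1 : ∀ᶠ z in 𝓝[S] p, dist z p₀ < ρ :=
    ((tendsto_id.mono_right inf_le_left : Tendsto id (𝓝[S] p) (𝓝 p)).dist
      tendsto_const_nhds).eventually_lt_const hpd
  filter_upwards [h1, self_mem_nhdsWithin] with z hz hzS using h z hzS hz

end

/-! ### The equation at the interface -/

lemma fderiv_sum_mul {a₁ b₁ a₂ b₂ a₃ b₃ a₄ b₄ : ℝ × ℝ → ℝ} {q : ℝ × ℝ}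
    (ha₁ : DifferentiableAt ℝ a₁ q) (hb₁ : DifferentiableAt ℝ b₁ q)
    (ha₂ : DifferentiableAt ℝ a₂ q) (hb₂ : DifferentiableAt ℝ b₂ q)
    (ha₃ : DifferentiableAt ℝ a₃ q) (hb₃ : DifferentiableAt ℝ b₃ q)
    (ha₄ : DifferentiableAt ℝ a₄ q) (hb₄ : DifferentiableAt ℝ b₄ q) (e : ℝ × ℝ) :
    fderiv ℝ (fun z ↦ a₁ z * b₁ z + a₂ z * b₂ z + a₃ z * b₃ z + a₄ z * b₄ z) q e
      = (a₁ q * fderiv ℝ b₁ q e + b₁ q * fderiv ℝ a₁ q e)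
        + (a₂ q * fderiv ℝ b₂ q e + b₂ q * fderiv ℝ a₂ q e)
        + (a₃ q * fderiv ℝ b₃ q e + b₃ q * fderiv ℝ a₃ q e)
        + (a₄ q * fderiv ℝ b₄ q e + b₄ q * fderiv ℝ a₄ q e) := by
  have h := (((ha₁.hasFDerivAt.mul hb₁.hasFDerivAt).add (ha₂.hasFDerivAt.mul hb₂.hasFDerivAt)).add
    (ha₃.hasFDerivAt.mul hb₃.hasFDerivAt)).add (ha₄.hasFDerivAt.mul hb₄.hasFDerivAt)
  have := congrArg (fun l ↦ l e) h.fderiv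
  exact this

section
variable {T S : Set (ℝ × ℝ)} {a u f : ℝ × ℝ → ℝ}

lemma pde_expanded (hS : IsOpen S) (ha : ContDiffOn ℝ (1 : ℕ) a S) (hu : ContDiffOn ℝ (2 : ℕ) u S)
    (hpde : ∀ q ∈ S, -(pdx (fun z ↦ a z * pdx u z) q + pdy (fun z ↦ a z * pdy u z) q) = f q)
    {q : ℝ × ℝ} (hq : q ∈ S) :
    a q * pd 2 0 u q + a q * pd 0 2 u q + pd 1 0 a q * pd 1 0 u q + pd 0 1 a q * pd 0 1 u q
      = -f q := by
  have hda : DifferentiableAt ℝ a q := differentiableAt_pd (m := 0) (n := 0) hS ha hq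
  have hdx : DifferentiableAt ℝ (pdx u) q := differentiableAt_pd (m := 1) (n := 0) hS hu hq
  have hdy : DifferentiableAt ℝ (pdy u) q := differentiableAt_pd (m := 0) (n := 1) hS hu hq
  have h1 : pdx (fun z ↦ a z * pdx u z) q = a q * pd 2 0 u q + pdx u q * pdx a q := by
    rw [pdx, fderiv_fun_mul hda hdx]; rfl
  have h2 : pdy (fun z ↦ a z * pdy u z) q = a q * pd 0 2 u q + pdy u q * pdy a q := by
    rw [pdy, fderiv_fun_mul hda hdy]; rfl
  rw [← hpde q hq, h1, h2]
  change _ + _ + pdx a q * pdx u q + pdy a q * pdy u q = _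
  ring

/-- The expanded equation holds near `q` and may be differentiated there; `-f` coincides locally
with the left side, whose derivative exists by the product rule. -/
lemma pde_derivatives (hS : IsOpen S) (ha : ContDiffOn ℝ (2 : ℕ) a S) (hu : ContDiffOn ℝ (3 : ℕ) u S)
    (hpde : ∀ q ∈ S, -(pdx (fun z ↦ a z * pdx u z) q + pdy (fun z ↦ a z * pdy u z) q) = f q)
    {q : ℝ × ℝ} (hq : q ∈ S) :
    (a q * pd 3 0 u q + pd 2 0 u q * pd 1 0 a q) + (a q * pd 1 2 u q + pd 0 2 u q * pd 1 0 a q)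
      + (pd 1 0 a q * pd 2 0 u q + pd 1 0 u q * pd 2 0 a q)
      + (pd 0 1 a q * pd 1 1 u q + pd 0 1 u q * pd 1 1 a q) = -pd 1 0 f q ∧
    (a q * pd 2 1 u q + pd 2 0 u q * pd 0 1 a q) + (a q * pd 0 3 u q + pd 0 2 u q * pd 0 1 a q)
      + (pd 1 0 a q * pd 1 1 u q + pd 1 0 u q * pd 1 1 a q)
      + (pd 0 1 a q * pd 0 2 u q + pd 0 1 u q * pd 0 2 a q) = -pd 0 1 f q := by
  have hev : (fun z ↦ a z * pd 2 0 u z + a z * pd 0 2 u z + pd 1 0 a z * pd 1 0 u z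
      + pd 0 1 a z * pd 0 1 u z) =ᶠ[𝓝 q] fun z ↦ -f z := by
    filter_upwards [hS.mem_nhds hq] with z hz
    exact pde_expanded hS (ha.of_le (by norm_num)) (hu.of_le (by norm_num)) hpde hz
  have da (m n : ℕ) (h : m + n + 1 ≤ 2) : DifferentiableAt ℝ (pd m n a) q :=
    differentiableAt_pd hS (ha.of_le (by exact_mod_cast h)) hq
  have du (m n : ℕ) (h : m + n + 1 ≤ 3) : DifferentiableAt ℝ (pd m n u) q :=
    differentiableAt_pd hS (hu.of_le (by exact_mod_cast h)) hq
  have ya (m n : ℕ) (h : m + n + 1 ≤ 2) : fderiv ℝ (pd m n a) q (0, 1) = pd m (n + 1) a q :=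
    pdy_pd hS (ha.of_le (by exact_mod_cast h)) hq
  have yu (m n : ℕ) (h : m + n + 1 ≤ 3) : fderiv ℝ (pd m n u) q (0, 1) = pd m (n + 1) u q :=
    pdy_pd hS (hu.of_le (by exact_mod_cast h)) hq
  have xa (m n : ℕ) : fderiv ℝ (pd m n a) q (1, 0) = pd (m + 1) n a q := congrFun (pdx_pd m n a) q
  have xu (m n : ℕ) : fderiv ℝ (pd m n u) q (1, 0) = pd (m + 1) n u q := congrFun (pdx_pd m n u) q
  have key (e : ℝ × ℝ) := fderiv_sum_mul (da 0 0 (by omega)) (du 2 0 (by omega)) (da 0 0 (by omega))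
    (du 0 2 (by omega)) (da 1 0 (by omega)) (du 1 0 (by omega)) (da 0 1 (by omega))
    (du 0 1 (by omega)) e
  constructor
  · have h := key (1, 0)
    have h' : fderiv ℝ (fun z ↦ -f z) q (1, 0) = -pd 1 0 f q := by rw [fderiv_fun_neg]; rfl
    simp only [xa, xu] at h
    simp only [pd_zero] at h
    rw [hev.fderiv_eq, h'] at h
    exact h.symm
  · have h := key (0, 1)
    have h' : fderiv ℝ (fun z ↦ -f z) q (0, 1) = -pd 0 1 f q := by rw [fderiv_fun_neg]; rfl
    rw [ya 0 0 (by omega), ya 1 0 (by omega), ya 0 1 (by omega), yu 2 0 (by omega),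
      yu 0 2 (by omega), yu 1 0 (by omega), yu 0 1 (by omega)] at h
    simp only [pd_zero] at h
    rw [hev.fderiv_eq, h'] at h
    exact h.symm

/-- The one-sided derivatives at the interface satisfy the reduction by the equation. -/
lemma IsSide.limJet_eq_fullJet (hS : IsSide T S) (ha : RegularUpTo T S 2 a)
    (hu : RegularUpTo T S 3 u) (hf : RegularUpTo T S 1 f)
    (hpde : ∀ q ∈ S, -(pdx (fun z ↦ a z * pdx u z) q + pdy (fun z ↦ a z * pdy u z) q) = f q)
    {p : ℝ × ℝ} (hp : p ∈ T) (hpos : limJet S a p (0, 0) ≠ 0) :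
    ∀ k ∈ Lam 3, limJet S u p k = fullJet (limJet S a p) (limJet S u p) (limJet S f p) k := by
  have : (𝓝[S] p).NeBot := mem_closure_iff_nhdsWithin_neBot.1 (hS.closure hp)
  have ta (m n : ℕ) (h : m + n ≤ 2) := ha.tendsto (m := m) (n := n) h hp
  have tu (m n : ℕ) (h : m + n ≤ 3) := hu.tendsto (m := m) (n := n) h hp
  have tf (m n : ℕ) (h : m + n ≤ 1) := hf.tendsto (m := m) (n := n) h hp
  -- Identities valid inside `S` pass to the one-sided limits at `p`.
  have lim {L R : ℝ × ℝ → ℝ} {l r : ℝ} (hL : Tendsto L (𝓝[S] p) (𝓝 l))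
      (hR : Tendsto R (𝓝[S] p) (𝓝 r)) (h : ∀ z ∈ S, L z = R z) : l = r :=
    tendsto_nhds_unique (hL.congr' (eventually_nhdsWithin_of_forall h)) hR
  have a00 := ta 0 0 (by omega)
  have a10 := ta 1 0 (by omega)
  have a01 := ta 0 1 (by omega)
  have a20 := ta 2 0 (by omega)
  have a11 := ta 1 1 (by omega)
  have a02 := ta 0 2 (by omega)
  have u10 := tu 1 0 (by omega)
  have u01 := tu 0 1 (by omega)
  have u20 := tu 2 0 (by omega)
  have u11 := tu 1 1 (by omega)
  have u02 := tu 0 2 (by omega)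
  have e0 := lim ((((a00.mul u20).add (a00.mul u02)).add (a10.mul u10)).add (a01.mul u01))
    (tf 0 0 (by omega)).neg fun z hz ↦ pde_expanded hS.isOpen (ha.contDiffOn.of_le (by norm_num))
      (hu.contDiffOn.of_le (by norm_num)) hpde hz
  have e1 := lim (((((a00.mul (tu 3 0 (by omega))).add (u20.mul a10)).add
    ((a00.mul (tu 1 2 (by omega))).add (u02.mul a10))).add ((a10.mul u20).add (u10.mul a20))).add
    ((a01.mul u11).add (u01.mul a11))) (tf 1 0 (by omega)).neg
    fun z hz ↦ (pde_derivatives hS.isOpen ha.contDiffOn hu.contDiffOn hpde hz).1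
  have e2 := lim (((((a00.mul (tu 2 1 (by omega))).add (u20.mul a01)).add
    ((a00.mul (tu 0 3 (by omega))).add (u02.mul a01))).add ((a10.mul u11).add (u10.mul a11))).add
    ((a01.mul u02).add (u01.mul a02))) (tf 0 1 (by omega)).neg
    fun z hz ↦ (pde_derivatives hS.isOpen ha.contDiffOn hu.contDiffOn hpde hz).2
  have h20 : limJet S u p (2, 0) = red20 (limJet S a p) (limJet S u p) (limJet S f p) := by
    rw [red20]
    field_simp
    linear_combination e0
  intro k hk
  rw [show Lam 3 = {(0, 0), (0, 1), (1, 0), (0, 2), (1, 1), (2, 0),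
    (0, 3), (1, 2), (2, 1), (3, 0)} by decide] at hk
  simp only [Finset.mem_insert, Finset.mem_singleton] at hk
  rcases hk with rfl | rfl | rfl | rfl | rfl | rfl | rfl | rfl | rfl | rfl
  any_goals rfl
  · exact h20
  · simp only [fullJet, ← h20]
    field_simp
    linear_combination e2
  · simp only [fullJet, ← h20]
    field_simp
    linear_combination e1

end

/-! ### Expansions along the interface -/

/-- `AX - A'X' = (A - A')(X - X') + (A - A')X' + A'(X - X')`. Only the polynomial approximations
`A'`, `X'` have to be continuous, not the extended functions `A`, `X`. -/
lemma isBigO_mul_sub_mul {A A' X X' b : ℝ → ℝ} {n : ℕ}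
    (hA : (fun t ↦ A t - A' t) =O[𝓝 0] fun t ↦ t ^ n)
    (hX : (fun t ↦ X t - X' t) =O[𝓝 0] fun t ↦ t ^ n)
    (hA' : ContinuousAt A' 0) (hX' : ContinuousAt X' 0) (hb : ContinuousAt b 0) :
    (fun t ↦ A t * (X t * b t) - A' t * (X' t * b t)) =O[𝓝 0] fun t ↦ t ^ n := by
  have one {y : ℝ → ℝ} (hy : ContinuousAt y 0) : y =O[𝓝 0] fun _ ↦ (1 : ℝ) :=
    hy.tendsto.isBigO_one ℝ
  have hX1 : (fun t ↦ X t - X' t) =O[𝓝 0] fun _ ↦ (1 : ℝ) := hX.trans (one (by fun_prop))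
  have h1 := (hA.mul hX1).mul (one hb)
  have h2 := (hA.mul (one hX')).mul (one hb)
  have h3 := ((one hA').mul hX).mul (one hb)
  simp only [mul_one, one_mul] at h1 h2 h3
  refine ((h1.add h2).add h3).congr_left fun t ↦ ?_
  ring

section
variable {T S : Set (ℝ × ℝ)} {v a u : ℝ × ℝ → ℝ} {N : ℕ} {p : ℝ × ℝ} {r s : ℝ → ℝ}

/-- The displacement `(r t, s t)` is `O(t)`, so the spatial remainder becomes a power of `t`. -/
lemma IsSide.taylor_curve (hS : IsSide T S) (hv : RegularUpTo T S N v) (hp : p ∈ T)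
    (hr : ContDiffAt ℝ ∞ r 0) (hs : ContDiffAt ℝ ∞ s 0) (r0 : r 0 = 0) (s0 : s 0 = 0)
    (hT : ∀ᶠ t in 𝓝 (0 : ℝ), p + (r t, s t) ∈ T) {m n d : ℕ} (hd : d ≤ 3) (hmn : m + n + d + 1 = N) :
    (fun t ↦ extendFrom S (pd m n v) (p + (r t, s t))
      - taylorPoly d (fun k ↦ limJet S v p (m + k.1, n + k.2)) (r t, s t))
      =O[𝓝 0] fun t ↦ t ^ (d + 1) := by
  obtain ⟨C, hC, ρ, hρ, h⟩ := hS.taylor hv hp hd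
  have hrs : (fun t ↦ (r t, s t)) =O[𝓝 0] fun t ↦ t := by
    have h1 := (hr.differentiableAt (by simp)).isBigO_sub
    have h2 := (hs.differentiableAt (by simp)).isBigO_sub
    simp only [r0, s0, sub_zero] at h1 h2
    exact h1.prod_left h2
  have hcont : Tendsto (fun t ↦ p + (r t, s t)) (𝓝 0) (𝓝 p) := by
    have := (hr.continuousAt.prodMk hs.continuousAt).tendsto.const_add p
    have hp0 : p + ((0 : ℝ), (0 : ℝ)) = p := add_zero p
    simpa [r0, s0, hp0] using this
  refine Asymptotics.IsBigO.trans (Asymptotics.IsBigO.of_bound C ?_) ((hrs.norm_left).pow (d + 1))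
  filter_upwards [hT, hcont.eventually (Metric.ball_mem_nhds p hρ)] with t h1 h2
  have := h p hp (by simpa using hρ) (p + (r t, s t)) (Or.inl h1) h2 m n hmn
  rw [add_sub_cancel_left, dist_eq_norm, add_sub_cancel_left] at this
  rwa [Real.norm_eq_abs, norm_pow, norm_norm]

/-- The gradient of the cubic Taylor polynomial of `u` consists of the quadratic Taylor polynomials
of the first derivatives, with remainder `O(t^3)`. The quadratic polynomial of `a` has the same
accuracy, so the product loses nothing further. -/
lemma IsSide.flux_curve (hS : IsSide T S) (ha : RegularUpTo T S 3 a) (hu : RegularUpTo T S 4 u)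
    (hp : p ∈ T) (hr : ContDiffAt ℝ ∞ r 0) (hs : ContDiffAt ℝ ∞ s 0) (r0 : r 0 = 0) (s0 : s 0 = 0)
    (hT : ∀ᶠ t in 𝓝 (0 : ℝ), p + (r t, s t) ∈ T) :
    (fun t ↦ (extendFrom S a (p + (r t, s t)) * (extendFrom S (pdx u) (p + (r t, s t)) * deriv s t)
        - extendFrom S a (p + (r t, s t)) * (extendFrom S (pdy u) (p + (r t, s t)) * deriv r t))
      - fluxAlong (limJet S a p) r s (taylorPoly 3 (limJet S u p)) t) =O[𝓝 0] fun t ↦ t ^ 3 := by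
  have h0 := hS.taylor_curve ha hp hr hs r0 s0 hT (m := 0) (n := 0) (d := 2) (by omega) rfl
  have hx := hS.taylor_curve hu hp hr hs r0 s0 hT (m := 1) (n := 0) (d := 2) (by omega) rfl
  have hy := hS.taylor_curve hu hp hr hs r0 s0 hT (m := 0) (n := 1) (d := 2) (by omega) rfl
  have hc (J : Jet) := (contDiffAt_taylorPoly_curve hr hs 2 J).continuousAt
  have h1 := isBigO_mul_sub_mul h0 hx (hc _) (hc _) (contDiffAt_deriv hs).continuousAt
  have h2 := isBigO_mul_sub_mul h0 hy (hc _) (hc _) (contDiffAt_deriv hr).continuousAt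
  refine (h1.sub h2).congr_left fun t ↦ ?_
  rw [fluxAlong_taylorPoly]
  simp only [zero_add, Nat.add_comm 1]
  change (extendFrom S a (p + (r t, s t)) * (extendFrom S (pdx u) (p + (r t, s t)) * deriv s t) - _)
    - (extendFrom S a (p + (r t, s t)) * (extendFrom S (pdy u) (p + (r t, s t)) * deriv r t) - _) = _
  ring

lemma fluxAlong_sum {ι : Type*} (α : Jet) (A : Finset ι) (w : ι → ℝ) {Q : ι → ℝ × ℝ → ℝ}
    (hQ : ∀ i, Differentiable ℝ (Q i)) (t : ℝ) :
    fluxAlong α r s (fun z ↦ ∑ i ∈ A, w i * Q i z) t = ∑ i ∈ A, w i * fluxAlong α r s (Q i) t := by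
  have hd (e q : ℝ × ℝ) : fderiv ℝ (fun z ↦ ∑ i ∈ A, w i * Q i z) q e
      = ∑ i ∈ A, w i * fderiv ℝ (Q i) q e := by
    rw [fderiv_fun_sum fun i _ ↦ ((hQ i).differentiableAt.const_mul (w i)),
      sum_apply]
    refine Finset.sum_congr rfl fun i _ ↦ ?_
    rw [fderiv_const_mul (hQ i).differentiableAt]
    rfl
  simp only [fluxAlong, pdx, pdy, hd, Finset.sum_mul, Finset.mul_sum, ← Finset.sum_sub_distrib]
  refine Finset.sum_congr rfl fun i _ ↦ ?_
  ring

lemma fluxAlong_add (α : Jet) {Q Q' : ℝ × ℝ → ℝ} (hQ : Differentiable ℝ Q)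
    (hQ' : Differentiable ℝ Q') (t : ℝ) :
    fluxAlong α r s (fun z ↦ Q z + Q' z) t = fluxAlong α r s Q t + fluxAlong α r s Q' t := by
  simp only [fluxAlong, pdx, pdy, fderiv_fun_add hQ.differentiableAt hQ'.differentiableAt,
    add_apply]
  ring

lemma coef_curve_fullJet (hr : ContDiffAt ℝ ∞ r 0) (hs : ContDiffAt ℝ ∞ s 0) (α U F : Jet) (q : ℕ) :
    coef (fun t ↦ taylorPoly 3 (fullJet α U F) (r t, s t)) q
      = ∑ k ∈ Lam1 3, U k * coef (fun t ↦ G α k (r t, s t)) q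
        + ∑ k ∈ Lam 1, F k * coef (fun t ↦ H α k (r t, s t)) q := by
  have hG (k) : ContDiffAt ℝ ∞ (fun t ↦ G α k (r t, s t)) 0 := contDiffAt_taylorPoly_curve hr hs 3 _
  have hH (k) : ContDiffAt ℝ ∞ (fun t ↦ H α k (r t, s t)) 0 := contDiffAt_taylorPoly_curve hr hs 3 _
  simp only [taylorPoly_fullJet]
  rw [coef_add (ContDiffAt.sum fun k _ ↦ contDiffAt_const.mul (hG k))
      (ContDiffAt.sum fun k _ ↦ contDiffAt_const.mul (hH k)),
    coef_sum _ fun k _ ↦ contDiffAt_const.mul (hG k),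
    coef_sum _ fun k _ ↦ contDiffAt_const.mul (hH k)]
  simp only [coef_const_mul]

lemma coef_fluxAlong_fullJet (hr : ContDiffAt ℝ ∞ r 0) (hs : ContDiffAt ℝ ∞ s 0) (α U F : Jet)
    (q : ℕ) :
    coef (fluxAlong α r s (taylorPoly 3 (fullJet α U F))) q
      = ∑ k ∈ Lam1 3, U k * coef (fluxAlong α r s (G α k)) q
        + ∑ k ∈ Lam 1, F k * coef (fluxAlong α r s (H α k)) q := by
  have dG (k) : Differentiable ℝ (G α k) := differentiable_taylorPoly 3 _
  have dH (k) : Differentiable ℝ (H α k) := differentiable_taylorPoly 3 _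
  have hG (k) : ContDiffAt ℝ ∞ (fluxAlong α r s (G α k)) 0 := contDiffAt_fluxAlong hr hs α _
  have hH (k) : ContDiffAt ℝ ∞ (fluxAlong α r s (H α k)) 0 := contDiffAt_fluxAlong hr hs α _
  have h1 : taylorPoly 3 (fullJet α U F) = _ := funext (taylorPoly_fullJet α U F)
  have h2 : fluxAlong α r s (taylorPoly 3 (fullJet α U F))
      = fun t ↦ ∑ k ∈ Lam1 3, U k * fluxAlong α r s (G α k) t
        + ∑ k ∈ Lam 1, F k * fluxAlong α r s (H α k) t := by
    ext t
    rw [h1, fluxAlong_add α (by fun_prop) (by fun_prop), fluxAlong_sum α _ _ dG,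
      fluxAlong_sum α _ _ dH]
  rw [h2, coef_add (ContDiffAt.sum fun k _ ↦ contDiffAt_const.mul (hG k))
      (ContDiffAt.sum fun k _ ↦ contDiffAt_const.mul (hH k)),
    coef_sum _ fun k _ ↦ contDiffAt_const.mul (hG k),
    coef_sum _ fun k _ ↦ contDiffAt_const.mul (hH k)]
  simp only [coef_const_mul]

end

lemma taylorPoly_congr {K : ℕ} {J J' : Jet} (h : ∀ k ∈ Lam K, J k = J' k) :
    taylorPoly K J = taylorPoly K J' := by
  ext z
  exact Finset.sum_congr rfl fun k hk ↦ by rw [h k hk]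

namespace Problem

variable {P : Problem} {u : ℝ × ℝ → ℝ}

/-! ### The two sides of the interface -/

lemma isOpen_Ω : IsOpen P.Ω := isOpen_Ioo.prod isOpen_Ioo

lemma Γ_subset_Ω : P.Γ ⊆ P.Ω := fun _ h ↦ h.1

lemma isSide_Ω : IsSide P.Γ P.Ω := isSide_of_subset isOpen_Ω Γ_subset_Ω

lemma Admissible.contDiffAt_ψ (hP : P.Admissible) {q : ℝ × ℝ} (hq : q ∈ P.Ω) :
    ContDiffAt ℝ ∞ P.ψ q :=
  hP.smooth_ψ.contDiffAt (isOpen_Ω.mem_nhds hq)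

lemma Admissible.isSide_Ωp (hP : P.Admissible) : IsSide P.Γ P.Ωp := by
  have hev (p) (hp : p ∈ P.Γ) : ∀ᶠ z in 𝓝 p, z ∈ P.Ωp ↔ 0 < P.ψ z := by
    filter_upwards [isOpen_Ω.mem_nhds hp.1] with z hz
    exact ⟨fun h ↦ h.2, fun h ↦ ⟨hz, h⟩⟩
  have hc (p) (hp : p ∈ P.Γ) : ContDiffAt ℝ 1 P.ψ p := (hP.contDiffAt_ψ hp.1).of_le (by simp)
  exact ⟨hP.smooth_ψ.continuousOn.isOpen_inter_preimage isOpen_Ω isOpen_Ioi,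
    fun p hp ↦ locallyQuasiconvexAt_of_regular (hc p hp) (hP.regular p hp) (hev p hp),
    fun p hp ↦ mem_closure_of_regular (hc p hp) (hP.regular p hp) hp.2 (hev p hp)⟩

lemma Admissible.isSide_Ωm (hP : P.Admissible) : IsSide P.Γ P.Ωm := by
  have hev (p) (hp : p ∈ P.Γ) : ∀ᶠ z in 𝓝 p, z ∈ P.Ωm ↔ 0 < -P.ψ z := by
    filter_upwards [isOpen_Ω.mem_nhds hp.1] with z hz
    exact ⟨fun h ↦ neg_pos.2 h.2, fun h ↦ ⟨hz, neg_pos.1 h⟩⟩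
  have hc (p) (hp : p ∈ P.Γ) : ContDiffAt ℝ 1 (fun z ↦ -P.ψ z) p :=
    ((hP.contDiffAt_ψ hp.1).of_le (by simp)).neg
  have hreg (p) (hp : p ∈ P.Γ) : pdx (fun z ↦ -P.ψ z) p ≠ 0 ∨ pdy (fun z ↦ -P.ψ z) p ≠ 0 := by
    simpa [pdx, pdy, fderiv_fun_neg] using hP.regular p hp
  exact ⟨hP.smooth_ψ.continuousOn.isOpen_inter_preimage isOpen_Ω isOpen_Iio,
    fun p hp ↦ locallyQuasiconvexAt_of_regular (hc p hp) (hreg p hp) (hev p hp),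
    fun p hp ↦ mem_closure_of_regular (hc p hp) (hreg p hp) (by simp [hp.2]) (hev p hp)⟩

lemma SmoothUpToInterface.regularUpTo {S : Set (ℝ × ℝ)} {g : ℝ × ℝ → ℝ}
    (h : P.SmoothUpToInterface S g) (N : ℕ) : RegularUpTo P.Γ S N g :=
  ⟨h.1.of_le (by exact_mod_cast le_top), fun m n _ q hq ↦ h.2 m n q hq⟩

lemma PiecewiseRegular.regularUpTo {S : Set (ℝ × ℝ)} (h : PiecewiseRegular S u)
    (hS : P.Γ ⊆ closure S) : RegularUpTo P.Γ S 5 u :=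
  ⟨h.1, fun m n hmn _ hq ↦ (h.2 m n hmn).exists_tendsto_nhdsWithin (hS hq)⟩

lemma regularUpTo_of_contDiffOn {g : ℝ × ℝ → ℝ} (h : ContDiffOn ℝ ∞ g P.Ω) (N : ℕ) :
    RegularUpTo P.Γ P.Ω N g :=
  regularUpTo_of_subset isOpen_Ω Γ_subset_Ω (h.of_le (by exact_mod_cast le_top))

lemma limJet_Ω {g : ℝ × ℝ → ℝ} (h : ContDiffOn ℝ ∞ g P.Ω) {p : ℝ × ℝ} (hp : p ∈ P.Ω)
    (k : ℕ × ℕ) : limJet P.Ω g p k = pd k.1 k.2 g p :=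
  extendFrom_of_mem isOpen_Ω (N := k.1 + k.2) (h.of_le (by exact_mod_cast le_top)) le_rfl hp

/-! ### Local parametrizations -/

section
variable {p : ℝ × ℝ} {r s : ℝ → ℝ}

lemma IsLocalParam.contDiffAt_r (h : P.IsLocalParam p r s) : ContDiffAt ℝ ∞ r 0 := by
  obtain ⟨ε, hε, h1, -⟩ := h.param
  exact h1.contDiffAt (Ioo_mem_nhds (by linarith) hε)

lemma IsLocalParam.contDiffAt_s (h : P.IsLocalParam p r s) : ContDiffAt ℝ ∞ s 0 := by
  obtain ⟨ε, hε, -, h1, -⟩ := h.param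
  exact h1.contDiffAt (Ioo_mem_nhds (by linarith) hε)

lemma IsLocalParam.eventually_mem (h : P.IsLocalParam p r s) :
    ∀ᶠ t in 𝓝 (0 : ℝ), p + (r t, s t) ∈ P.Γ := by
  obtain ⟨ε, hε, -, -, h1⟩ := h.param
  filter_upwards [Ioo_mem_nhds (by linarith : -ε < 0) hε] with t ht using (h1 t ht).1

lemma IsLocalParam.eventually_speed (h : P.IsLocalParam p r s) :
    ∀ᶠ t in 𝓝 (0 : ℝ), 0 < deriv r t ^ 2 + deriv s t ^ 2 := by
  obtain ⟨ε, hε, -, -, h1⟩ := h.param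
  filter_upwards [Ioo_mem_nhds (by linarith : -ε < 0) hε] with t ht using (h1 t ht).2

/-- A vector orthogonal to `(ξ, η)` is a multiple of `(η, -ξ)`. The orientation makes the factor
positive, and normalization removes it. -/
lemma normal_eq_of_orthogonal {x y ξ η : ℝ} (h : ξ * x + η * y = 0) (hpos : 0 < x * η - y * ξ)
    (hs : 0 < ξ ^ 2 + η ^ 2) :
    x / √(x ^ 2 + y ^ 2) = η / √(ξ ^ 2 + η ^ 2) ∧ y / √(x ^ 2 + y ^ 2) = -ξ / √(ξ ^ 2 + η ^ 2) := by
  set l := (x * η - y * ξ) / (ξ ^ 2 + η ^ 2) with hl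
  have hl0 : 0 < l := by positivity
  have hx : x = l * η := by
    rw [hl]; field_simp; linear_combination ξ * h
  have hy : y = -(l * ξ) := by
    rw [hl]; field_simp; linear_combination η * h
  have hsq : √(x ^ 2 + y ^ 2) = l * √(ξ ^ 2 + η ^ 2) := by
    rw [hx, hy, show (l * η) ^ 2 + (-(l * ξ)) ^ 2 = l ^ 2 * (ξ ^ 2 + η ^ 2) by ring,
      Real.sqrt_mul (sq_nonneg l), Real.sqrt_sq hl0.le]
  have hpos' : 0 < √(ξ ^ 2 + η ^ 2) := Real.sqrt_pos.2 hs
  rw [hsq]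
  constructor
  · rw [hx]; field_simp
  · rw [hy]; field_simp

/-- The unit normal along the curve. -/
lemma IsLocalParam.eventually_normal (hP : P.Admissible) (h : P.IsLocalParam p r s) (hp : p ∈ P.Γ) :
    ∀ᶠ t in 𝓝 (0 : ℝ), P.normal (p + (r t, s t))
      = (deriv s t / √(deriv r t ^ 2 + deriv s t ^ 2),
        -deriv r t / √(deriv r t ^ 2 + deriv s t ^ 2)) := by
  have hr := h.contDiffAt_r
  have hs := h.contDiffAt_s
  have hcont : ContinuousAt (fun t ↦ p + (r t, s t)) 0 := by
    exact continuousAt_const.add (hr.continuousAt.prodMk hs.continuousAt)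
  have hγ0 : p + (r 0, s 0) = p := by rw [h.r_zero, h.s_zero]; simp
  have hpd (m n : ℕ) : ContinuousAt (fun t ↦ pd m n P.ψ (p + (r t, s t))) 0 := by
    refine ContinuousAt.comp (f := fun t ↦ p + (r t, s t)) ?_ hcont
    rw [hγ0]
    exact continuousAt_pd isOpen_Ω (N := m + n) (hP.smooth_ψ.of_le (by exact_mod_cast le_top))
      le_rfl hp.1
  -- The orientation is prescribed only at `t = 0` and persists nearby by continuity.
  have hor : ∀ᶠ t in 𝓝 (0 : ℝ),
      0 < pdx P.ψ (p + (r t, s t)) * deriv s t - pdy P.ψ (p + (r t, s t)) * deriv r t := by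
    have hc := ((hpd 1 0).mul (contDiffAt_deriv hs).continuousAt).sub
      ((hpd 0 1).mul (contDiffAt_deriv hr).continuousAt)
    have := h.oriented
    rw [← hγ0] at this
    exact hc.eventually_const_lt this
  have hdr : ∀ᶠ t in 𝓝 (0 : ℝ), DifferentiableAt ℝ r t := by
    filter_upwards [(hr.of_infty 1).eventually (by simp)] with t ht
      using ht.differentiableAt (by simp)
  have hds : ∀ᶠ t in 𝓝 (0 : ℝ), DifferentiableAt ℝ s t := by
    filter_upwards [(hs.of_infty 1).eventually (by simp)] with t ht
      using ht.differentiableAt (by simp)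
  filter_upwards [hor, hdr, hds, h.eventually_speed, h.eventually_mem.eventually_nhds]
    with t h1 h2 h3 h4 h5
  have hmem := h5.self_of_nhds
  have hd : HasDerivAt (fun t ↦ P.ψ (p + (r t, s t)))
      (fderiv ℝ P.ψ (p + (r t, s t)) (deriv r t, deriv s t)) t := by
    have hψ := ((hP.contDiffAt_ψ hmem.1).differentiableAt (by simp)).hasFDerivAt
    exact hψ.comp_hasDerivAt t ((h2.hasDerivAt.prodMk h3.hasDerivAt).const_add p)
  have hzero : (fun t ↦ P.ψ (p + (r t, s t))) =ᶠ[𝓝 t] fun _ ↦ (0 : ℝ) := by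
    filter_upwards [h5] with τ hτ using hτ.2
  -- The level set function vanishes along the curve, so its gradient is orthogonal to the velocity.
  have horth : deriv r t * pdx P.ψ (p + (r t, s t)) + deriv s t * pdy P.ψ (p + (r t, s t)) = 0 := by
    rw [fderiv_eq_pd] at hd
    exact hd.unique ((hasDerivAt_const t (0 : ℝ)).congr_of_eventuallyEq hzero)
  obtain ⟨e1, e2⟩ := normal_eq_of_orthogonal horth h1 h4
  exact Prod.ext e1 e2

/-- The flux condition in terms of the tangent. -/
lemma flux_jump_eq (hP : P.Admissible) (hu : P.IsSolution u) {q : ℝ × ℝ} (hq : q ∈ P.Γ) {ξ η : ℝ}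
    (hpos : 0 < ξ ^ 2 + η ^ 2)
    (hn : P.normal q = (η / √(ξ ^ 2 + η ^ 2), -ξ / √(ξ ^ 2 + η ^ 2))) :
    (P.limP P.a q * (P.limP (pdx u) q * η) - P.limP P.a q * (P.limP (pdy u) q * ξ))
      - (P.limM P.a q * (P.limM (pdx u) q * η) - P.limM P.a q * (P.limM (pdy u) q * ξ))
      = P.g₂ q * √(ξ ^ 2 + η ^ 2) := by
  have hj := hu.jump_flux q hq
  -- The jump is taken of the whole flux with the normal frozen at `q`; the limits of the separate
  -- factors exist, so the limit splits into their products.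
  have lim {S : Set (ℝ × ℝ)} (hS : IsSide P.Γ S) (ha : RegularUpTo P.Γ S 0 P.a)
      (hu : RegularUpTo P.Γ S 5 u) (x y : ℝ) :
      extendFrom S (fun z ↦ P.a z * pdx u z * x + P.a z * pdy u z * y) q
        = extendFrom S P.a q * extendFrom S (pdx u) q * x
          + extendFrom S P.a q * extendFrom S (pdy u) q * y := by
    refine extendFrom_eq (hS.closure hq) ?_
    have h0 := ha.tendsto (m := 0) (n := 0) le_rfl hq
    have h1 := hu.tendsto (m := 1) (n := 0) (by omega) hq
    have h2 := hu.tendsto (m := 0) (n := 1) (by omega) hq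
    exact ((h0.mul h1).mul tendsto_const_nhds).add ((h0.mul h2).mul tendsto_const_nhds)
  rw [jump, limP, limM, lim hP.isSide_Ωp (hP.smooth_aP.regularUpTo 0)
      (hu.regP.regularUpTo hP.isSide_Ωp.closure),
    lim hP.isSide_Ωm (hP.smooth_aM.regularUpTo 0)
      (hu.regM.regularUpTo hP.isSide_Ωm.closure), hn] at hj
  have hpos' : 0 < √(ξ ^ 2 + η ^ 2) := Real.sqrt_pos.2 hpos
  rw [← hj]
  simp only [limP, limM]
  field_simp
  ring

lemma jetP_eq_fullJet (hP : P.Admissible) (hu : P.IsSolution u) (hp : p ∈ P.Γ) :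
    ∀ k ∈ Lam 3, P.jetP u p k = fullJet (P.jetP P.a p) (P.jetP u p) (P.jetP P.f p) k :=
  hP.isSide_Ωp.limJet_eq_fullJet (hP.smooth_aP.regularUpTo 2)
    ((hu.regP.regularUpTo hP.isSide_Ωp.closure).mono (by omega)) (hP.smooth_fP.regularUpTo 1)
    (fun q hq ↦ hu.pde q ⟨hq.1, fun hq' ↦ hq.2.ne' hq'.2⟩) hp (hP.pos_aP p hp).ne'

lemma jetM_eq_fullJet (hP : P.Admissible) (hu : P.IsSolution u) (hp : p ∈ P.Γ) :
    ∀ k ∈ Lam 3, P.jetM u p k = fullJet (P.jetM P.a p) (P.jetM u p) (P.jetM P.f p) k :=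
  hP.isSide_Ωm.limJet_eq_fullJet (hP.smooth_aM.regularUpTo 2)
    ((hu.regM.regularUpTo hP.isSide_Ωm.closure).mono (by omega)) (hP.smooth_fM.regularUpTo 1)
    (fun q hq ↦ hu.pde q ⟨hq.1, fun hq' ↦ hq.2.ne hq'.2⟩) hp (hP.pos_aM p hp).ne'

/-- The derivatives on the negative side are obtained from the data by the transmission recursion. -/
theorem transmission (hP : P.Admissible) (hu : P.IsSolution u) (hp : p ∈ P.Γ)
    (h : P.IsLocalParam p r s) (v w : ℝ) (d : Finset (ℤ × ℤ)) {j : ℕ × ℕ} (hj : j ∈ Lam1 3) :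
    (P.config p r s v w d).minusJet (P.jetP u p) (P.jetP P.f p) (P.jetM P.f p)
      (fun k ↦ pd k.1 k.2 P.g₁ p) (fun k ↦ pd k.1 k.2 P.g₂ p) 3 j = P.jetM u p j := by
  have hr := h.contDiffAt_r
  have hs := h.contDiffAt_s
  have r0 := h.r_zero
  have s0 := h.s_zero
  have hT := h.eventually_mem
  have hspeed := h.eventually_speed.self_of_nhds
  have hSp := hP.isSide_Ωp
  have hSm := hP.isSide_Ωm
  have hup := hu.regP.regularUpTo hSp.closure
  have hum := hu.regM.regularUpTo hSm.closure
  have jetp := jetP_eq_fullJet hP hu hp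
  have jetm := jetM_eq_fullJet hP hu hp
  have smooth (K : ℕ) (J : Jet) := contDiffAt_taylorPoly_curve hr hs K J
  have hσ : ContDiffAt ℝ ∞ (fun t ↦ √(deriv r t ^ 2 + deriv s t ^ 2)) 0 :=
    (((contDiffAt_deriv hr).pow 2).add ((contDiffAt_deriv hs).pow 2)).sqrt hspeed.ne'
  have hg₁ := regularUpTo_of_contDiffOn hP.smooth_g₁
  have hg₂ := regularUpTo_of_contDiffOn hP.smooth_g₂
  -- the expansion of the jump of the solution
  have hO₁ : (fun t ↦ taylorPoly 3 (P.jetP u p) (r t, s t) - taylorPoly 3 (P.jetM u p) (r t, s t)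
      - taylorPoly 3 (fun k ↦ pd k.1 k.2 P.g₁ p) (r t, s t)) =O[𝓝 0] fun t ↦ t ^ 4 := by
    have e1 := hSp.taylor_curve (hup.mono (by omega : 4 ≤ 5)) hp hr hs r0 s0 hT (m := 0) (n := 0)
      (d := 3) le_rfl rfl
    have e2 := hSm.taylor_curve (hum.mono (by omega : 4 ≤ 5)) hp hr hs r0 s0 hT (m := 0) (n := 0)
      (d := 3) le_rfl rfl
    have e3 := isSide_Ω.taylor_curve (hg₁ 4) hp hr hs r0 s0 hT (m := 0) (n := 0)
      (d := 3) le_rfl rfl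
    simp only [zero_add, limJet_Ω hP.smooth_g₁ hp.1] at e1 e2 e3
    refine ((e2.sub e1).add e3).congr' ?_ EventuallyEq.rfl
    filter_upwards [hT] with t ht
    have e4 := hu.jump_u _ ht
    have e5 : extendFrom P.Ω (pd 0 0 P.g₁) (p + (r t, s t)) = P.g₁ (p + (r t, s t)) :=
      extendFrom_of_mem isOpen_Ω (hg₁ 0).contDiffOn le_rfl ht.1
    rw [e5, ← e4, jump]
    change P.limM u _ - taylorPoly 3 (P.jetM u p) _ - (P.limP u _ - taylorPoly 3 (P.jetP u p) _)
      + _ = _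
    ring
  -- The flux condition multiplied by the speed, which clears the normalization of the normal; it is
  -- expanded to one order less.
  have hO₂ : (fun t ↦ fluxAlong (P.jetP P.a p) r s (taylorPoly 3 (P.jetP u p)) t
      - fluxAlong (P.jetM P.a p) r s (taylorPoly 3 (P.jetM u p)) t
      - taylorPoly 2 (fun k ↦ pd k.1 k.2 P.g₂ p) (r t, s t) * √(deriv r t ^ 2 + deriv s t ^ 2))
      =O[𝓝 0] fun t ↦ t ^ 3 := by
    have e1 := hSp.flux_curve (hP.smooth_aP.regularUpTo 3) (hup.mono (by omega)) hp hr hs r0 s0 hT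
    have e2 := hSm.flux_curve (hP.smooth_aM.regularUpTo 3) (hum.mono (by omega)) hp hr hs r0 s0 hT
    have e3 := isSide_Ω.taylor_curve (hg₂ 3) hp hr hs r0 s0 hT (m := 0) (n := 0)
      (d := 2) (by omega) rfl
    simp only [zero_add, limJet_Ω hP.smooth_g₂ hp.1] at e3
    have e3' := e3.mul (hσ.continuousAt.tendsto.isBigO_one ℝ)
    simp only [mul_one] at e3'
    refine ((e2.sub e1).add e3').congr' ?_ EventuallyEq.rfl
    filter_upwards [hT, h.eventually_speed, h.eventually_normal hP hp] with t ht hv hn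
    have e4 := flux_jump_eq hP hu ht hv hn
    have e5 : extendFrom P.Ω (pd 0 0 P.g₂) (p + (r t, s t)) = P.g₂ (p + (r t, s t)) :=
      extendFrom_of_mem isOpen_Ω (hg₂ 0).contDiffOn le_rfl ht.1
    rw [e5, sub_mul, ← e4]
    change P.limM P.a _ * _ - _ - fluxAlong (P.jetM P.a p) r s (taylorPoly 3 (P.jetM u p)) t
      - (P.limP P.a _ * _ - _ - fluxAlong (P.jetP P.a p) r s (taylorPoly 3 (P.jetP u p)) t) + _ = _
    simp only [limP, limM]
    ring
  refine (congrFun (Config.minusJet_eq (uM := P.jetM u p) hr hs r0 s0 (hP.pos_aM p hp).ne' hspeed.ne'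
    (hu.jump_u p hp) ?_ ?_ 3 le_rfl) j).trans (if_pos hj)
  · intro q hq
    have hz := coef_eq_zero_of_isBigO (((smooth 3 _).sub (smooth 3 _)).sub (smooth 3 _)) hO₁ q
      (by omega)
    rw [coef_sub ((smooth 3 _).sub (smooth 3 _)) (smooth 3 _), coef_sub (smooth 3 _) (smooth 3 _),
      coef_taylorPoly_curve hr hs 3 (fun k ↦ pd k.1 k.2 P.g₁ p), taylorPoly_congr jetp,
      taylorPoly_congr jetm, coef_curve_fullJet hr hs, coef_curve_fullJet hr hs] at hz
    simp only [Config.rhsU, Finset.sum_sub_distrib]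
    change _ + ∑ k ∈ Lam 1, P.jetP P.f p k * (P.config p r s v w d).hP k q
      - (_ + ∑ k ∈ Lam 1, P.jetM P.f p k * (P.config p r s v w d).hM k q)
      - ∑ k ∈ Lam 3, pd k.1 k.2 P.g₁ p / (k.1 ! * k.2 !) * (P.config p r s v w d).rc k q = 0 at hz
    change ∑ k ∈ Lam1 3, P.jetP u p k * coef (fun t ↦ G (P.jetP P.a p) k (r t, s t)) q
      - ∑ k ∈ Lam1 3, P.jetM u p k * coef (fun t ↦ G (P.jetM P.a p) k (r t, s t)) q = _
    linarith
  · intro q hq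
    have hsm := contDiffAt_fluxAlong hr hs
    have hz := coef_eq_zero_of_isBigO (((hsm _ _).sub (hsm _ _)).sub ((smooth 2 _).mul hσ)) hO₂ q
      (by omega)
    have hg : coef (fun t ↦ taylorPoly 2 (fun k ↦ pd k.1 k.2 P.g₂ p) (r t, s t)
        * √(deriv r t ^ 2 + deriv s t ^ 2)) q
        = ∑ k ∈ Lam 2, pd k.1 k.2 P.g₂ p / (k.1 ! * k.2 !) * (P.config p r s v w d).rtc k q := by
      simp only [taylorPoly, Finset.sum_mul, mul_assoc]
      rw [coef_sum _ fun k _ ↦ contDiffAt_const.mul ((hr.pow _).mul ((hs.pow _).mul hσ))]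
      refine Finset.sum_congr rfl fun k _ ↦ ?_
      rw [coef_const_mul]
      simp only [← mul_assoc]
      rfl
    rw [coef_sub ((hsm _ _).sub (hsm _ _)) ((smooth 2 _).mul hσ), coef_sub (hsm _ _) (hsm _ _), hg,
      taylorPoly_congr jetp, taylorPoly_congr jetm, coef_fluxAlong_fullJet hr hs,
      coef_fluxAlong_fullJet hr hs] at hz
    simp only [Config.rhsFlux, Finset.sum_sub_distrib]
    change _ + ∑ k ∈ Lam 1, P.jetP P.f p k * (P.config p r s v w d).htP k q
      - (_ + ∑ k ∈ Lam 1, P.jetM P.f p k * (P.config p r s v w d).htM k q) - _ = 0 at hz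
    change ∑ k ∈ Lam1 3, P.jetP u p k * coef (fluxAlong (P.jetP P.a p) r s (G (P.jetP P.a p) k)) q
      - ∑ k ∈ Lam1 3, P.jetM u p k * coef (fluxAlong (P.jetM P.a p) r s (G (P.jetM P.a p) k)) q = _
    linarith

end

end Problem

namespace Problem

variable {P : Problem} {u : ℝ × ℝ → ℝ}

/-! ### The consistency error -/

section
variable {p : ℝ × ℝ} {r s : ℝ → ℝ}

lemma sum_mul_taylorPoly_fullJet (A : Finset (ℤ × ℤ)) (C : ℤ × ℤ → ℝ) (ν : ℤ × ℤ → ℝ × ℝ)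
    (α U F : Jet) :
    ∑ e ∈ A, C e * taylorPoly 3 (fullJet α U F) (ν e)
      = ∑ k ∈ Lam1 3, U k * ∑ e ∈ A, C e * G α k (ν e)
        + ∑ k ∈ Lam 1, F k * ∑ e ∈ A, C e * H α k (ν e) := by
  simp only [taylorPoly_fullJet, mul_add, Finset.sum_add_distrib, Finset.mul_sum]
  congr 1 <;>
  · rw [Finset.sum_comm]
    exact Finset.sum_congr rfl fun k _ ↦ Finset.sum_congr rfl fun e _ ↦ by ring

/-- The consistency error is the residual of the system plus the Taylor remainders. -/
lemma consistencyError_eq (hP : P.Admissible) (hu : P.IsSolution u) (hp : p ∈ P.Γ)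
    (h : P.IsLocalParam p r s) (v w : ℝ) {d : Finset (ℤ × ℤ)} (hd : d ⊆ stencil) (C : ℤ × ℤ → ℝ)
    (t : ℝ) :
    P.consistencyError u p (P.config p r s v w d) C t
      = ∑ k ∈ Lam1 3, P.jetP u p k * (P.config p r s v w d).I C t k
        + ∑ e ∈ d, C e * (P.exactValue u (gridPoint (p + (v * t, w * t)) t e)
            - taylorPoly 3 (P.jetP u p) (gridPoint (p + (v * t, w * t)) t e - p))
        + ∑ e ∈ stencil \ d, C e * (P.exactValue u (gridPoint (p + (v * t, w * t)) t e)
            - taylorPoly 3 (P.jetM u p) (gridPoint (p + (v * t, w * t)) t e - p)) := by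
  set c := P.config p r s v w d with hc
  have hnode (e : ℤ × ℤ) : gridPoint (p + (v * t, w * t)) t e - p = c.node t e := by
    ext
    · simp only [gridPoint, Config.node, hc, config, Prod.fst_sub, Prod.fst_add]; ring
    · simp only [gridPoint, Config.node, hc, config, Prod.snd_sub, Prod.snd_add]; ring
  have hplus : ∑ e ∈ d, C e * taylorPoly 3 (P.jetP u p) (c.node t e)
      = ∑ k ∈ Lam1 3, P.jetP u p k * c.IP C t k + ∑ k ∈ Lam 1, P.jetP P.f p k * c.JP0 C t k := by
    rw [taylorPoly_congr (jetP_eq_fullJet hP hu hp)]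
    exact sum_mul_taylorPoly_fullJet _ _ _ _ _ _
  have hminus : ∑ e ∈ stencil \ d, C e * taylorPoly 3 (P.jetM u p) (c.node t e)
      = ∑ j ∈ Lam1 3, P.jetM u p j * c.IM C t j + ∑ k ∈ Lam 1, P.jetM P.f p k * c.JM0 C t k := by
    rw [taylorPoly_congr (jetM_eq_fullJet hP hu hp)]
    exact sum_mul_taylorPoly_fullJet _ _ _ _ _ _
  have swap (A : Finset (ℕ × ℕ)) (x : ℕ × ℕ → ℝ) (τ : ℕ × ℕ → ℕ × ℕ → ℝ) :
      ∑ j ∈ Lam1 3, (∑ k ∈ A, x k * τ j k) * c.IM C t j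
        = ∑ k ∈ A, x k * ∑ j ∈ Lam1 3, c.IM C t j * τ j k := by
    simp only [Finset.sum_mul, Finset.mul_sum]
    rw [Finset.sum_comm]
    exact Finset.sum_congr rfl fun k _ ↦ Finset.sum_congr rfl fun e _ ↦ by ring
  -- Here the derivatives of `u₋` are eliminated. The terms with the data are those subtracted as
  -- the right-hand side of the scheme, so only the derivatives of `u₊` survive, with factors
  -- completing `IP` to `I`.
  have htrans : ∑ j ∈ Lam1 3, P.jetM u p j * c.IM C t j
      = ∑ k ∈ Lam1 3, P.jetP u p k * ∑ j ∈ Lam1 3, c.IM C t j * c.Tu j k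
        + (∑ k ∈ Lam 1, P.jetP P.f p k * ∑ j ∈ Lam1 3, c.IM C t j * c.TfP j k
          + ∑ k ∈ Lam 1, P.jetM P.f p k * ∑ j ∈ Lam1 3, c.IM C t j * c.TfM j k)
        + ∑ k ∈ Lam 3, pd k.1 k.2 P.g₁ p * c.Jg1 C t k
        + ∑ k ∈ Lam 2, pd k.1 k.2 P.g₂ p * c.Jg2 C t k := by
    simp only [Config.Jg1, Config.Jg2, ← swap, ← Finset.sum_add_distrib, ← add_mul]
    refine Finset.sum_congr rfl fun j hj ↦ ?_
    rw [← transmission hP hu hp h v w d hj, Config.minusJet_eq_sum]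
  simp only [hnode, mul_sub, Finset.sum_sub_distrib, hplus, hminus, htrans]
  rw [consistencyError, schemeRhs, ← Finset.sum_sdiff hd]
  simp only [Config.I, Config.JP, Config.JM, mul_add, Finset.sum_add_distrib]
  change ∑ e ∈ stencil \ d, C e * P.exactValue u (gridPoint (p + (v * t, w * t)) t e)
    + ∑ e ∈ d, C e * P.exactValue u (gridPoint (p + (v * t, w * t)) t e) - _ = _
  ring

end

/-- The Taylor remainder of the exact solution at `z`, for the base point `p`, and the derivatives
at `p` are controlled by `K`. -/
def TaylorBound (P : Problem) (u : ℝ × ℝ → ℝ) (K : ℝ) (p z : ℝ × ℝ) : Prop :=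
  (0 ≤ P.ψ z → |P.exactValue u z - taylorPoly 3 (P.jetP u p) (z - p)| ≤ K * dist z p ^ 4) ∧
  (P.ψ z < 0 → |P.exactValue u z - taylorPoly 3 (P.jetM u p) (z - p)| ≤ K * dist z p ^ 4) ∧
  ∀ k ∈ Lam1 3, |P.jetP u p k| ≤ K

lemma TaylorBound.mono {K K' : ℝ} (hK : K ≤ K') {p z : ℝ × ℝ} (h : TaylorBound P u K p z) :
    TaylorBound P u K' p z :=
  ⟨fun hz ↦ (h.1 hz).trans (by gcongr), fun hz ↦ (h.2.1 hz).trans (by gcongr),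
    fun k hk ↦ (h.2.2 k hk).trans hK⟩

lemma taylorBound_local (hP : P.Admissible) (hu : P.IsSolution u) {p₀ : ℝ × ℝ} (hp₀ : p₀ ∈ P.Γ) :
    ∃ K ≥ 0, ∃ ρ > 0, ∀ p ∈ P.Γ, dist p p₀ < ρ → ∀ z, dist z p₀ < ρ → TaylorBound P u K p z := by
  have hSp := hP.isSide_Ωp
  have hSm := hP.isSide_Ωm
  have hup := (hu.regP.regularUpTo hSp.closure).mono (by omega : 4 ≤ 5)
  have hum := (hu.regM.regularUpTo hSm.closure).mono (by omega : 4 ≤ 5)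
  obtain ⟨C₁, hC₁, ρ₁, hρ₁, h₁⟩ := hSp.taylor hup hp₀ (d := 3) le_rfl
  obtain ⟨C₂, hC₂, ρ₂, hρ₂, h₂⟩ := hSm.taylor hum hp₀ (d := 3) le_rfl
  obtain ⟨ρ₃, hρ₃, h₃⟩ := Metric.isOpen_iff.1 (isOpen_Ω (P := P)) p₀ hp₀.1
  have hbd : ∀ k ∈ Lam1 3, ∃ M, ∃ ρ > 0, ∀ p ∈ P.Γ, dist p p₀ < ρ → |P.jetP u p k| ≤ M :=
    fun k hk ↦ hSp.limJet_bounded hup hp₀ (by have := (mem_Lam1.1 hk).1; omega)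
  choose! M R hR hM using hbd
  have hne : (Lam1 3).Nonempty := ⟨(0, 0), by decide⟩
  refine ⟨C₁ + C₂ + ∑ k ∈ Lam1 3, |M k|, by positivity,
    min (min ρ₁ ρ₂) (min ρ₃ ((Lam1 3).inf' hne R)), ?_, fun p hp hpd z hzd ↦ ⟨?_, ?_, ?_⟩⟩
  · have : 0 < (Lam1 3).inf' hne R := by rw [Finset.lt_inf'_iff]; exact hR
    positivity
  all_goals simp only [lt_min_iff] at hpd hzd
  · intro hz
    have hzΩ : z ∈ P.Ω := h₃ hzd.2.1
    -- A point with `ψ = 0` lies on the interface and counts as positive; Taylor's formula on the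
    -- closed positive side covers it.
    have hmem : z ∈ P.Γ ∪ P.Ωp := hz.eq_or_lt.imp (fun h ↦ ⟨hzΩ, h.symm⟩) fun h ↦ ⟨hzΩ, h⟩
    have := h₁ p hp hpd.1.1 z hmem hzd.1.1 0 0 rfl
    simp only [zero_add] at this
    rw [exactValue, if_pos hz]
    refine this.trans ?_
    have : C₁ ≤ C₁ + C₂ + ∑ k ∈ Lam1 3, |M k| := by
      rw [add_assoc]; exact le_add_of_nonneg_right (by positivity)
    gcongr
  · intro hz
    have := h₂ p hp hpd.1.2 z (Or.inr ⟨h₃ hzd.2.1, hz⟩) hzd.1.2 0 0 rfl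
    simp only [zero_add] at this
    rw [exactValue, if_neg hz.not_ge]
    refine this.trans ?_
    have h4 : 0 ≤ ∑ k ∈ Lam1 3, |M k| := by positivity
    have : C₂ ≤ C₁ + C₂ + ∑ k ∈ Lam1 3, |M k| := by linarith
    gcongr
  · intro k hk
    have h4 := hM k hk p hp (hpd.2.2.trans_le (Finset.inf'_le R hk))
    have h5 : |M k| ≤ ∑ k ∈ Lam1 3, |M k| :=
      Finset.single_le_sum (f := fun k ↦ |M k|) (fun _ _ ↦ abs_nonneg _) hk
    linarith [le_abs_self (M k)]

lemma taylorBound_compact (hP : P.Admissible) (hu : P.IsSolution u) {S : Set (ℝ × ℝ)}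
    (hS : IsCompact S) (hSΓ : S ⊆ P.Γ) :
    ∃ K ≥ 0, ∃ ρ > 0, ∀ p ∈ S, ∀ z, dist z p < ρ → TaylorBound P u K p z := by
  refine hS.induction_on (p := fun S ↦ ∃ K ≥ 0, ∃ ρ > 0, ∀ p ∈ S, ∀ z, dist z p < ρ →
    TaylorBound P u K p z) ⟨0, le_rfl, 1, one_pos, by simp⟩ ?_ ?_ ?_
  · rintro A B hAB ⟨K, hK, ρ, hρ, h⟩
    exact ⟨K, hK, ρ, hρ, fun p hp ↦ h p (hAB hp)⟩
  · rintro A B ⟨K, hK, ρ, hρ, h⟩ ⟨K', hK', ρ', hρ', h'⟩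
    refine ⟨max K K', le_max_of_le_left hK, min ρ ρ', lt_min hρ hρ', fun p hp z hz ↦ ?_⟩
    rw [lt_min_iff] at hz
    rcases hp with hp | hp
    · exact (h p hp z hz.1).mono (le_max_left _ _)
    · exact (h' p hp z hz.2).mono (le_max_right _ _)
  · intro p₀ hp₀
    obtain ⟨K, hK, ρ, hρ, h⟩ := taylorBound_local hP hu (hSΓ hp₀)
    -- The local bound holds for base points and points near the fixed `p₀`. Halving the radius
    -- makes it valid on balls centred at the moving base point.
    refine ⟨S ∩ Metric.ball p₀ (ρ / 2), inter_mem_nhdsWithin S (Metric.ball_mem_nhds _ (by positivity)),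
      K, hK, ρ / 2, by positivity, fun p hp z hz ↦ h p (hSΓ hp.1) ?_ z ?_⟩
    · have := Metric.mem_ball.1 hp.2
      linarith
    · have := Metric.mem_ball.1 hp.2
      have := dist_triangle z p p₀
      linarith

lemma dP_subset_stencil (x : ℝ × ℝ) (h : ℝ) : P.dP x h ⊆ stencil := Finset.filter_subset _ _

/-- The distance on the product is the maximum of the coordinate distances, and each offset is less
than one plus at most one step. -/
lemma dist_gridPoint_le (p : ℝ × ℝ) {v w h : ℝ} (hv : |v| < 1) (hw : |w| < 1) (hh : 0 < h)
    {e : ℤ × ℤ} (he : e ∈ stencil) : dist (gridPoint (p + (v * h, w * h)) h e) p ≤ 2 * h := by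
  obtain ⟨h1, h2⟩ := Finset.mem_product.1 he
  have key (x : ℝ) (y : ℤ) {a : ℝ} (hx : |x| < 1) (hy : y ∈ Finset.Icc (-1) 1) :
      dist (a + x * h + y * h) a ≤ 2 * h := by
    have hy' := Finset.mem_Icc.1 hy
    have e1 : (-1 : ℝ) ≤ y := by exact_mod_cast hy'.1
    have e2 : (y : ℝ) ≤ 1 := by exact_mod_cast hy'.2
    have hx' := abs_lt.1 hx
    rw [Real.dist_eq, abs_le]
    constructor <;> nlinarith
  exact max_le (key v e.1 hv h1) (key w e.2 hw h2)

/-- The consistency error is of fourth order, uniformly for base points in a compact set. -/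
theorem consistencyError_uniform (hP : P.Admissible) (hu : P.IsSolution u) {S : Set (ℝ × ℝ)}
    (hS : IsCompact S) (hSΓ : S ⊆ P.Γ) (B : ℝ) : ∃ K : ℝ, ∃ h₀ > 0,
      ∀ p ∈ S, ∀ r s : ℝ → ℝ, P.IsLocalParam p r s →
      ∀ v w : ℝ, |v| < 1 → |w| < 1 →
      ∀ h : ℝ, 0 < h → h < h₀ →
      ∀ C : ℤ × ℤ → ℝ, (∀ e ∈ stencil, |C e| ≤ B) →
        (∀ k ∈ Lam1 3,
          |(P.config p r s v w (P.dP (p + (v * h, w * h)) h)).I C h k| ≤ B * h ^ 4) →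
        |P.consistencyError u p (P.config p r s v w (P.dP (p + (v * h, w * h)) h)) C h|
          ≤ K * h ^ 4 := by
  obtain ⟨K, hK, ρ, hρ, hT⟩ := taylorBound_compact hP hu hS hSΓ
  -- One term `K * B` for each residual `I_{m,n}` and one term `B * (K * 2 ^ 4)` for each Taylor
  -- remainder, at distance at most `2h`. The bound `ρ / 2` on `h` keeps the stencil within distance
  -- `ρ` of `p`.
  refine ⟨∑ _k ∈ Lam1 3, K * B + ∑ _e ∈ stencil, B * (K * 2 ^ 4), ρ / 2, by positivity,
    fun p hp r s hrs v w hv hw h hh hhρ C hC hI ↦ ?_⟩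
  have hB : 0 ≤ B := (abs_nonneg _).trans (hC (0, 0) (by decide))
  have hgood (e : ℤ × ℤ) (he : e ∈ stencil) :
      TaylorBound P u K p (gridPoint (p + (v * h, w * h)) h e) :=
    hT p hp _ ((dist_gridPoint_le p hv hw hh he).trans_lt (by linarith))
  have hrem {e : ℤ × ℤ} (he : e ∈ stencil) {x : ℝ}
      (hx : |x| ≤ K * dist (gridPoint (p + (v * h, w * h)) h e) p ^ 4) :
      |C e * x| ≤ B * (K * 2 ^ 4) * h ^ 4 := by
    have h2 : K * dist (gridPoint (p + (v * h, w * h)) h e) p ^ 4 ≤ K * (2 * h) ^ 4 := by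
      have := dist_gridPoint_le p hv hw hh he
      gcongr
    rw [abs_mul]
    calc |C e| * |x| ≤ B * (K * (2 * h) ^ 4) :=
          mul_le_mul (hC e he) (hx.trans h2) (abs_nonneg _) hB
      _ = _ := by ring
  have hd := P.dP_subset_stencil (p + (v * h, w * h)) h
  rw [consistencyError_eq hP hu (hSΓ hp) hrs v w hd, add_mul, Finset.sum_mul, Finset.sum_mul,
    ← Finset.sum_sdiff hd, add_assoc]
  refine (abs_add_le _ _).trans (add_le_add ?_ ?_)
  · refine (Finset.abs_sum_le_sum_abs _ _).trans (Finset.sum_le_sum fun k hk ↦ ?_)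
    rw [abs_mul, mul_assoc]
    exact mul_le_mul ((hgood (0, 0) (by decide)).2.2 k hk) (hI k hk) (abs_nonneg _) hK
  · rw [add_comm]
    refine (abs_add_le _ _).trans (add_le_add ?_ ?_) <;>
      refine (Finset.abs_sum_le_sum_abs _ _).trans (Finset.sum_le_sum fun e he ↦ ?_)
    · have he' := Finset.mem_sdiff.1 he
      refine hrem he'.1 ((hgood e he'.1).2.1 (not_le.1 fun hψ ↦ he'.2 ?_))
      exact Finset.mem_filter.2 ⟨he'.1, hψ⟩
    · have he' := Finset.mem_filter.1 he
      exact hrem he'.1 ((hgood e he'.1).1 he'.2)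

/-- Third-order consistency for polynomial stencil coefficients. -/
theorem consistencyError_isBigO (hP : P.Admissible) (hu : P.IsSolution u) {p : ℝ × ℝ} (hp : p ∈ P.Γ)
    {r s : ℝ → ℝ} (h : P.IsLocalParam p r s) {v w : ℝ} (hv : |v| < 1) (hw : |w| < 1)
    {d : Finset (ℤ × ℤ)} {C : ℤ × ℤ → Polynomial ℝ}
    (hC : ∀ k ∈ Lam1 3, (fun t : ℝ ↦ (P.config p r s v w d).I (fun e ↦ (C e).eval t) t k)
      =O[𝓝 0] fun t : ℝ ↦ t ^ 4) :
    (fun t : ℝ ↦ P.consistencyError u p (P.config p r s v w d) (fun e ↦ (C e).eval t) t)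
      =O[𝓝[>] 0 ⊓ 𝓟 {t : ℝ | P.dP (p + (v * t, w * t)) t = d}] fun t : ℝ ↦ t ^ 4 := by
  choose! b hb using fun k hk ↦ (hC k hk).bound
  -- A single bound for the stencil values near `h = 0` and for the constants in the system, as the
  -- uniform estimate requires; it is then applied to the compact set `{p}`.
  set B : ℝ := ∑ k ∈ Lam1 3, |b k| + ∑ e ∈ stencil, (|(C e).eval 0| + 1) with hBdef
  obtain ⟨K, h₀, hh₀, hK⟩ := consistencyError_uniform hP hu (isCompact_singleton (x := p))
    (singleton_subset_iff.2 hp) B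
  have hev₁ : ∀ᶠ t in 𝓝 (0 : ℝ), ∀ e ∈ stencil, |(C e).eval t| ≤ B := by
    rw [Finset.eventually_all]
    intro e he
    filter_upwards [(C e).continuous.continuousAt.abs.eventually_lt_const (lt_add_one _)] with t ht
    have h1 : |(C e).eval 0| + 1 ≤ ∑ e ∈ stencil, (|(C e).eval 0| + 1) :=
      Finset.single_le_sum (f := fun e ↦ |(C e).eval 0| + 1) (fun _ _ ↦ by positivity) he
    have h2 : 0 ≤ ∑ k ∈ Lam1 3, |b k| := by positivity
    linarith
  have hev₂ : ∀ᶠ t in 𝓝 (0 : ℝ), ∀ k ∈ Lam1 3,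
      |(P.config p r s v w d).I (fun e ↦ (C e).eval t) t k| ≤ B * t ^ 4 := by
    rw [Finset.eventually_all]
    intro k hk
    filter_upwards [hb k hk] with t ht
    rw [Real.norm_eq_abs, Real.norm_eq_abs, abs_of_nonneg (by positivity : 0 ≤ t ^ 4)] at ht
    refine ht.trans ?_
    have h1 : |b k| ≤ ∑ k ∈ Lam1 3, |b k| :=
      Finset.single_le_sum (f := fun k ↦ |b k|) (fun _ _ ↦ abs_nonneg _) hk
    have h2 : 0 ≤ ∑ e ∈ stencil, (|(C e).eval 0| + 1) := by positivity
    have h3 : b k ≤ B := by linarith [le_abs_self (b k)]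
    gcongr
  refine Asymptotics.IsBigO.of_bound K ?_
  have hle : 𝓝[>] (0 : ℝ) ⊓ 𝓟 {t : ℝ | P.dP (p + (v * t, w * t)) t = d} ≤ 𝓝[>] 0 := inf_le_left
  filter_upwards [hle.trans inf_le_left hev₁, hle.trans inf_le_left hev₂, hle self_mem_nhdsWithin,
    hle.trans inf_le_left (Iio_mem_nhds hh₀), mem_inf_of_right (mem_principal_self _)]
    with t h1 h2 h3 h4 h5
  have h5 : P.dP (p + (v * t, w * t)) t = d := h5
  have := hK p rfl r s h v w hv hw t h3 h4 (fun e ↦ (C e).eval t) h1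
  -- Along these mesh sizes the actual splitting of the stencil is the prescribed `d`, so both
  -- estimates concern the same configuration.
  rw [h5] at this
  rw [Real.norm_eq_abs, Real.norm_eq_abs, abs_of_nonneg (by positivity : 0 ≤ t ^ 4)]
  exact this h2

end Problem

end InterfaceScheme

end

open InterfaceScheme in
theorem mainTheorem3 (P : Problem) (hP : P.Admissible) (u : ℝ × ℝ → ℝ) (hu : P.IsSolution u) :
    (∀ p ∈ P.Γ, ∀ r s : ℝ → ℝ, P.IsLocalParam p r s →
      ∀ v w : ℝ, |v| < 1 → |w| < 1 →
      ∀ d ⊆ stencil, d.Nonempty → (stencil \ d).Nonempty →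
        (∃ C : ℤ × ℤ → Polynomial ℝ, (P.config p r s v w d).IsNontrivialSolution C) ∧
        ∀ C : ℤ × ℤ → Polynomial ℝ, (P.config p r s v w d).IsNontrivialSolution C →
          (fun h : ℝ ↦ P.consistencyError u p (P.config p r s v w d) (fun e ↦ (C e).eval h) h)
            =O[𝓝[>] 0 ⊓ 𝓟 {h : ℝ | P.dP (p + (v * h, w * h)) h = d}] fun h : ℝ ↦ h ^ 4) ∧
    (∀ S : Set (ℝ × ℝ), IsCompact S → S ⊆ P.Γ → ∀ B : ℝ, ∃ K : ℝ, ∃ h₀ > 0,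
      ∀ p ∈ S, ∀ r s : ℝ → ℝ, P.IsLocalParam p r s →
      ∀ v w : ℝ, |v| < 1 → |w| < 1 →
      ∀ h : ℝ, 0 < h → h < h₀ → P.IsIrregular (p + (v * h, w * h)) h →
      ∀ C : ℤ × ℤ → ℝ, (∀ e ∈ stencil, |C e| ≤ B) →
        (∀ k ∈ Lam1 3,
          |(P.config p r s v w (P.dP (p + (v * h, w * h)) h)).I C h k| ≤ B * h ^ 4) →
        |P.consistencyError u p (P.config p r s v w (P.dP (p + (v * h, w * h)) h)) C h|
          ≤ K * h ^ 4) := by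
  refine ⟨fun p hp r s hrs v w hv hw d hd _ _ ↦
    ⟨(P.config p r s v w d).exists_isNontrivialSolution hd, fun C hC ↦
      Problem.consistencyError_isBigO hP hu hp hrs hv hw hC.system⟩, fun S hS hSΓ B ↦ ?_⟩
  obtain ⟨K, h₀, hh₀, h⟩ := Problem.consistencyError_uniform hP hu hS hSΓ B
  exact ⟨K, h₀, hh₀, fun p hp r s hrs v w hv hw t ht ht₀ _ C hC hI ↦
    h p hp r s hrs v w hv hw t ht ht₀ C hC hI⟩
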